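/- Let $N\ge 1$, let $\ell_1,\dots,\ell_N,\delta_1,\dots,\delta_N\in\mathbb C$ with $2\ell_k\notin\{0,-1,-2,\dots\}$ for all $k$. For variables $z_i,z_j$ put $z_{ij}=z_i-z_j$, let $\mathbb P_{ij}$ be the operator exchanging $z_i$ and $z_j$ in polynomials, and let $$\mathcal R^{+}_{ij}(u_+|v_+,v_-)=\frac{\Gamma(v_+-v_-)}{\Gamma(u_+-v_-)}\,\frac{\Gamma(z_{ji}\partial_j+u_+-v_-)}{\Gamma(z_{ji}\partial_j+v_+-v_-)},\qquad \mathcal R^{-}_{ij}(u_+,u_-|v_-)=\frac{\Gamma(u_+-u_-)}{\Gamma(u_+-v_-)}\,\frac{\Gamma(z_{ij}\partial_i+u_+-v_-)}{\Gamma(z_{ij}\partial_i+u_+-u_-)},$$ $$\check{\mathbb R}_{ij}(u_+,u_-|v_+,v_-)=\mathcal R^{+}_{ij}(u_+|v_+,u_-)\,\mathcal R^{-}_{ij}(u_+,u_-|v_-),$$ where $\frac{\Gamma(b)}{\Gamma(a)}\frac{\Gamma(z_{ij}\partial_i+a)}{\Gamma(z_{ij}\partial_i+b)}$ is the operator on polynomials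 acting as $\frac{a(a+1)\cdots(a+n-1)}{b(b+1)\cdots(b+n-1)}$ on the eigenspace of $z_{ij}\partial_i$ with eigenvalue $n\in\{0,1,2,\dots\}$; it is defined for $b\notin\{0,-1,-2,\dots\}$. For an operator $\mathbb A$ on $\mathbb C[z_0,z_1,\dots,z_N]$ its trace over the auxiliary space $V_0=\mathbb C[z_0]$ is the operator $$(\operatorname{tr}_{V_0}\mathbb A)\Psi=\sum_{m\ge 0}\tfrac1{m!}\,\partial_0^m\,\mathbb A\,z_0^m\,\Psi\Big|_{z_0=0},\qquad \Psi\in\mathbb C[z_1,\dots,z_N],$$ which is said to exist if for every $\Psi$ the series of each coefficient converges absolutely (and the sums are the coefficients of a polynomial). Put $$\mathbf Q(u_1|u_2)=\operatorname{tr}_{V_0}\mathbb R_{10}(u_1|u_2)\cdots\mathbb R_{N0}(u_1|u_2),\qquad \mathbf Q_\pm(u)=\operatorname{tr}_{V_0}\mathbb P_{10}\mathcal R^\pm_{10}(u+\delta_1)\cdots\mathbb P_{N0}\mathcal R^\pm_{N0}(u+\delta_N),$$ $$\mathbb R_{k0}(u_1|u_2)=\frac{\Gamma(\ell_k+1-u_1-\delta_k)}{\Gamma(\ell_k+u_2+\delta_k)}\,\mathbb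 P_{k0}\,\frac{\Gamma(z_{0k}\partial_0+2\ell_k)}{\Gamma(z_{0k}\partial_0+\ell_k+1-u_1-\delta_k)}\,\frac{\Gamma(z_{k0}\partial_k+\ell_k+u_2+\delta_k)}{\Gamma(z_{k0}\partial_k+2\ell_k)},$$ $$\mathcal R^{-}_{k0}(u)=\frac{\Gamma(2\ell_k)}{\Gamma(u+\ell_k)}\frac{\Gamma(z_{k0}\partial_k+u+\ell_k)}{\Gamma(z_{k0}\partial_k+2\ell_k)},\qquad \mathcal R^{+}_{k0}(u)=\frac{\Gamma(1+\ell_k-u)}{\Gamma(2\ell_k)}\frac{\Gamma(z_{0k}\partial_0+2\ell_k)}{\Gamma(z_{0k}\partial_0+1+\ell_k-u)},$$ and let $\mathbb P\Psi(z_1,\dots,z_N)=\Psi(z_2,\dots,z_N,z_1)$. Call $u$ regular if $1+\ell_k-\delta_k-u\notin\{0,-1,-2,\dots\}$ for all $k$. Then: (a) For all complex $u_\pm,v_\pm,w_\pm$ with $u_+-u_-,\ v_+-u_-,\ w_+-u_-\notin\{0,-1,\dots\}$ one has on $\mathbb C[z_1,z_2,z_3]$ $$\mathcal R^{-}_{12}(v_+,v_-|w_-)\check{\mathbb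 R}_{23}(u_+,u_-|w_+,w_-)\check{\mathbb R}_{12}(u_+,u_-|v_+,v_-)=\check{\mathbb R}_{23}(u_+,u_-|w_+,v_-)\check{\mathbb R}_{12}(u_+,u_-|v_+,w_-)\mathcal R^{-}_{23}(v_+,v_-|w_-)$$ if also $v_+-v_-\notin\{0,-1,\dots\}$, and $$\mathcal R^{+}_{12}(v_+|w_+,w_-)\check{\mathbb R}_{23}(u_+,u_-|w_+,w_-)\check{\mathbb R}_{12}(u_+,u_-|v_+,v_-)=\check{\mathbb R}_{23}(u_+,u_-|v_+,w_-)\check{\mathbb R}_{12}(u_+,u_-|w_+,v_-)\mathcal R^{+}_{23}(v_+|w_+,w_-)$$ if also $w_+-w_-\notin\{0,-1,\dots\}$. (b) The trace $\mathbf Q_-(u)$ exists for every $u$. For regular $u_1$, the trace $\mathbf Q_+(u_1)$ exists if $\operatorname{Re}\sum_k 2\ell_k>1$; and for every $u_2$ the trace $\mathbf Q(u_1|u_2)$ exists if and only if $\mathbf Q_+(u_1)$ does. (c) For regular $u_1,v_1$ and arbitrary $u_2,v_2$ such that the traces $\mathbf Q(u_1|u_2)$, $\mathbf Q(v_1|v_2)$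 exist, $$\mathbf Q(u_1|u_2)\mathbf Q(v_1|v_2)=\mathbf Q(v_1|u_2)\mathbf Q(u_1|v_2)=\mathbf Q(u_1|v_2)\mathbf Q(v_1|u_2).$$ (d) For regular $u_1$ such that $\mathbf Q_+(u_1)$ exists and arbitrary $u_2$, $\mathbf Q(u_1|u_2)=\mathbf Q_+(u_1)\,\mathbb P\,\mathbf Q_-(u_2)$. (e) For regular $u_1,v_1$ such that $\mathbf Q_+(u_1)$, $\mathbf Q_+(v_1)$ exist and arbitrary $u_2$, $$\mathbf Q_+(u_1)\,\mathbb P\,\mathbf Q_-(u_2)\,\mathbf Q_+(v_1)=\mathbf Q_+(v_1)\,\mathbb P\,\mathbf Q_-(u_2)\,\mathbf Q_+(u_1),$$ and for regular $v_1$ such that $\mathbf Q_+(v_1)$ exists and arbitrary $u_2,v_2$, $$\mathbf Q_-(u_2)\,\mathbf Q_+(v_1)\,\mathbb P\,\mathbf Q_-(v_2)=\mathbf Q_-(v_2)\,\mathbf Q_+(v_1)\,\mathbb P\,\mathbf Q_-(u_2).$$ -/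

import Mathlib

open MvPolynomial

/-- `a` is not one of the poles `0, -1, -2, …` of the Gamma function. -/
def NotGammaPole (a : ℂ) : Prop := ∀ n : ℕ, a ≠ -(n : ℂ)

/-- The ratio of Pochhammer symbols `(a)_n / (b)_n`, where `(a)_n = a (a + 1) ⋯ (a + n - 1)`. -/
noncomputable def pochRatio (a b : ℂ) (n : ℕ) : ℂ :=
  (ascPochhammer ℂ n).eval a / (ascPochhammer ℂ n).eval b

theorem gamma_add_nat {a : ℂ} (ha : NotGammaPole a) (n : ℕ) :
    Complex.Gamma ((n : ℂ) + a) = (ascPochhammer ℂ n).eval a * Complex.Gamma a := by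
  induction n with
  | zero => simp
  | succ n ih =>
    have h : (n : ℂ) + a ≠ 0 := fun h => ha n (eq_neg_of_add_eq_zero_right h)
    have e : ((n + 1 : ℕ) : ℂ) + a = ((n : ℂ) + a) + 1 := by push_cast; ring
    rw [e, Complex.Gamma_add_one _ h, ih, ascPochhammer_succ_eval]
    ring

/-- `(a)_n / (b)_n = Γ(b)/Γ(a) · Γ(n + a)/Γ(n + b)`. -/
theorem pochRatio_eq_gamma {a b : ℂ} (ha : NotGammaPole a) (hb : NotGammaPole b) (n : ℕ) :
    pochRatio a b n = Complex.Gamma b / Complex.Gamma a *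
      (Complex.Gamma ((n : ℂ) + a) / Complex.Gamma ((n : ℂ) + b)) := by
  have ha' : Complex.Gamma a ≠ 0 := Complex.Gamma_ne_zero ha
  have hb' : Complex.Gamma b ≠ 0 := Complex.Gamma_ne_zero hb
  rw [gamma_add_nat ha, gamma_add_nat hb, pochRatio]
  field_simp

section Local

variable {σ : Type} [DecidableEq σ]

/-- The substitution `z_i ↦ z_i + c z_j`, all other variables being fixed. -/
noncomputable def shiftVar (i j : σ) (c : ℂ) : MvPolynomial σ ℂ →ₐ[ℂ] MvPolynomial σ ℂ :=
  aeval (Function.update X i (X i + C c * X j))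

/-- The operator `f(z_i ∂_i)`: it multiplies a monomial by `f` of its degree in `z_i`. -/
noncomputable def degreeFun (i : σ) (f : ℕ → ℂ) : Module.End ℂ (MvPolynomial σ ℂ) :=
  (basisMonomials σ ℂ).constr ℂ (fun s => f (s i) • monomial s (1 : ℂ))

/-- The operator `f(z_{ij} ∂_i)`, `z_{ij} = z_i - z_j` (for `i ≠ j`): since
`z_{ij} ∂_i = e^{-z_j ∂_i} (z_i ∂_i) e^{z_j ∂_i}`, it is obtained from `f(z_i ∂_i)` by conjugation
with a shift of `z_i`. -/
noncomputable def eulerFun (i j : σ) (f : ℕ → ℂ) : Module.End ℂ (MvPolynomial σ ℂ) :=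
  (shiftVar i j (-1)).toLinearMap ∘ₗ degreeFun i f ∘ₗ (shiftVar i j 1).toLinearMap

/-- `f(z_{ij} ∂_i)` acts as `f(n)` on the products of `(z_i - z_j)^n` with a monomial without `z_i`.
These eigenvectors of `z_{ij} ∂_i` (eigenvalue `n`) span the polynomial ring. -/
theorem eulerFun_apply {i j : σ} (hij : i ≠ j) (f : ℕ → ℂ) (n : ℕ) (s : σ →₀ ℕ) (hs : s i = 0) :
    eulerFun i j f ((X i - X j) ^ n * monomial s 1) =
      f n • ((X i - X j) ^ n * monomial s (1 : ℂ)) := by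
  have hmon : ∀ c : ℂ, shiftVar i j c (monomial s 1) = monomial s 1 := by
    intro c
    rw [shiftVar, aeval_monomial, monomial_eq]
    simp only [map_one, one_mul]
    refine Finset.prod_congr rfl fun k hk => ?_
    have hk' : k ≠ i := by
      rintro rfl
      exact (Finsupp.mem_support_iff.mp hk) hs
    simp [hk']
  have hXi : ∀ c : ℂ, shiftVar i j c (X i) = X i + C c * X j := by
    intro c
    simp [shiftVar]
  have hXj : ∀ c : ℂ, shiftVar i j c (X j) = X j := by
    intro c
    simp [shiftVar, hij.symm]
  have hd : degreeFun i f (X i ^ n * monomial s 1) = f n • (X i ^ n * monomial s (1 : ℂ)) := by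
    have e : (X i ^ n * monomial s 1 : MvPolynomial σ ℂ)
        = monomial (Finsupp.single i n + s) 1 := by
      rw [X_pow_eq_monomial, monomial_mul, one_mul]
    rw [e, degreeFun]
    have := (basisMonomials σ ℂ).constr_basis ℂ
      (fun s => f (s i) • monomial s (1 : ℂ)) (Finsupp.single i n + s)
    rw [coe_basisMonomials] at this
    rw [this]
    simp [hs]
  simp only [eulerFun, LinearMap.comp_apply, AlgHom.toLinearMap_apply, map_mul, map_pow, map_sub,
    hmon, hXi, hXj]
  have e1 : (X i + C 1 * X j - X j : MvPolynomial σ ℂ) = X i := by simp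
  rw [e1, hd]
  simp only [map_smul, map_mul, map_pow, hmon, hXi]
  have e2 : (X i + C (-1) * X j : MvPolynomial σ ℂ) = X i - X j := by simp [sub_eq_add_neg]
  rw [e2]

/-- The operator `Γ(b)/Γ(a) · Γ(z_{ij} ∂_i + a)/Γ(z_{ij} ∂_i + b)`. -/
noncomputable def gammaRatio (i j : σ) (a b : ℂ) : Module.End ℂ (MvPolynomial σ ℂ) :=
  eulerFun i j (pochRatio a b)

/-- The permutation `P_{ij}` of the variables `z_i` and `z_j`. -/
noncomputable def permOp (i j : σ) : Module.End ℂ (MvPolynomial σ ℂ) :=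
  (rename (Equiv.swap i j)).toLinearMap

/-- `R⁺_{ij}(u₊ | v₊, v₋)`. -/
noncomputable def Rplus (i j : σ) (up vp vm : ℂ) : Module.End ℂ (MvPolynomial σ ℂ) :=
  gammaRatio j i (up - vm) (vp - vm)

/-- `R⁻_{ij}(u₊, u₋ | v₋)`. -/
noncomputable def Rminus (i j : σ) (up um vm : ℂ) : Module.End ℂ (MvPolynomial σ ℂ) :=
  gammaRatio i j (up - vm) (up - um)

/-- `Ř_{ij}(u₊, u₋ | v₊, v₋) = R⁺_{ij}(u₊ | v₊, u₋) R⁻_{ij}(u₊, u₋ | v₋)`. -/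
noncomputable def Rcheck (i j : σ) (up um vp vm : ℂ) : Module.End ℂ (MvPolynomial σ ℂ) :=
  Rplus i j up vp um * Rminus i j up um vm

end Local

section Trace

variable {N : ℕ}

/-- The coefficient of `z_0^m` in `A (z_0^m Ψ(z_1, …, z_N))`, that is
`(1/m!) ∂_0^m A z_0^m Ψ` at `z_0 = 0`. -/
noncomputable def auxTerm (A : Module.End ℂ (MvPolynomial (Fin (N + 1)) ℂ)) (m : ℕ)
    (Ψ : MvPolynomial (Fin N) ℂ) : MvPolynomial (Fin N) ℂ :=
  (finSuccEquiv ℂ N (A (X 0 ^ m * rename Fin.succ Ψ))).coeff m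

/-- `B` is the trace of `A` over the auxiliary space `ℂ[z_0]`: for all `Ψ` the series
`∑_m (1/m!) ∂_0^m A z_0^m Ψ |_{z_0 = 0}` converges coefficientwise to `B Ψ`. -/
def HasAuxTrace (A : Module.End ℂ (MvPolynomial (Fin (N + 1)) ℂ))
    (B : Module.End ℂ (MvPolynomial (Fin N) ℂ)) : Prop :=
  ∀ (Ψ : MvPolynomial (Fin N) ℂ) (s : Fin N →₀ ℕ),
    HasSum (fun m : ℕ => coeff s (auxTerm A m Ψ)) (coeff s (B Ψ))

/-- The trace of `A` over the auxiliary space exists. -/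
def AuxTraceExists (A : Module.End ℂ (MvPolynomial (Fin (N + 1)) ℂ)) : Prop :=
  ∃ B, HasAuxTrace A B

open Classical in
/-- The trace of `A` over the auxiliary space (`0` if it does not exist). -/
noncomputable def auxTrace (A : Module.End ℂ (MvPolynomial (Fin (N + 1)) ℂ)) :
    Module.End ℂ (MvPolynomial (Fin N) ℂ) :=
  if h : AuxTraceExists A then h.choose else 0

theorem HasAuxTrace.auxTrace_eq {A : Module.End ℂ (MvPolynomial (Fin (N + 1)) ℂ)}
    {B : Module.End ℂ (MvPolynomial (Fin N) ℂ)} (h : HasAuxTrace A B) : auxTrace A = B := by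
  have hex : AuxTraceExists A := ⟨B, h⟩
  rw [auxTrace, dif_pos hex]
  refine LinearMap.ext fun Ψ => MvPolynomial.ext _ _ fun s => ?_
  exact (hex.choose_spec Ψ s).unique (h Ψ s)

/-- The product `T_1 T_2 ⋯ T_N`. -/
noncomputable def monodromy (T : Fin N → Module.End ℂ (MvPolynomial (Fin (N + 1)) ℂ)) :
    Module.End ℂ (MvPolynomial (Fin (N + 1)) ℂ) :=
  (List.ofFn T).prod

end Trace

section Chain

/-! The variable with index `0` is the auxiliary one; the site `k : Fin N` of the chain, with spin
`ℓ k` and inhomogeneity `δ k`, has the variable with index `k.succ`. -/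

variable {N : ℕ} (ℓ δ : Fin N → ℂ)

/-- The operator `R_{k0}(u₁|u₂)`. -/
noncomputable def siteR (u1 u2 : ℂ) (k : Fin N) : Module.End ℂ (MvPolynomial (Fin (N + 1)) ℂ) :=
  permOp k.succ 0 * gammaRatio 0 k.succ (2 * ℓ k) (ℓ k + 1 - u1 - δ k) *
    gammaRatio k.succ 0 (ℓ k + u2 + δ k) (2 * ℓ k)

/-- `R_{k0}(u₁|u₂)` with `u₁ = 1 + u - ℓ₀`, `u₂ = u + ℓ₀` is the general operator `P_{k0} Ř_{k0}`
with the parameters `(u + δ_k) ± ℓ_k` at the site `k` and `± ℓ₀` in the auxiliary space. -/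
theorem siteR_eq (u ℓ₀ : ℂ) (k : Fin N) :
    siteR ℓ δ (1 + u - ℓ₀) (u + ℓ₀) k =
      permOp k.succ 0 *
        Rcheck k.succ 0 (u + δ k + ℓ k) (u + δ k - ℓ k) ℓ₀ (-ℓ₀) := by
  rw [siteR, Rcheck, Rplus, Rminus, mul_assoc]
  congr 3 <;> ring

/-- The operator `P_{k0} R⁺_{k0}(u + δ_k)`. -/
noncomputable def siteRplus (u : ℂ) (k : Fin N) : Module.End ℂ (MvPolynomial (Fin (N + 1)) ℂ) :=
  permOp k.succ 0 * gammaRatio 0 k.succ (2 * ℓ k) (1 + ℓ k - (u + δ k))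

/-- The operator `P_{k0} R⁻_{k0}(u + δ_k)`. -/
noncomputable def siteRminus (u : ℂ) (k : Fin N) : Module.End ℂ (MvPolynomial (Fin (N + 1)) ℂ) :=
  permOp k.succ 0 * gammaRatio k.succ 0 (u + δ k + ℓ k) (2 * ℓ k)

/-- The operator under the trace in `Q(u₁|u₂)`. -/
noncomputable def monQ (u1 u2 : ℂ) : Module.End ℂ (MvPolynomial (Fin (N + 1)) ℂ) :=
  monodromy (siteR ℓ δ u1 u2)

/-- The operator under the trace in `Q₊(u)`. -/
noncomputable def monQplus (u : ℂ) : Module.End ℂ (MvPolynomial (Fin (N + 1)) ℂ) :=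
  monodromy (siteRplus ℓ δ u)

/-- The operator under the trace in `Q₋(u)`. -/
noncomputable def monQminus (u : ℂ) : Module.End ℂ (MvPolynomial (Fin (N + 1)) ℂ) :=
  monodromy (siteRminus ℓ δ u)

/-- The two-parametric operator `Q(u₁|u₂)`. -/
noncomputable def opQ (u1 u2 : ℂ) : Module.End ℂ (MvPolynomial (Fin N) ℂ) :=
  auxTrace (monQ ℓ δ u1 u2)

/-- The operator `Q₊(u)`. -/
noncomputable def opQplus (u : ℂ) : Module.End ℂ (MvPolynomial (Fin N) ℂ) :=
  auxTrace (monQplus ℓ δ u)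

/-- The operator `Q₋(u)`. -/
noncomputable def opQminus (u : ℂ) : Module.End ℂ (MvPolynomial (Fin N) ℂ) :=
  auxTrace (monQminus ℓ δ u)

/-- No denominator of `R_{k0}(u|·)` and of `R⁺_{k0}(u + δ_k)` has a pole. -/
def RegularAt (u : ℂ) : Prop := ∀ k, NotGammaPole (1 + ℓ k - δ k - u)

/-- The cyclic shift `(P Ψ)(z_1, …, z_N) = Ψ(z_2, …, z_N, z_1)`. -/
noncomputable def cyclicShift (N : ℕ) : Module.End ℂ (MvPolynomial (Fin N) ℂ) :=
  (rename (finRotate N)).toLinearMap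

end Chain

/-! Everything rests on one formula, `coeffMap_gammaRatio`: the operator `gammaRatio i j a b` sends
the generating function z_ij^k (1 - x z_i)^{-b-k} to (a)_k/(b)_k z_ij^k (1 - x z_i)^{-a-k} (1 - x
z_j)^{a-b}, and factors free of z_i pass through it. On well-chosen products of such powers a word
in these operators only moves exponents, so two words agree as soon as their exponents do. This
gives three elementary relations: one variable with two reference points
(`gammaRatio_exchange_same`), the braid relation (`gammaRatio_braid`), and the exchange of two
opposite operators (`gammaRatio_exchange`). Part (a) is a word computation with them. Superfluous
genericity conditions are removed by continuity, their exceptional sets being countable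
(`ContMapAt.eq_of_countable`).

For (d), the factors R⁻_{k0} in the monodromy of Q are pushed to the right end: passing the operator
of the next site turns the reference point z_0 into the variable of that site, and the result
commutes with all later sites. This leaves A C, where the chain C commutes with z_0 and the
remaining monodromy A satisfies A z_1 = z_0 A because of its leftmost permutation. Hence the trace
of A C is the trace of A composed with "apply C, then put z_0 = z_1" (`HasAuxTrace.mul_right`).
Taking for A the monodromy of Q₊ gives Q; taking P_{10} ⋯ P_{N0}, whose trace is P⁻¹, gives Q₋.
Comparison of the two is the factorization, and it also yields the existence of Q₋ and that of Q
from that of Q₊.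

For Q₊, a monomial of the image is reached along a single path, so that a trace term is a product
over the sites of matrix elements of size O(m^{-2 Re ℓ_k}), some of which may vanish for all large
m. On constants the order is exact, so convergence on constants decides existence
(`auxTraceExists_plusSite_tfae`). Since C fixes constants, Q and Q₊ have the same series there.

For (e), the products of traces are traces over two auxiliary spaces. A local relation at each site
(`siteOp_exchange_plus`, `siteOp_exchange_minus`) involves an intertwiner whose parameters, such as
1 - u₁ + u₂, do not depend on the site, so it passes through the whole monodromy. It preserves the
total degree in the two auxiliary variables; cyclicity of finite traces in each degree and absolute
convergence give `HasAuxTrace.mul_eq_mul`. Part (c) follows from (d) and (e). -/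

/-! ### Rising factorials and binomial coefficients -/

section RisingFactorials

theorem ascPochhammer_eval_add (a : ℂ) (n m : ℕ) :
    (ascPochhammer ℂ (n + m)).eval a =
      (ascPochhammer ℂ n).eval a * (ascPochhammer ℂ m).eval (a + n) := by
  rw [← ascPochhammer_mul]
  simp

theorem NotGammaPole.ascPochhammer_ne_zero {a : ℂ} (ha : NotGammaPole a) (n : ℕ) :
    (ascPochhammer ℂ n).eval a ≠ 0 := by
  rw [Ne, ascPochhammer_eval_eq_zero_iff]
  rintro ⟨k, -, hk⟩
  exact ha k (by rw [hk, neg_neg])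

theorem NotGammaPole.add_nat {a : ℂ} (ha : NotGammaPole a) (n : ℕ) : NotGammaPole (a + n) := by
  intro m hm
  refine ha (m + n) ?_
  push_cast
  linear_combination hm

theorem pochRatio_self {a : ℂ} (ha : NotGammaPole a) (n : ℕ) : pochRatio a a n = 1 :=
  div_self (ha.ascPochhammer_ne_zero n)

theorem pochRatio_mul {b : ℂ} (hb : NotGammaPole b) (a c : ℂ) (n : ℕ) :
    pochRatio a b n * pochRatio b c n = pochRatio a c n := by
  have := hb.ascPochhammer_ne_zero n
  rw [pochRatio, pochRatio, pochRatio]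
  field_simp

theorem pochRatio_add (a b : ℂ) (n m : ℕ) :
    pochRatio a b (n + m) = pochRatio a b n * pochRatio (a + n) (b + n) m := by
  rw [pochRatio, pochRatio, pochRatio, ascPochhammer_eval_add, ascPochhammer_eval_add,
    mul_div_mul_comm]

/-- The coefficients `(β)_n / n!` of the series `(1 - x)^{-β}`. -/
noncomputable def negBinom (β : ℂ) (n : ℕ) : ℂ := (ascPochhammer ℂ n).eval β / n.factorial

theorem negBinom_zero (β : ℂ) : negBinom β 0 = 1 := by simp [negBinom]

theorem negBinom_succ (β : ℂ) (n : ℕ) :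
    ((n : ℂ) + 1) * negBinom β (n + 1) = (β + n) * negBinom β n := by
  have h : ((n : ℂ) + 1) ≠ 0 := Nat.cast_add_one_ne_zero n
  have h' : (n.factorial : ℂ) ≠ 0 := Nat.cast_ne_zero.mpr n.factorial_ne_zero
  rw [negBinom, negBinom, ascPochhammer_succ_eval, Nat.factorial_succ]
  push_cast
  field_simp

theorem NotGammaPole.negBinom_ne_zero {a : ℂ} (ha : NotGammaPole a) (n : ℕ) :
    negBinom a n ≠ 0 :=
  div_ne_zero (ha.ascPochhammer_ne_zero n) (Nat.cast_ne_zero.mpr n.factorial_ne_zero)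

/-- The Chu-Vandermonde identity. -/
theorem negBinom_add (a b : ℂ) (n : ℕ) :
    negBinom (a + b) n = ∑ p ∈ Finset.HasAntidiagonal.antidiagonal n, negBinom a p.1 * negBinom b p.2 := by
  induction n with
  | zero => simp [negBinom_zero]
  | succ n ih =>
    have h : ((n : ℂ) + 1) ≠ 0 := Nat.cast_add_one_ne_zero n
    apply mul_left_cancel₀ h
    rw [negBinom_succ, ih]
    -- The weight n + 1 splits as p.1 + p.2, the product rule for the derivative of a product of two
    -- series; the recursion `negBinom_succ` then applies to each factor.
    have e : ((n : ℂ) + 1) * ∑ p ∈ Finset.HasAntidiagonal.antidiagonal (n + 1), negBinom a p.1 * negBinom b p.2 =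
        ∑ p ∈ Finset.HasAntidiagonal.antidiagonal (n + 1), (p.1 : ℂ) * negBinom a p.1 * negBinom b p.2 +
        ∑ p ∈ Finset.HasAntidiagonal.antidiagonal (n + 1), negBinom a p.1 * ((p.2 : ℂ) * negBinom b p.2) := by
      rw [Finset.mul_sum, ← Finset.sum_add_distrib]
      refine Finset.sum_congr rfl fun p hp => ?_
      have : ((p.1 : ℂ) + p.2) = n + 1 := by
        exact_mod_cast congrArg (Nat.cast : ℕ → ℂ) (Finset.HasAntidiagonal.mem_antidiagonal.mp hp)
      rw [← this]
      ring
    rw [e, Finset.Nat.sum_antidiagonal_succ, Finset.Nat.sum_antidiagonal_succ']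
    simp only [Nat.cast_zero, zero_mul, mul_zero, zero_add, Nat.cast_succ, negBinom_succ]
    rw [Finset.mul_sum, ← Finset.sum_add_distrib]
    refine Finset.sum_congr rfl fun p hp => ?_
    have : ((p.1 : ℂ) + p.2) = n := by
      exact_mod_cast congrArg (Nat.cast : ℕ → ℂ) (Finset.HasAntidiagonal.mem_antidiagonal.mp hp)
    rw [← this]
    ring

/-- The coefficient identity behind the Taylor re-expansion of (1 - x p)^{-β} at another point: the
n-th derivative of a power is again a power, with exponent lowered by n. -/
theorem choose_mul_negBinom (β : ℂ) (n m : ℕ) :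
    ((n + m).choose n : ℂ) * negBinom β (n + m) = negBinom β n * negBinom (β + n) m := by
  have h1 : (n.factorial : ℂ) ≠ 0 := Nat.cast_ne_zero.mpr n.factorial_ne_zero
  have h2 : (m.factorial : ℂ) ≠ 0 := Nat.cast_ne_zero.mpr m.factorial_ne_zero
  have h3 : ((n + m).factorial : ℂ) ≠ 0 := Nat.cast_ne_zero.mpr (n + m).factorial_ne_zero
  have h : ((n + m).choose n : ℂ) * n.factorial * m.factorial = (n + m).factorial := by
    exact_mod_cast Nat.choose_symm_add (a := n) (b := m) ▸ Nat.add_choose_mul_factorial_mul_factorial n m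
  rw [negBinom, negBinom, negBinom, ascPochhammer_eval_add, ← h]
  have h4 : ((n + m).choose n : ℂ) ≠ 0 := by
    rintro h4
    rw [h4] at h
    simp at h
    exact h3 h.symm
  field_simp

/-- An eigenvalue times a coefficient of (1 - x)^{-b-k} is a coefficient of (1 - x)^{-a-k}, up to a
constant factor. This is why the operators act so simply on generating functions. -/
theorem pochRatio_mul_negBinom {b : ℂ} (hb : NotGammaPole b) (a : ℂ) (k n : ℕ) :
    pochRatio a b (k + n) * negBinom (b + k) n = pochRatio a b k * negBinom (a + k) n := by
  have := (hb.add_nat k).ascPochhammer_ne_zero n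
  rw [pochRatio_add, pochRatio, pochRatio, negBinom, negBinom]
  field_simp

end RisingFactorials

/-! ### Binomial series with polynomial arguments -/

section BinomialSeries

variable {R : Type*} [CommRing R] [Algebra ℂ R]

/-- The power series `(1 - x p)^{-β}` in `x`. -/
noncomputable def negBinomSeries (β : ℂ) (p : R) : PowerSeries R :=
  PowerSeries.mk fun n => negBinom β n • p ^ n

theorem coeff_negBinomSeries (β : ℂ) (p : R) (n : ℕ) :
    PowerSeries.coeff n (negBinomSeries β p) = negBinom β n • p ^ n := PowerSeries.coeff_mk _ _

theorem negBinomSeries_mul (a b : ℂ) (p : R) :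
    negBinomSeries a p * negBinomSeries b p = negBinomSeries (a + b) p := by
  ext n
  rw [PowerSeries.coeff_mul, coeff_negBinomSeries, negBinom_add, Finset.sum_smul]
  refine Finset.sum_congr rfl fun q hq => ?_
  rw [coeff_negBinomSeries, coeff_negBinomSeries, smul_mul_smul_comm, ← pow_add,
    Finset.HasAntidiagonal.mem_antidiagonal.mp hq]

/-- Re-expansion of `(1 - x p)^{-β}` around another point. -/
theorem coeff_negBinomSeries_mul_eq (β : ℂ) (p q : R) (H : PowerSeries R) (n : ℕ) :
    PowerSeries.coeff n (negBinomSeries β p * H) =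
      ∑ k ∈ Finset.HasAntidiagonal.antidiagonal n, negBinom β k.1 •
        ((p - q) ^ k.1 * PowerSeries.coeff k.2 (negBinomSeries (β + k.1) q * H)) := by
  -- The case H = 1, from the binomial theorem for p = (p - q) + q.
  have h : ∀ m, PowerSeries.coeff m (negBinomSeries β p) = ∑ k ∈ Finset.HasAntidiagonal.antidiagonal m,
      negBinom β k.1 • ((p - q) ^ k.1 * PowerSeries.coeff k.2 (negBinomSeries (β + k.1) q)) := by
    intro m
    rw [coeff_negBinomSeries, ← sub_add_cancel p q, add_pow, sub_add_cancel,
      ← Finset.Nat.sum_antidiagonal_eq_sum_range_succ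
        (fun i j => (p - q) ^ i * q ^ j * (m.choose i : R)), Finset.smul_sum]
    refine Finset.sum_congr rfl fun k hk => ?_
    have hk' := Finset.HasAntidiagonal.mem_antidiagonal.mp hk
    rw [coeff_negBinomSeries, mul_smul_comm, smul_smul, ← choose_mul_negBinom, hk', mul_comm
      (_ * _ : R), ← nsmul_eq_mul, ← Nat.cast_smul_eq_nsmul ℂ, smul_smul, mul_comm (negBinom _ _)]
  rw [PowerSeries.coeff_mul]
  simp_rw [h, Finset.sum_mul, PowerSeries.coeff_mul, Finset.mul_sum, Finset.smul_sum]
  rw [Finset.sum_sigma', Finset.sum_sigma']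
  -- Both sides are sums over triples with sum n; only the bracketing differs.
  refine Finset.sum_nbij' (fun x => ⟨(x.2.1, x.2.2 + x.1.2), (x.2.2, x.1.2)⟩)
    (fun x => ⟨(x.1.1 + x.2.1, x.2.2), (x.1.1, x.2.1)⟩) ?_ ?_ ?_ ?_ ?_
  · rintro ⟨⟨a, b⟩, ⟨c, d⟩⟩
    simp only [Finset.mem_sigma, Finset.HasAntidiagonal.mem_antidiagonal]
    rintro ⟨rfl, rfl⟩
    exact ⟨by ring, trivial⟩
  · rintro ⟨⟨a, b⟩, ⟨c, d⟩⟩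
    simp only [Finset.mem_sigma, Finset.HasAntidiagonal.mem_antidiagonal]
    rintro ⟨rfl, rfl⟩
    exact ⟨by ring, trivial⟩
  · rintro ⟨⟨a, b⟩, ⟨c, d⟩⟩
    simp only [Finset.mem_sigma, Finset.HasAntidiagonal.mem_antidiagonal]
    rintro ⟨-, rfl⟩
    rfl
  · rintro ⟨⟨a, b⟩, ⟨c, d⟩⟩
    simp only [Finset.mem_sigma, Finset.HasAntidiagonal.mem_antidiagonal]
    rintro ⟨-, rfl⟩
    rfl
  · rintro ⟨⟨a, b⟩, ⟨c, d⟩⟩ -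
    simp only [smul_mul_assoc, mul_assoc]

end BinomialSeries

/-! ### Operators f(z_ij ∂_i) and their linearity over the other variables -/

section EulerOperators

variable {σ : Type}

theorem degreeFun_monomial (i : σ) (f : ℕ → ℂ) (s : σ →₀ ℕ) (c : ℂ) :
    degreeFun i f (monomial s c) = f (s i) • monomial s c := by
  have h := (basisMonomials σ ℂ).constr_basis ℂ (fun s => f (s i) • monomial s (1 : ℂ)) s
  rw [coe_basisMonomials] at h
  have e : (monomial s c : MvPolynomial σ ℂ) = c • monomial s 1 := by simp [smul_monomial]
  rw [e, map_smul, degreeFun, h, smul_comm]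

theorem degreeFun_X_mul {i l : σ} (h : l ≠ i) (f : ℕ → ℂ) (p : MvPolynomial σ ℂ) :
    degreeFun i f (X l * p) = X l * degreeFun i f p := by
  induction p using MvPolynomial.induction_on' with
  | monomial s c =>
    have e : (X l * monomial s c : MvPolynomial σ ℂ) = monomial (Finsupp.single l 1 + s) c := by
      rw [X, monomial_mul, one_mul]
    rw [e, degreeFun_monomial, degreeFun_monomial, mul_smul_comm, e]
    simp [h]
  | add p q hp hq => rw [mul_add, map_add, hp, hq, map_add, mul_add]

/-- An operator that commutes with the multiplication by the variables with index outside `s` is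
linear over the polynomials in these variables. -/
theorem map_mul_of_mem_supported {L : Module.End ℂ (MvPolynomial σ ℂ)} {s : Set σ}
    (hL : ∀ l ∈ s, ∀ p, L (X l * p) = X l * L p) {q : MvPolynomial σ ℂ} (hq : q ∈ supported ℂ s)
    (p : MvPolynomial σ ℂ) : L (q * p) = q * L p := by
  rw [supported] at hq
  induction hq using Algebra.adjoin_induction generalizing p with
  | mem x hx =>
    obtain ⟨l, hl, rfl⟩ := hx
    exact hL l hl p
  | algebraMap r => rw [← Algebra.smul_def, map_smul, Algebra.smul_def]
  | add x y _ _ hx hy => rw [add_mul, map_add, hx, hy, add_mul]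
  | mul x y _ _ hx hy => rw [mul_assoc, hx, hy, mul_assoc]

theorem X_mem_supported_compl {i l : σ} (h : l ≠ i) :
    (X l : MvPolynomial σ ℂ) ∈ supported ℂ ({i}ᶜ : Set σ) := by
  rw [X_mem_supported]
  exact h

/-- A subspace of polynomials that is stable under the multiplication by all variables with index
outside `A` and contains the monomials in the variables with index in `A` is everything. -/
theorem eq_top_of_stable {W : Submodule ℂ (MvPolynomial σ ℂ)} (A : Set σ)
    (hst : ∀ l ∉ A, ∀ p ∈ W, X l * p ∈ W)
    (hmem : ∀ s : σ →₀ ℕ, (∀ l ∉ A, s l = 0) → monomial s (1 : ℂ) ∈ W) : W = ⊤ := by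
  classical
  have hsup : ∀ q ∈ supported ℂ Aᶜ, ∀ p ∈ W, q * p ∈ W := by
    intro q hq
    rw [supported] at hq
    induction hq using Algebra.adjoin_induction with
    | mem x hx =>
      obtain ⟨l, hl, rfl⟩ := hx
      exact hst l hl
    | algebraMap r =>
      intro p hp
      rw [← Algebra.smul_def]
      exact W.smul_mem r hp
    | add x y _ _ hx hy =>
      intro p hp
      rw [add_mul]
      exact W.add_mem (hx p hp) (hy p hp)
    | mul x y _ _ hx hy =>
      intro p hp
      rw [mul_assoc]
      exact hx _ (hy p hp)
  rw [eq_top_iff]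
  rintro p -
  induction p using MvPolynomial.induction_on' with
  | monomial s c =>
    have e : (monomial s c : MvPolynomial σ ℂ) =
        monomial (s.filter (· ∉ A)) c * monomial (s.filter (· ∈ A)) 1 := by
      rw [monomial_mul, mul_one, add_comm, Finsupp.filter_add_filter_not]
    rw [e]
    refine hsup _ ?_ _ (hmem _ fun l hl => Finsupp.filter_apply_neg _ _ hl)
    rw [mem_supported]
    intro l hl
    rw [Finset.mem_coe, mem_vars_iff_mem_support] at hl
    obtain ⟨d, hd, hl⟩ := hl
    have hd' := Finset.mem_singleton.mp (support_monomial_subset hd)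
    subst hd'
    rw [Finsupp.support_filter, Finset.mem_filter] at hl
    exact hl.2
  | add p q hp hq => exact W.add_mem hp hq

theorem eq_top_of_stable_one {W : Submodule ℂ (MvPolynomial σ ℂ)} (i : σ)
    (hst : ∀ l ≠ i, ∀ p ∈ W, X l * p ∈ W) (hmem : ∀ n, (X i) ^ n ∈ W) : W = ⊤ := by
  refine eq_top_of_stable {i} hst fun s hs => ?_
  have : s = Finsupp.single i (s i) := by
    ext l
    by_cases h : l = i
    · simp [h]
    · rw [hs l h, Finsupp.single_eq_of_ne h]
  rw [this, ← X_pow_eq_monomial]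
  exact hmem _

theorem eq_top_of_stable_two {W : Submodule ℂ (MvPolynomial σ ℂ)} {i k : σ} (hik : i ≠ k)
    (hst : ∀ l, l ≠ i → l ≠ k → ∀ p ∈ W, X l * p ∈ W)
    (hmem : ∀ n m, (X i) ^ n * (X k) ^ m ∈ W) : W = ⊤ := by
  refine eq_top_of_stable {i, k} (fun l hl => hst l (fun h => hl (by simp [h]))
    (fun h => hl (by simp [h]))) fun s hs => ?_
  have : s = Finsupp.single i (s i) + Finsupp.single k (s k) := by
    ext l
    by_cases h : l = i
    · subst h
      simp [hik]
    · by_cases h' : l = k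
      · subst h'
        simp [hik.symm]
      · rw [hs l (by simp [h, h'])]
        simp [h, h']
  rw [this, ← one_mul (1 : ℂ), ← monomial_mul, ← X_pow_eq_monomial, ← X_pow_eq_monomial]
  exact hmem _ _

/-- Multiplication by powers of the variables with index outside a given set. -/
theorem pow_mul_mem_of_stable {W : Submodule ℂ (MvPolynomial σ ℂ)} {l : σ}
    (hst : ∀ p ∈ W, X l * p ∈ W) (n : ℕ) {p : MvPolynomial σ ℂ} (hp : p ∈ W) :
    X l ^ n * p ∈ W := by
  induction n with
  | zero => simpa using hp
  | succ n ih =>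
    rw [pow_succ', mul_assoc]
    exact hst _ ih

variable [DecidableEq σ]

theorem shiftVar_X_self (i j : σ) (c : ℂ) : shiftVar i j c (X i) = X i + C c * X j := by
  simp [shiftVar]

theorem shiftVar_X_of_ne {i l : σ} (h : l ≠ i) (j : σ) (c : ℂ) :
    shiftVar i j c (X l) = X l := by
  simp [shiftVar, h]

theorem eulerFun_X_mul {i l : σ} (h : l ≠ i) (j : σ) (f : ℕ → ℂ) (p : MvPolynomial σ ℂ) :
    eulerFun i j f (X l * p) = X l * eulerFun i j f p := by
  simp only [eulerFun, LinearMap.comp_apply, AlgHom.toLinearMap_apply, map_mul,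
    shiftVar_X_of_ne h, degreeFun_X_mul h]

theorem eulerFun_mul {i : σ} (j : σ) (f : ℕ → ℂ) {q : MvPolynomial σ ℂ}
    (hq : q ∈ supported ℂ ({i}ᶜ : Set σ)) (p : MvPolynomial σ ℂ) :
    eulerFun i j f (q * p) = q * eulerFun i j f p :=
  map_mul_of_mem_supported (fun _ hl p => eulerFun_X_mul hl j f p) hq p

theorem eulerFun_pow {i j : σ} (hij : i ≠ j) (f : ℕ → ℂ) (n : ℕ) :
    eulerFun i j f ((X i - X j) ^ n) = f n • (X i - X j) ^ n := by
  have := eulerFun_apply hij f n 0 rfl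
  rwa [monomial_zero', C_1, mul_one] at this

/-- `f(z_{ij} ∂_i)` acts as `f(n)` on `(z_i - z_j)^n q` if `q` does not depend on `z_i`. -/
theorem eulerFun_pow_mul {i j : σ} (hij : i ≠ j) (f : ℕ → ℂ) (n : ℕ) {q : MvPolynomial σ ℂ}
    (hq : q ∈ supported ℂ ({i}ᶜ : Set σ)) :
    eulerFun i j f ((X i - X j) ^ n * q) = f n • ((X i - X j) ^ n * q) := by
  rw [mul_comm, eulerFun_mul j f hq, eulerFun_pow hij, mul_smul_comm]

end EulerOperators

/-! ### Generating functions and the elementary relations -/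

section ExchangeRelations

variable {σ : Type}

/-- `L` commutes with the multiplication by the variable `z_l`. -/
def CommutesWithX (L : Module.End ℂ (MvPolynomial σ ℂ)) (l : σ) : Prop :=
  ∀ p, L (X l * p) = X l * L p

theorem CommutesWithX.mul {L L' : Module.End ℂ (MvPolynomial σ ℂ)} {l : σ}
    (h : CommutesWithX L l) (h' : CommutesWithX L' l) : CommutesWithX (L * L') l := fun p => by
  rw [Module.End.mul_apply, h', h, Module.End.mul_apply]

theorem CommutesWithX.one (l : σ) : CommutesWithX (1 : Module.End ℂ (MvPolynomial σ ℂ)) l :=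
  fun _ => rfl

theorem CommutesWithX.eqLocus {L L' : Module.End ℂ (MvPolynomial σ ℂ)} {l : σ}
    (h : CommutesWithX L l) (h' : CommutesWithX L' l) :
    ∀ p ∈ LinearMap.eqLocus L L', X l * p ∈ LinearMap.eqLocus L L' := fun p hp => by
  rw [LinearMap.mem_eqLocus] at hp ⊢
  rw [h, h', hp]

/-- Both operators are linear over the polynomials in the variables other than z_i, and the powers
of z_i generate the polynomial ring as a module over these. -/
theorem ext_of_commutesWithX {L L' : Module.End ℂ (MvPolynomial σ ℂ)} (i : σ)
    (h : ∀ l ≠ i, CommutesWithX L l) (h' : ∀ l ≠ i, CommutesWithX L' l)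
    (hX : ∀ n, L (X i ^ n) = L' (X i ^ n)) : L = L' :=
  LinearMap.eqLocus_eq_top.mp
    (eq_top_of_stable_one i (fun l hl => (h l hl).eqLocus (h' l hl)) hX)

theorem ext_of_commutesWithX_two {L L' : Module.End ℂ (MvPolynomial σ ℂ)} {i k : σ} (hik : i ≠ k)
    (h : ∀ l, l ≠ i → l ≠ k → CommutesWithX L l) (h' : ∀ l, l ≠ i → l ≠ k → CommutesWithX L' l)
    (hX : ∀ n m, L (X i ^ n * X k ^ m) = L' (X i ^ n * X k ^ m)) : L = L' :=
  LinearMap.eqLocus_eq_top.mp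
    (eq_top_of_stable_two hik (fun l h1 h2 => (h l h1 h2).eqLocus (h' l h1 h2)) hX)

/-- The action of an operator on the coefficients of a power series. -/
noncomputable def coeffMap (L : Module.End ℂ (MvPolynomial σ ℂ))
    (f : PowerSeries (MvPolynomial σ ℂ)) : PowerSeries (MvPolynomial σ ℂ) :=
  PowerSeries.mk fun n => L (PowerSeries.coeff n f)

theorem coeff_coeffMap (L : Module.End ℂ (MvPolynomial σ ℂ))
    (f : PowerSeries (MvPolynomial σ ℂ)) (n : ℕ) :
    PowerSeries.coeff n (coeffMap L f) = L (PowerSeries.coeff n f) := PowerSeries.coeff_mk _ _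

theorem coeffMap_mul (L L' : Module.End ℂ (MvPolynomial σ ℂ))
    (f : PowerSeries (MvPolynomial σ ℂ)) : coeffMap (L * L') f = coeffMap L (coeffMap L' f) := by
  ext1 n
  rw [coeff_coeffMap, coeff_coeffMap, coeff_coeffMap, Module.End.mul_apply]

/-- The coefficients of the power series do not depend on the variable `z_i`. -/
def FreeOf (i : σ) (H : PowerSeries (MvPolynomial σ ℂ)) : Prop :=
  ∀ n, PowerSeries.coeff n H ∈ supported ℂ ({i}ᶜ : Set σ)

theorem FreeOf.mul {i : σ} {G H : PowerSeries (MvPolynomial σ ℂ)} (hG : FreeOf i G)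
    (hH : FreeOf i H) : FreeOf i (G * H) := fun n => by
  rw [PowerSeries.coeff_mul]
  exact sum_mem fun q _ => mul_mem (hG _) (hH _)

theorem FreeOf.const {i : σ} {p : MvPolynomial σ ℂ} (hp : p ∈ supported ℂ ({i}ᶜ : Set σ)) :
    FreeOf i (PowerSeries.C p) := fun n => by
  rw [PowerSeries.coeff_C]
  split_ifs
  exacts [hp, zero_mem _]

theorem FreeOf.scalar (i : σ) (c : ℂ) : FreeOf i (PowerSeries.C (C c)) :=
  FreeOf.const (Subalgebra.algebraMap_mem _ c)

theorem FreeOf.one (i : σ) : FreeOf i (1 : PowerSeries (MvPolynomial σ ℂ)) := by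
  simpa using FreeOf.scalar i 1

theorem FreeOf.negBinomSeries {i j : σ} (h : j ≠ i) (β : ℂ) :
    FreeOf i (negBinomSeries β (X j)) := fun n => by
  rw [coeff_negBinomSeries]
  exact Subalgebra.smul_mem _ (pow_mem (X_mem_supported_compl h) n) _

theorem FreeOf.sub_pow {i j k : σ} (hj : j ≠ i) (hk : k ≠ i) (n : ℕ) :
    FreeOf i (PowerSeries.C ((X j - X k : MvPolynomial σ ℂ) ^ n)) :=
  FreeOf.const (pow_mem (sub_mem (X_mem_supported_compl hj) (X_mem_supported_compl hk)) n)

theorem negBinomSeries_mul_of_add_eq {a b c : ℂ} (h : a + b = c) (p : MvPolynomial σ ℂ) :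
    negBinomSeries a p * negBinomSeries b p = negBinomSeries c p := by
  rw [negBinomSeries_mul, h]

variable [DecidableEq σ]

theorem commutesWithX_eulerFun {i l : σ} (h : l ≠ i) (j : σ) (f : ℕ → ℂ) :
    CommutesWithX (eulerFun i j f) l := eulerFun_X_mul h j f

theorem commutesWithX_gammaRatio {i l : σ} (h : l ≠ i) (j : σ) (a b : ℂ) :
    CommutesWithX (gammaRatio i j a b) l := eulerFun_X_mul h j _

/-- The products z_ij^n z_kl^m are common eigenvectors and generate everything over the remaining
variables. The case j = l of a common reference point is allowed, and is used below. -/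
theorem eulerFun_commute {i j k l : σ} (hij : i ≠ j) (hkl : k ≠ l) (hik : i ≠ k) (hil : i ≠ l)
    (hkj : k ≠ j) (f g : ℕ → ℂ) : Commute (eulerFun i j f) (eulerFun k l g) := by
  refine ext_of_commutesWithX_two hik
    (fun m h1 h2 => (commutesWithX_eulerFun h1 j f).mul (commutesWithX_eulerFun h2 l g))
    (fun m h1 h2 => (commutesWithX_eulerFun h2 l g).mul (commutesWithX_eulerFun h1 j f))
    fun n m => ?_
  rw [← LinearMap.mem_eqLocus]
  have hst : ∀ m, m ≠ i → m ≠ k → ∀ p ∈ LinearMap.eqLocus (eulerFun i j f * eulerFun k l g)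
      (eulerFun k l g * eulerFun i j f), X m * p ∈ LinearMap.eqLocus
      (eulerFun i j f * eulerFun k l g) (eulerFun k l g * eulerFun i j f) := fun m h1 h2 =>
    ((commutesWithX_eulerFun h1 j f).mul (commutesWithX_eulerFun h2 l g)).eqLocus
      ((commutesWithX_eulerFun h2 l g).mul (commutesWithX_eulerFun h1 j f))
  have hmem : ∀ n m, (X i - X j) ^ n * (X k - X l) ^ m ∈ LinearMap.eqLocus
      (eulerFun i j f * eulerFun k l g) (eulerFun k l g * eulerFun i j f) := by
    intro n m
    have h1 : ((X k - X l) ^ m : MvPolynomial σ ℂ) ∈ supported ℂ ({i}ᶜ : Set σ) :=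
      pow_mem (sub_mem (X_mem_supported_compl hik.symm) (X_mem_supported_compl hil.symm)) m
    have h2 : ((X i - X j) ^ n : MvPolynomial σ ℂ) ∈ supported ℂ ({k}ᶜ : Set σ) :=
      pow_mem (sub_mem (X_mem_supported_compl hik) (X_mem_supported_compl hkj.symm)) n
    rw [LinearMap.mem_eqLocus, Module.End.mul_apply, Module.End.mul_apply,
      eulerFun_mul l g h2, eulerFun_pow hkl, mul_smul_comm, map_smul, eulerFun_pow_mul hij f n h1,
      map_smul, eulerFun_mul l g h2, eulerFun_pow hkl, mul_smul_comm, smul_comm]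
  -- If z_j and z_l lie outside {z_i, z_k}, as is the case here, powers of z_i and z_k expand in the
  -- eigenvectors with coefficients in z_j and z_l.
  have e : (X i ^ n * X k ^ m : MvPolynomial σ ℂ) =
      ((X i - X j) + X j) ^ n * ((X k - X l) + X l) ^ m := by
    rw [sub_add_cancel, sub_add_cancel]
  rw [e, add_pow, add_pow, Finset.sum_mul_sum]
  refine sum_mem fun r _ => sum_mem fun s _ => ?_
  have e2 : ((X i - X j) ^ r * X j ^ (n - r) * (n.choose r : MvPolynomial σ ℂ) *
      ((X k - X l) ^ s * X l ^ (m - s) * (m.choose s : MvPolynomial σ ℂ))) =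
      ((n.choose r : ℂ) * (m.choose s : ℂ)) • (X j ^ (n - r) * (X l ^ (m - s) *
        ((X i - X j) ^ r * (X k - X l) ^ s))) := by
    rw [smul_eq_C_mul]
    simp only [map_mul, map_natCast]
    ring
  rw [e2]
  exact Submodule.smul_mem _ _ (pow_mul_mem_of_stable (hst j hij.symm hkj.symm) _
    (pow_mul_mem_of_stable (hst l hil.symm hkl.symm) _ (hmem r s)))

theorem gammaRatio_commute {i j k l : σ} (hij : i ≠ j) (hkl : k ≠ l) (hik : i ≠ k) (hil : i ≠ l)
    (hkj : k ≠ j) (a b c d : ℂ) : Commute (gammaRatio i j a b) (gammaRatio k l c d) :=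
  eulerFun_commute hij hkl hik hil hkj _ _

theorem gammaRatio_self {i j : σ} (hij : i ≠ j) {a : ℂ} (ha : NotGammaPole a) :
    gammaRatio i j a a = 1 := by
  have h : ∀ n, pochRatio a a n = 1 := pochRatio_self ha
  refine ext_of_commutesWithX i (fun l hl => commutesWithX_gammaRatio hl j a a)
    (fun l _ => CommutesWithX.one l) fun n => ?_
  have e : (X i ^ n : MvPolynomial σ ℂ) = ((X i - X j) + X j) ^ n := by rw [sub_add_cancel]
  rw [e, add_pow, map_sum]
  refine Finset.sum_congr rfl fun r _ => ?_
  rw [mul_assoc, gammaRatio, eulerFun_pow_mul hij, h, one_smul]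
  exact mul_mem (pow_mem (X_mem_supported_compl hij.symm) _) (natCast_mem _ _)

/-- The action of `Γ(b)/Γ(a) · Γ(z_{ij} ∂_i + a)/Γ(z_{ij} ∂_i + b)` on the generating function
`z_{ij}^k (1 - x z_i)^{-b-k}`. -/
theorem coeffMap_gammaRatio {i j : σ} (hij : i ≠ j) (a : ℂ) {b : ℂ} (hb : NotGammaPole b) (k : ℕ)
    {H : PowerSeries (MvPolynomial σ ℂ)} (hH : FreeOf i H) :
    coeffMap (gammaRatio i j a b)
      (PowerSeries.C ((X i - X j) ^ k) * negBinomSeries (b + k) (X i) * H) =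
    PowerSeries.C (C (pochRatio a b k)) * PowerSeries.C ((X i - X j) ^ k) *
      negBinomSeries (a + k) (X i) * negBinomSeries (b - a) (X j) * H := by
  ext1 n
  -- Both sides are re-expanded at z_j: every term becomes a power of z_ij times a factor free of
  -- z_i, hence an eigenvector.
  rw [coeff_coeffMap, mul_assoc, PowerSeries.coeff_C_mul, mul_assoc, mul_assoc, mul_assoc,
    PowerSeries.coeff_C_mul, PowerSeries.coeff_C_mul,
    coeff_negBinomSeries_mul_eq _ _ (X j), coeff_negBinomSeries_mul_eq _ _ (X j), Finset.mul_sum,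
    Finset.mul_sum, Finset.mul_sum, map_sum]
  refine Finset.sum_congr rfl fun q _ => ?_
  have hfree : PowerSeries.coeff q.2 (negBinomSeries (b + k + q.1) (X j) * H) ∈
      supported ℂ ({i}ᶜ : Set σ) := (FreeOf.negBinomSeries hij.symm _).mul hH _
  -- On the right the powers of 1 - x z_j combine to the exponent -(b + k + q.1) found on the left;
  -- the scalars agree by `pochRatio_mul_negBinom`.
  rw [← mul_assoc (negBinomSeries (a + k + q.1) _), negBinomSeries_mul_of_add_eq
    (c := b + k + q.1) (by ring), mul_smul_comm, ← mul_assoc, ← pow_add, map_smul, gammaRatio,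
    eulerFun_pow_mul hij _ _ hfree, smul_smul, mul_comm (negBinom _ _), pochRatio_mul_negBinom hb,
    ← smul_smul, smul_eq_C_mul, smul_eq_C_mul, smul_eq_C_mul, pow_add]
  ring

theorem coeffMap_gammaRatio_zero {i j : σ} (hij : i ≠ j) (a : ℂ) {b : ℂ} (hb : NotGammaPole b)
    {H : PowerSeries (MvPolynomial σ ℂ)} (hH : FreeOf i H) :
    coeffMap (gammaRatio i j a b) (negBinomSeries b (X i) * H) =
      negBinomSeries a (X i) * negBinomSeries (b - a) (X j) * H := by
  have := coeffMap_gammaRatio hij a hb 0 hH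
  simpa [pochRatio] using this

/-- Operators in the same variable with different reference points. -/
theorem gammaRatio_exchange_same {i j k : σ} (hij : i ≠ j) (hik : i ≠ k) {a b c d : ℂ}
    (hb : NotGammaPole b) (hc : NotGammaPole c) (hd : NotGammaPole d) (h : a + c = b + d) :
    gammaRatio i k a b * gammaRatio i j b c = gammaRatio i j a d * gammaRatio i k d c := by
  refine ext_of_commutesWithX i
    (fun l hl => (commutesWithX_gammaRatio hl k a b).mul (commutesWithX_gammaRatio hl j b c))
    (fun l hl => (commutesWithX_gammaRatio hl j a d).mul (commutesWithX_gammaRatio hl k d c))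
    fun n => ?_
  -- Both sides equal (1 - x z_i)^{-a} (1 - x z_j)^{b-c} (1 - x z_k)^{a-b}. The coefficients of the
  -- test function are nonzero multiples of all powers of z_i, as c is not a pole.
  have key : coeffMap (gammaRatio i k a b * gammaRatio i j b c) (negBinomSeries c (X i)) =
      coeffMap (gammaRatio i j a d * gammaRatio i k d c) (negBinomSeries c (X i)) := by
    have e1 := coeffMap_gammaRatio_zero hij b hc (FreeOf.one i)
    have e2 := coeffMap_gammaRatio_zero hik d hc (FreeOf.one i)
    rw [mul_one, mul_one] at e1 e2
    rw [coeffMap_mul, coeffMap_mul, e1, e2,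
      coeffMap_gammaRatio_zero hik a hb (FreeOf.negBinomSeries hij.symm _),
      coeffMap_gammaRatio_zero hij a hd (FreeOf.negBinomSeries hik.symm _),
      show c - b = d - a by linear_combination h, show c - d = b - a by linear_combination h]
    ring
  have hn := congrArg (PowerSeries.coeff n) key
  rw [coeff_coeffMap, coeff_coeffMap, coeff_negBinomSeries, map_smul, map_smul] at hn
  exact smul_right_injective _ (hc.negBinom_ne_zero n) hn

/-- The braid relation. -/
theorem gammaRatio_braid {i j k : σ} (hij : i ≠ j) (hik : i ≠ k) (hjk : j ≠ k)
    {x₁ x₂ x₃ y₁ y₂ y₃ : ℂ} (hx₁ : NotGammaPole x₁) (hx₂ : NotGammaPole x₂)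
    (hy₁ : NotGammaPole y₁) (hy₂ : NotGammaPole y₂) (h₂ : x₁ + y₂ = x₂ + y₁)
    (h₃ : x₁ + y₃ = x₃ + y₁) :
    gammaRatio i j x₃ x₂ * gammaRatio j k y₃ y₁ * gammaRatio i j x₂ x₁ =
      gammaRatio j k y₂ y₁ * gammaRatio i j x₃ x₁ * gammaRatio j k y₃ y₂ := by
  have hL : ∀ l, l ≠ i → l ≠ j → CommutesWithX
      (gammaRatio i j x₃ x₂ * gammaRatio j k y₃ y₁ * gammaRatio i j x₂ x₁) l := fun l h1 h2 =>
    ((commutesWithX_gammaRatio h1 j _ _).mul (commutesWithX_gammaRatio h2 k _ _)).mul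
      (commutesWithX_gammaRatio h1 j _ _)
  have hR : ∀ l, l ≠ i → l ≠ j → CommutesWithX
      (gammaRatio j k y₂ y₁ * gammaRatio i j x₃ x₁ * gammaRatio j k y₃ y₂) l := fun l h1 h2 =>
    ((commutesWithX_gammaRatio h2 k _ _).mul (commutesWithX_gammaRatio h1 j _ _)).mul
      (commutesWithX_gammaRatio h2 k _ _)
  set L := gammaRatio i j x₃ x₂ * gammaRatio j k y₃ y₁ * gammaRatio i j x₂ x₁ with hLdef
  set R := gammaRatio j k y₂ y₁ * gammaRatio i j x₃ x₁ * gammaRatio j k y₃ y₂ with hRdef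
  -- The exponent y₂ + m fits the first operator on the right, and becomes y₁ + m after the first
  -- one on the left. Both sides give (y₃)_m/(y₁)_m z_jk^m (1 - x z_i)^{-x₃} (1 - x z_j)^{-y₂-m} (1
  -- - x z_k)^{y₃-y₁}.
  have key : ∀ m : ℕ,
      coeffMap L (PowerSeries.C ((X j - X k) ^ m) * negBinomSeries x₁ (X i) *
        negBinomSeries (y₂ + m) (X j)) =
      coeffMap R (PowerSeries.C ((X j - X k) ^ m) * negBinomSeries x₁ (X i) *
        negBinomSeries (y₂ + m) (X j)) := by
    intro m
    have fZi := FreeOf.sub_pow (i := i) (j := j) (k := k) hij.symm hik.symm m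
    have fi : ∀ β, FreeOf i (negBinomSeries β (X j)) := FreeOf.negBinomSeries hij.symm
    have fik : ∀ β, FreeOf i (negBinomSeries β (X k)) := FreeOf.negBinomSeries hik.symm
    have fj : ∀ β, FreeOf j (negBinomSeries β (X i)) := FreeOf.negBinomSeries hij
    have fjk : ∀ β, FreeOf j (negBinomSeries β (X k)) := FreeOf.negBinomSeries hjk.symm
    have l1 := coeffMap_gammaRatio_zero hij x₂ hx₁ (fZi.mul (fi (y₂ + m)))
    have l2 := coeffMap_gammaRatio hjk y₃ hy₁ m (fj x₂)
    have l3 := coeffMap_gammaRatio_zero hij x₃ hx₂ (((FreeOf.scalar i (pochRatio y₃ y₁ m)).mul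
      fZi).mul ((fi (y₃ + m)).mul (fik (y₁ - y₃))))
    have r1 := coeffMap_gammaRatio hjk y₃ hy₂ m (fj x₁)
    have r2 := coeffMap_gammaRatio_zero hij x₃ hx₁ (((FreeOf.scalar i (pochRatio y₃ y₂ m)).mul
      fZi).mul ((fi (y₃ + m)).mul (fik (y₂ - y₃))))
    have r3 := coeffMap_gammaRatio hjk y₂ hy₁ m (((FreeOf.scalar j (pochRatio y₃ y₂ m)).mul
      (fj x₃)).mul (fjk (y₂ - y₃)))
    have q1 := negBinomSeries_mul_of_add_eq (a := x₁ - x₂) (b := y₂ + m) (c := y₁ + m)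
      (by linear_combination h₂) (X j : MvPolynomial σ ℂ)
    have q2 := negBinomSeries_mul_of_add_eq (a := x₂ - x₃) (b := y₃ + m) (c := y₂ + m)
      (by linear_combination h₃ - h₂) (X j : MvPolynomial σ ℂ)
    have q3 := negBinomSeries_mul_of_add_eq (a := x₁ - x₃) (b := y₃ + m) (c := y₁ + m)
      (by linear_combination h₃) (X j : MvPolynomial σ ℂ)
    have q4 := negBinomSeries_mul_of_add_eq (a := y₁ - y₂) (b := y₂ - y₃) (c := y₁ - y₃)
      (by ring) (X k : MvPolynomial σ ℂ)
    have q5 : PowerSeries.C (C (pochRatio y₃ y₂ m) : MvPolynomial σ ℂ) *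
        PowerSeries.C (C (pochRatio y₂ y₁ m)) = PowerSeries.C (C (pochRatio y₃ y₁ m)) := by
      rw [← map_mul, ← map_mul, pochRatio_mul hy₂]
    rw [hLdef, hRdef, coeffMap_mul, coeffMap_mul, coeffMap_mul, coeffMap_mul]
    refine (congrArg (coeffMap _) (congrArg (coeffMap _)
      ((congrArg (coeffMap _) (by ring)).trans l1))).trans ?_
    refine (congrArg (coeffMap _) ((congrArg (coeffMap _) ?_).trans l2)).trans ?_
    · linear_combination (PowerSeries.C ((X j - X k) ^ m) * negBinomSeries x₂ (X i)) * q1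
    refine ((congrArg (coeffMap _) (by ring)).trans l3).trans ?_
    symm
    refine (congrArg (coeffMap _) (congrArg (coeffMap _)
      ((congrArg (coeffMap _) (by ring)).trans r1))).trans ?_
    refine (congrArg (coeffMap _) ((congrArg (coeffMap _) (by ring)).trans r2)).trans ?_
    refine ((congrArg (coeffMap _) ?_).trans r3).trans ?_
    · linear_combination (PowerSeries.C (C (pochRatio y₃ y₂ m)) * PowerSeries.C ((X j - X k) ^ m) *
        negBinomSeries x₃ (X i) * negBinomSeries (y₂ - y₃) (X k)) * q3
    rw [← q5, ← q4, ← q2]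
    ring
  -- The coefficient of x^n of the test function is a nonzero multiple of z_i^n z_jk^m plus terms of
  -- lower degree in z_i, which are covered by induction after writing z_j = z_jk + z_k.
  have hmem : ∀ n m, X i ^ n * (X j - X k) ^ m ∈ LinearMap.eqLocus L R := by
    intro n
    induction n using Nat.strong_induction_on with
    | _ n ih =>
      intro m
      have hn := congrArg (PowerSeries.coeff n) (key m)
      rw [coeff_coeffMap, coeff_coeffMap, ← LinearMap.mem_eqLocus, mul_assoc,
        PowerSeries.coeff_C_mul, PowerSeries.coeff_mul, Finset.mul_sum,
        ← Finset.add_sum_erase _ _ (show (n, 0) ∈ Finset.HasAntidiagonal.antidiagonal n by simp)]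
        at hn
      have hrest : ∑ q ∈ (Finset.HasAntidiagonal.antidiagonal n).erase (n, 0), (X j - X k) ^ m *
          (PowerSeries.coeff q.1 (negBinomSeries x₁ (X i)) *
            PowerSeries.coeff q.2 (negBinomSeries (y₂ + m) (X j))) ∈ LinearMap.eqLocus L R := by
        refine sum_mem fun q hq => ?_
        rw [Finset.mem_erase, Finset.HasAntidiagonal.mem_antidiagonal] at hq
        have hlt : q.1 < n := by
          rcases Nat.lt_or_ge q.1 n with h | h
          · exact h
          · exact absurd (Prod.ext (by omega) (by simp; omega)) hq.1
        have e : (X j - X k : MvPolynomial σ ℂ) ^ m * (PowerSeries.coeff q.1 (negBinomSeries x₁ (X i)) *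
            PowerSeries.coeff q.2 (negBinomSeries (y₂ + m) (X j))) =
            ∑ r ∈ Finset.range (q.2 + 1), (negBinom x₁ q.1 * negBinom (y₂ + m) q.2 *
              (q.2.choose r : ℂ)) • (X k ^ (q.2 - r) * (X i ^ q.1 * (X j - X k) ^ (m + r))) := by
          rw [coeff_negBinomSeries, coeff_negBinomSeries]
          nth_rewrite 2 [show (X j : MvPolynomial σ ℂ) = (X j - X k) + X k by ring]
          rw [add_pow, Finset.smul_sum, Finset.mul_sum, Finset.mul_sum]
          refine Finset.sum_congr rfl fun r _ => ?_
          simp only [smul_eq_C_mul, map_mul, map_natCast]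
          ring
        rw [e]
        refine sum_mem fun r _ => Submodule.smul_mem _ _ ?_
        exact pow_mul_mem_of_stable ((hL k hik.symm hjk.symm).eqLocus (hR k hik.symm hjk.symm)) _
          (ih q.1 hlt (m + r))
      have := (Submodule.add_mem_iff_left _ hrest).mp hn
      rw [coeff_negBinomSeries, coeff_negBinomSeries, negBinom_zero, one_smul, pow_zero, mul_one,
        mul_smul_comm, Submodule.smul_mem_iff _ (hx₁.negBinom_ne_zero n), mul_comm] at this
      exact this
  refine ext_of_commutesWithX_two hij hL hR fun n m => ?_
  rw [← LinearMap.mem_eqLocus]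
  nth_rewrite 1 [show (X j : MvPolynomial σ ℂ) = (X j - X k) + X k by ring]
  rw [add_pow, Finset.mul_sum]
  refine sum_mem fun r _ => ?_
  have e : X i ^ n * ((X j - X k) ^ r * X k ^ (m - r) * (m.choose r : MvPolynomial σ ℂ)) =
      (m.choose r : ℂ) • (X k ^ (m - r) * (X i ^ n * (X j - X k) ^ r)) := by
    simp only [smul_eq_C_mul, map_natCast]
    ring
  rw [e]
  exact Submodule.smul_mem _ _ (pow_mul_mem_of_stable
    ((hL k hik.symm hjk.symm).eqLocus (hR k hik.symm hjk.symm)) _ (hmem n r))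

/-- The exchange relation for operators in two variables, under a genericity assumption. -/
theorem gammaRatio_exchange_of_generic {i j : σ} (hij : i ≠ j) {p q r t : ℂ}
    (hp : NotGammaPole p) (hq : NotGammaPole q) (ht : NotGammaPole t) (hpt : NotGammaPole (p + t))
    (h : t + p = r + q) :
    gammaRatio j i p q * gammaRatio i j r p = gammaRatio i j t q * gammaRatio j i r t := by
  have hL : ∀ l, l ≠ i → l ≠ j → CommutesWithX (gammaRatio j i p q * gammaRatio i j r p) l :=
    fun l h1 h2 => (commutesWithX_gammaRatio h2 _ _ _).mul (commutesWithX_gammaRatio h1 _ _ _)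
  have hR : ∀ l, l ≠ i → l ≠ j → CommutesWithX (gammaRatio i j t q * gammaRatio j i r t) l :=
    fun l h1 h2 => (commutesWithX_gammaRatio h1 _ _ _).mul (commutesWithX_gammaRatio h2 _ _ _)
  set L := gammaRatio j i p q * gammaRatio i j r p with hLdef
  set R := gammaRatio i j t q * gammaRatio j i r t with hRdef
  -- Either side interchanges the exponents t + m and p + m of the two powers and multiplies by
  -- (r)_m/(q)_m.
  have key : ∀ m : ℕ,
      coeffMap L (PowerSeries.C ((X i - X j) ^ m) * (negBinomSeries (t + m) (X j) *
        negBinomSeries (p + m) (X i))) =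
      coeffMap R (PowerSeries.C ((X i - X j) ^ m) * (negBinomSeries (t + m) (X j) *
        negBinomSeries (p + m) (X i))) := by
    intro m
    have fi : ∀ β, FreeOf i (negBinomSeries β (X j)) := FreeOf.negBinomSeries hij.symm
    have fj : ∀ β, FreeOf j (negBinomSeries β (X i)) := FreeOf.negBinomSeries hij
    -- The two operators see the same factor as z_ij^m and as z_ji^m; the signs cancel in the end.
    have sg : PowerSeries.C ((X i - X j : MvPolynomial σ ℂ) ^ m) =
        PowerSeries.C (C ((-1) ^ m)) * PowerSeries.C ((X j - X i) ^ m) := by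
      rw [← map_mul, ← neg_sub (X j : MvPolynomial σ ℂ) (X i), neg_pow, map_pow C, map_neg, map_one]
    have sg2 : (PowerSeries.C (C ((-1) ^ m)) * PowerSeries.C (C ((-1) ^ m)) :
        PowerSeries (MvPolynomial σ ℂ)) = 1 := by
      rw [← map_mul, ← map_mul, ← mul_pow]
      simp
    have l1 := coeffMap_gammaRatio hij r hp m (fi (t + m))
    have l2 := coeffMap_gammaRatio hij.symm p hq m ((FreeOf.scalar j (pochRatio r p m)).mul
      ((FreeOf.scalar j ((-1) ^ m)).mul (fj (r + m))))
    have r1 := coeffMap_gammaRatio hij.symm r ht m ((FreeOf.scalar j ((-1) ^ m)).mul (fj (p + m)))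
    have r2 := coeffMap_gammaRatio hij t hq m ((FreeOf.scalar i (pochRatio r t m)).mul (fi (r + m)))
    have q1 := negBinomSeries_mul_of_add_eq (a := p - r) (b := t + m) (c := q + m)
      (by linear_combination h) (X j : MvPolynomial σ ℂ)
    have q2 := negBinomSeries_mul_of_add_eq (a := q - p) (b := r + m) (c := t + m)
      (by linear_combination -h) (X i : MvPolynomial σ ℂ)
    have q3 := negBinomSeries_mul_of_add_eq (a := t - r) (b := p + m) (c := q + m)
      (by linear_combination h) (X i : MvPolynomial σ ℂ)
    have q4 := negBinomSeries_mul_of_add_eq (a := q - t) (b := r + m) (c := p + m)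
      (by linear_combination -h) (X j : MvPolynomial σ ℂ)
    have q5 : PowerSeries.C (C (pochRatio r p m) : MvPolynomial σ ℂ) *
        PowerSeries.C (C (pochRatio p q m)) = PowerSeries.C (C (pochRatio r q m)) := by
      rw [← map_mul, ← map_mul, pochRatio_mul hp]
    have q6 : PowerSeries.C (C (pochRatio r t m) : MvPolynomial σ ℂ) *
        PowerSeries.C (C (pochRatio t q m)) = PowerSeries.C (C (pochRatio r q m)) := by
      rw [← map_mul, ← map_mul, pochRatio_mul ht]
    rw [hLdef, hRdef, coeffMap_mul, coeffMap_mul]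
    refine (congrArg (coeffMap _) ((congrArg (coeffMap _) (by ring)).trans l1)).trans ?_
    refine ((congrArg (coeffMap _) ?_).trans l2).trans ?_
    · rw [sg]
      linear_combination (PowerSeries.C (C (pochRatio r p m)) * PowerSeries.C (C ((-1) ^ m)) *
        PowerSeries.C ((X j - X i) ^ m) * negBinomSeries (r + m) (X i)) * q1
    symm
    refine (congrArg (coeffMap _) ((congrArg (coeffMap _) ?_).trans r1)).trans ?_
    · rw [sg]
      ring
    refine ((congrArg (coeffMap _) ?_).trans r2).trans ?_
    · rw [sg]
      linear_combination (PowerSeries.C (C (pochRatio r t m)) * PowerSeries.C (C ((-1) ^ m)) *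
        PowerSeries.C ((X j - X i) ^ m) * negBinomSeries (r + m) (X j)) * q3
    rw [sg, ← q4, ← q2]
    linear_combination (PowerSeries.C (C ((-1) ^ m)) * PowerSeries.C ((X j - X i) ^ m) *
      negBinomSeries (q - t) (X j) * negBinomSeries (r + m) (X j) * negBinomSeries (q - p) (X i) *
      negBinomSeries (r + m) (X i)) * (q6 - q5)
  -- Re-expanded at z_i, the test function has the leading term z_ij^m (1 - x z_i)^{-(t+p+2m)}, the
  -- other terms carrying higher powers of z_ji. Genericity of p + t makes the leading coefficient
  -- nonzero.
  have hmem : ∀ n m, X i ^ n * (X i - X j) ^ m ∈ LinearMap.eqLocus L R := by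
    intro n
    induction n using Nat.strong_induction_on with
    | _ n ih =>
      intro m
      have hn := congrArg (PowerSeries.coeff n) (key m)
      rw [coeff_coeffMap, coeff_coeffMap, ← LinearMap.mem_eqLocus,
        PowerSeries.coeff_C_mul, coeff_negBinomSeries_mul_eq _ _ (X i), Finset.mul_sum,
        ← Finset.add_sum_erase _ _ (show (0, n) ∈ Finset.HasAntidiagonal.antidiagonal n by simp)]
        at hn
      have hrest : ∑ s ∈ (Finset.HasAntidiagonal.antidiagonal n).erase (0, n), (X i - X j) ^ m *
          negBinom (t + m) s.1 • ((X j - X i) ^ s.1 * PowerSeries.coeff s.2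
            (negBinomSeries (t + m + s.1) (X i) * negBinomSeries (p + m) (X i))) ∈
          LinearMap.eqLocus L R := by
        refine sum_mem fun s hs => ?_
        rw [Finset.mem_erase, Finset.HasAntidiagonal.mem_antidiagonal] at hs
        have hlt : s.2 < n := by
          rcases Nat.lt_or_ge s.2 n with h | h
          · exact h
          · exact absurd (Prod.ext (by simp; omega) (by simp; omega)) hs.1
        have e : (X i - X j : MvPolynomial σ ℂ) ^ m * negBinom (t + m) s.1 • ((X j - X i) ^ s.1 * PowerSeries.coeff s.2
            (negBinomSeries (t + m + s.1) (X i) * negBinomSeries (p + m) (X i))) =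
            (negBinom (t + m) s.1 * negBinom (t + m + s.1 + (p + m)) s.2 * (-1) ^ s.1) •
              (X i ^ s.2 * (X i - X j) ^ (m + s.1)) := by
          rw [negBinomSeries_mul, coeff_negBinomSeries, ← neg_sub (X i : MvPolynomial σ ℂ) (X j),
            neg_pow (X i - X j : MvPolynomial σ ℂ) s.1]
          simp only [smul_eq_C_mul, map_mul, map_pow, map_neg, map_one]
          ring
        rw [e]
        exact Submodule.smul_mem _ _ (ih s.2 hlt (m + s.1))
      have := (Submodule.add_mem_iff_left _ hrest).mp hn
      have hnp : NotGammaPole (t + m + (0 : ℕ) + (p + m)) := by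
        have := hpt.add_nat (m + m)
        convert this using 1
        push_cast
        ring
      rw [negBinom_zero, one_smul, pow_zero, one_mul, negBinomSeries_mul, coeff_negBinomSeries,
        mul_smul_comm, Submodule.smul_mem_iff _ (hnp.negBinom_ne_zero n), mul_comm] at this
      exact this
  refine ext_of_commutesWithX_two hij hL hR fun n m => ?_
  rw [← LinearMap.mem_eqLocus]
  nth_rewrite 1 [show (X j : MvPolynomial σ ℂ) = X i + -(X i - X j) by ring]
  rw [add_pow, Finset.mul_sum]
  refine sum_mem fun s _ => ?_
  have e : X i ^ n * (X i ^ s * (-(X i - X j)) ^ (m - s) * (m.choose s : MvPolynomial σ ℂ)) =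
      ((m.choose s : ℂ) * (-1) ^ (m - s)) • (X i ^ (n + s) * (X i - X j) ^ (m - s)) := by
    rw [neg_pow]
    simp only [smul_eq_C_mul, map_natCast, map_mul, map_pow, map_neg, map_one]
    ring
  rw [e]
  exact Submodule.smul_mem _ _ (hmem _ _)

end ExchangeRelations

/-! ### Removal of genericity conditions by continuity -/

section Continuity

variable {σ τ υ : Type}

/-- A family of polynomials in a finite-dimensional space that is continuous at `t₀`. -/
def ContFamilyAt (t₀ : ℂ) (f : ℂ → MvPolynomial σ ℂ) : Prop :=
  ∃ (ι : Type) (_ : Fintype ι) (c : ι → ℂ → ℂ) (p : ι → MvPolynomial σ ℂ),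
    (∀ i, ContinuousAt (c i) t₀) ∧ ∀ t, f t = ∑ i, c i t • p i

/-- A family of linear maps all of whose orbits are continuous at `t₀`. -/
def ContMapAt (t₀ : ℂ) (A : ℂ → MvPolynomial σ ℂ →ₗ[ℂ] MvPolynomial τ ℂ) : Prop :=
  ∀ p, ContFamilyAt t₀ fun t => A t p

theorem ContFamilyAt.continuousAt_coeff {t₀ : ℂ} {f : ℂ → MvPolynomial σ ℂ}
    (hf : ContFamilyAt t₀ f) (s : σ →₀ ℕ) : ContinuousAt (fun t => coeff s (f t)) t₀ := by
  obtain ⟨ι, _, c, p, hc, hf⟩ := hf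
  have : (fun t => coeff s (f t)) = fun t => ∑ i, c i t * coeff s (p i) := by
    funext t
    simp [hf t, coeff_sum]
  rw [this]
  exact tendsto_finsetSum _ fun i _ => (hc i).mul continuousAt_const

theorem ContMapAt.const (t₀ : ℂ) (A : MvPolynomial σ ℂ →ₗ[ℂ] MvPolynomial τ ℂ) :
    ContMapAt t₀ fun _ => A := fun p =>
  ⟨Unit, inferInstance, fun _ _ => 1, fun _ => A p, fun _ => continuousAt_const, fun _ => by simp⟩

theorem ContMapAt.comp {t₀ : ℂ} {A : ℂ → MvPolynomial τ ℂ →ₗ[ℂ] MvPolynomial υ ℂ}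
    {B : ℂ → MvPolynomial σ ℂ →ₗ[ℂ] MvPolynomial τ ℂ} (hA : ContMapAt t₀ A)
    (hB : ContMapAt t₀ B) : ContMapAt t₀ fun t => A t ∘ₗ B t := fun p => by
  obtain ⟨ι, _, c, q, hc, hB⟩ := hB p
  choose κ _ d r hd hA using fun i => hA (q i)
  refine ⟨Σ i, κ i, inferInstance, fun x t => c x.1 t * d x.1 x.2 t, fun x => r x.1 x.2,
    fun x => (hc x.1).mul (hd x.1 x.2), fun t => ?_⟩
  simp only at hA hB ⊢
  rw [LinearMap.comp_apply, hB, map_sum, Fintype.sum_sigma]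
  refine Finset.sum_congr rfl fun i _ => ?_
  rw [map_smul, hA, Finset.smul_sum]
  exact Finset.sum_congr rfl fun j _ => smul_smul _ _ _

theorem ContMapAt.mul {t₀ : ℂ} {A B : ℂ → Module.End ℂ (MvPolynomial σ ℂ)}
    (hA : ContMapAt t₀ A) (hB : ContMapAt t₀ B) : ContMapAt t₀ fun t => A t * B t :=
  hA.comp hB

/-- The complement of a countable set is dense in ℂ, and every matrix element is continuous at t₀.
-/
theorem ContMapAt.eq_of_countable {t₀ : ℂ} {A B : ℂ → MvPolynomial σ ℂ →ₗ[ℂ] MvPolynomial τ ℂ}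
    (hA : ContMapAt t₀ A) (hB : ContMapAt t₀ B) {S : Set ℂ} (hS : S.Countable)
    (h : ∀ t ∉ S, A t = B t) : A t₀ = B t₀ := by
  refine LinearMap.ext fun p => MvPolynomial.ext _ _ fun s => ?_
  have hd : t₀ ∈ closure Sᶜ := (hS.dense_compl ℂ) t₀
  have : (nhdsWithin t₀ Sᶜ).NeBot := mem_closure_iff_nhdsWithin_neBot.mp hd
  have h1 := ((hA p).continuousAt_coeff s).continuousWithinAt (s := Sᶜ)
  have h2 := ((hB p).continuousAt_coeff s).continuousWithinAt (s := Sᶜ)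
  refine tendsto_nhds_unique (h1.tendsto.congr' ?_) h2.tendsto
  filter_upwards [self_mem_nhdsWithin] with t ht
  rw [h t ht]

theorem countable_setOf_pole {f : ℂ → ℂ} (hf : Function.Injective f) :
    {t | ¬ NotGammaPole (f t)}.Countable := by
  have : {t | ¬ NotGammaPole (f t)} = f ⁻¹' Set.range fun n : ℕ => -(n : ℂ) := by
    ext t
    simp [NotGammaPole, eq_comm]
  rw [this]
  exact (Set.countable_range _).preimage hf

theorem countable_setOf_pole_add (c : ℂ) : {t | ¬ NotGammaPole (c + t)}.Countable :=
  countable_setOf_pole (add_right_injective c)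

theorem countable_setOf_pole_sub (c : ℂ) : {t | ¬ NotGammaPole (c - t)}.Countable :=
  countable_setOf_pole fun _ _ h => sub_right_injective h

variable [DecidableEq σ]

/-- Only the finitely many eigenvalues met by a given polynomial depend on t. They are rational in
the parameters, with denominators that do not vanish at t₀. -/
theorem contMapAt_gammaRatio (i j : σ) {t₀ : ℂ} {a b : ℂ → ℂ} (ha : ContinuousAt a t₀)
    (hb : ContinuousAt b t₀) (hpole : NotGammaPole (b t₀)) :
    ContMapAt t₀ fun t => gammaRatio i j (a t) (b t) := fun p => by
  set q := shiftVar i j 1 p with hq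
  refine ⟨q.support, inferInstance, fun s t => pochRatio (a t) (b t) (s.1 i),
    fun s => shiftVar i j (-1) (monomial s.1 (coeff s.1 q)), fun s => ?_, fun t => ?_⟩
  · exact ((Polynomial.continuous _).continuousAt.comp ha).div
      ((Polynomial.continuous _).continuousAt.comp hb) (hpole.ascPochhammer_ne_zero _)
  · simp only [gammaRatio, eulerFun]
    rw [LinearMap.comp_apply, LinearMap.comp_apply,
      AlgHom.toLinearMap_apply, AlgHom.toLinearMap_apply, ← hq]
    conv_lhs => rw [q.as_sum, map_sum, map_sum]
    rw [← Finset.sum_coe_sort]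
    refine Finset.sum_congr rfl fun s _ => ?_
    rw [degreeFun_monomial, map_smul]

/-- The exchange relation for operators in two variables. -/
theorem gammaRatio_exchange {i j : σ} (hij : i ≠ j) {p q r t : ℂ}
    (hp : NotGammaPole p) (hq : NotGammaPole q) (ht : NotGammaPole t) (h : t + p = r + q) :
    gammaRatio j i p q * gammaRatio i j r p = gammaRatio i j t q * gammaRatio j i r t := by
  -- Solving for r leaves t as a free parameter, which can be moved away from the poles of p + t
  -- while p and q stay fixed.
  obtain rfl : r = t + p - q := by linear_combination -h
  have c1 : ∀ t, ContinuousAt (fun t => t + p - q) t := fun t => by fun_prop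
  have hA : ContMapAt t fun t => gammaRatio j i p q * gammaRatio i j (t + p - q) p :=
    (ContMapAt.const t _).mul (contMapAt_gammaRatio i j (c1 t) continuousAt_const hp)
  have hB : ContMapAt t fun t => gammaRatio i j t q * gammaRatio j i (t + p - q) t :=
    (contMapAt_gammaRatio i j continuousAt_id continuousAt_const hq).mul
      (contMapAt_gammaRatio j i (c1 t) continuousAt_id ht)
  refine hA.eq_of_countable hB ((countable_setOf_pole Function.injective_id).union
    (countable_setOf_pole_add p)) fun t ht => ?_
  simp only [Set.mem_union, Set.mem_ofPred_eq, not_or, not_not, id] at ht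
  exact gammaRatio_exchange_of_generic hij hp hq ht.1 ht.2 (by ring)

end Continuity

/-! ### The three-term relations of part (a) -/

section ThreeTermRelations

/-- The two factors of the rightmost Ř are exchanged, which brings three R⁻ into braid position; R⁻
in z_0 and R⁺ in z_2 share the reference point z_1 and commute. The remaining relations restore the
order R⁺ R⁻ in both Ř. -/
theorem Rminus_Rcheck_Rcheck_of_generic {up um vp vm wp wm : ℂ} (hu : NotGammaPole (up - um))
    (hvu : NotGammaPole (vp - um)) (hv : NotGammaPole (vp - vm)) (huv : NotGammaPole (up - vm))
    (hw : NotGammaPole (vp - wm)) :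
    (Rminus 0 1 vp vm wm * Rcheck 1 2 up um wp wm * Rcheck 0 1 up um vp vm :
        Module.End ℂ (MvPolynomial (Fin 3) ℂ)) =
      Rcheck 1 2 up um wp vm * Rcheck 0 1 up um vp wm * Rminus 1 2 vp vm wm := by
  have h01 : (0 : Fin 3) ≠ 1 := by decide
  have h12 : (1 : Fin 3) ≠ 2 := by decide
  have h02 : (0 : Fin 3) ≠ 2 := by decide
  -- The computation in an abstract word, with the five relations as hypotheses.
  have hM : ∀ {A D E P Q F G H I J K L Q' : Module.End ℂ (MvPolynomial (Fin 3) ℂ)},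
      P * Q = F * G → A * D = D * A → A * E * F = H * I * J → J * G = K * L → P * Q' = I * K →
      A * (D * E) * (P * Q) = D * H * (P * Q') * L := by
    intro A D E P Q F G H I J K L Q' e1 e2 e3 e4 e5
    calc A * (D * E) * (P * Q) = (A * D) * E * F * G := by simp only [e1, mul_assoc]
      _ = D * (A * E * F) * G := by simp only [e2, mul_assoc]
      _ = D * H * I * (J * G) := by simp only [e3, mul_assoc]
      _ = D * H * (P * Q') * L := by simp only [e4, e5, mul_assoc]
  exact hM
    (gammaRatio_exchange h01 hu hvu hv (by ring))
    (gammaRatio_commute h01 h12.symm h02 h01 h12.symm _ _ _ _)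
    (gammaRatio_braid h01 h02 h12 (x₁ := vp - um) (x₂ := vp - vm) (x₃ := vp - wm)
      (y₁ := up - um) (y₂ := up - vm) (y₃ := up - wm) hvu hv hu huv (by ring) (by ring))
    (gammaRatio_exchange_same h01.symm h12 huv hv hw (by ring))
    (gammaRatio_exchange h01 hu hvu hw (by ring))

/-- The mirror image of the preceding argument: the braid relation is now used for R⁺, with the
variables in the order z_2, z_1, z_0. -/
theorem Rplus_Rcheck_Rcheck_of_generic {up um vp vm wp wm : ℂ} (hu : NotGammaPole (up - um))
    (hvu : NotGammaPole (vp - um)) (hwu : NotGammaPole (wp - um)) (hw : NotGammaPole (wp - wm))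
    (hv : NotGammaPole (vp - wm)) :
    (Rplus 0 1 vp wp wm * Rcheck 1 2 up um wp wm * Rcheck 0 1 up um vp vm :
        Module.End ℂ (MvPolynomial (Fin 3) ℂ)) =
      Rcheck 1 2 up um vp wm * Rcheck 0 1 up um wp vm * Rplus 1 2 vp wp wm := by
  have h01 : (0 : Fin 3) ≠ 1 := by decide
  have h12 : (1 : Fin 3) ≠ 2 := by decide
  have h02 : (0 : Fin 3) ≠ 2 := by decide
  have hM : ∀ {A D E P Q D' P' T F I J K L : Module.End ℂ (MvPolynomial (Fin 3) ℂ)},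
      Q * T = T * Q → E * P = K * L → A * D * K = D' * I * J → J * L = F * T → I * F = E * P' →
      A * (D * E) * (P * Q) = D' * E * (P' * Q) * T := by
    intro A D E P Q D' P' T F I J K L e1 e2 e3 e4 e5
    calc A * (D * E) * (P * Q) = A * D * (E * P) * Q := by simp only [mul_assoc]
      _ = (A * D * K) * L * Q := by simp only [e2, mul_assoc]
      _ = D' * I * (J * L) * Q := by simp only [e3, mul_assoc]
      _ = D' * (I * F) * (T * Q) := by simp only [e4, mul_assoc]
      _ = D' * E * (P' * Q) * T := by simp only [e5, ← e1, mul_assoc]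
  exact hM
    (gammaRatio_commute h01 h12.symm h02 h01 h12.symm _ _ _ _)
    (gammaRatio_exchange_same h01.symm h12 (d := vp - wm) hu hvu hv (by ring))
    (gammaRatio_braid h12.symm h02.symm h01.symm (x₁ := wp - um) (x₂ := vp - um) (x₃ := up - um)
      (y₁ := wp - wm) (y₂ := vp - wm) (y₃ := up - wm) hwu hvu hw hv (by ring) (by ring)).symm
    (gammaRatio_exchange h12 hvu hwu hw (by ring))
    (gammaRatio_exchange_same h01.symm h12 hu hwu hw (by ring)).symm

theorem contMapAt_Rminus {σ : Type} [DecidableEq σ] (i j : σ) {up um vm : ℂ → ℂ} {t₀ : ℂ}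
    (hup : ContinuousAt up t₀) (hum : ContinuousAt um t₀) (hvm : ContinuousAt vm t₀)
    (h : NotGammaPole (up t₀ - um t₀)) :
    ContMapAt t₀ fun t => Rminus i j (up t) (um t) (vm t) :=
  contMapAt_gammaRatio i j (hup.sub hvm) (hup.sub hum) h

theorem contMapAt_Rplus {σ : Type} [DecidableEq σ] (i j : σ) {up vp vm : ℂ → ℂ} {t₀ : ℂ}
    (hup : ContinuousAt up t₀) (hvp : ContinuousAt vp t₀) (hvm : ContinuousAt vm t₀)
    (h : NotGammaPole (vp t₀ - vm t₀)) :
    ContMapAt t₀ fun t => Rplus i j (up t) (vp t) (vm t) :=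
  contMapAt_gammaRatio j i (hup.sub hvm) (hvp.sub hvm) h

theorem contMapAt_Rcheck {σ : Type} [DecidableEq σ] (i j : σ) (up um vp : ℂ) {vm : ℂ → ℂ} {t₀ : ℂ}
    (hvm : ContinuousAt vm t₀) (hu : NotGammaPole (up - um)) :
    ContMapAt t₀ fun t => Rcheck i j up um vp (vm t) :=
  (ContMapAt.const _ _).mul (contMapAt_Rminus i j continuousAt_const continuousAt_const hvm hu)

theorem Rminus_Rcheck_Rcheck {up um vp vm wp wm : ℂ} (hu : NotGammaPole (up - um))
    (hvu : NotGammaPole (vp - um)) (hv : NotGammaPole (vp - vm)) :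
    (Rminus 0 1 vp vm wm * Rcheck 1 2 up um wp wm * Rcheck 0 1 up um vp vm :
        Module.End ℂ (MvPolynomial (Fin 3) ℂ)) =
      Rcheck 1 2 up um wp vm * Rcheck 0 1 up um vp wm * Rminus 1 2 vp vm wm := by
  -- Shifting v₋ and w₋ by the same t removes both extra conditions at once; t = 0 is the claim.
  have hvm : ContinuousAt (fun t : ℂ => vm + t) 0 := by fun_prop
  have hwm : ContinuousAt (fun t : ℂ => wm + t) 0 := by fun_prop
  have hv' : NotGammaPole (vp - (vm + 0)) := by rwa [add_zero]
  have hA := ((contMapAt_Rminus (0 : Fin 3) 1 (continuousAt_const (y := vp)) hvm hwm hv').mul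
    (contMapAt_Rcheck 1 2 up um wp hwm hu)).mul (contMapAt_Rcheck 0 1 up um vp hvm hu)
  have hB := ((contMapAt_Rcheck (1 : Fin 3) 2 up um wp hvm hu).mul
    (contMapAt_Rcheck 0 1 up um vp hwm hu)).mul
    (contMapAt_Rminus 1 2 (continuousAt_const (y := vp)) hvm hwm hv')
  have := hA.eq_of_countable hB (((countable_setOf_pole_sub (up - vm)).union
    (countable_setOf_pole_sub (vp - wm))).union (countable_setOf_pole_sub (vp - vm)))
    fun t ht => by
      simp only [Set.mem_union, Set.mem_ofPred_eq, not_or, not_not, sub_sub] at ht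
      exact Rminus_Rcheck_Rcheck_of_generic hu hvu ht.2 ht.1.1 ht.1.2
  simpa only [add_zero] using this

theorem Rplus_Rcheck_Rcheck {up um vp vm wp wm : ℂ} (hu : NotGammaPole (up - um))
    (hvu : NotGammaPole (vp - um)) (hwu : NotGammaPole (wp - um)) (hw : NotGammaPole (wp - wm)) :
    (Rplus 0 1 vp wp wm * Rcheck 1 2 up um wp wm * Rcheck 0 1 up um vp vm :
        Module.End ℂ (MvPolynomial (Fin 3) ℂ)) =
      Rcheck 1 2 up um vp wm * Rcheck 0 1 up um wp vm * Rplus 1 2 vp wp wm := by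
  -- The only superfluous condition involves v₊ - w₋, so w₋ alone is varied.
  have hA := ((contMapAt_Rplus (0 : Fin 3) 1 (continuousAt_const (y := vp))
    (continuousAt_const (y := wp)) continuousAt_id hw).mul
    (contMapAt_Rcheck 1 2 up um wp continuousAt_id hu)).mul
    (ContMapAt.const wm (Rcheck 0 1 up um vp vm))
  have hB := ((contMapAt_Rcheck (1 : Fin 3) 2 up um vp continuousAt_id hu).mul
    (ContMapAt.const wm (Rcheck 0 1 up um wp vm))).mul
    (contMapAt_Rplus (1 : Fin 3) 2 (continuousAt_const (y := vp))
      (continuousAt_const (y := wp)) continuousAt_id hw)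
  exact hA.eq_of_countable hB ((countable_setOf_pole_sub vp).union (countable_setOf_pole_sub wp))
    fun t ht => by
      simp only [Set.mem_union, Set.mem_ofPred_eq, not_or, not_not] at ht
      exact Rplus_Rcheck_Rcheck_of_generic hu hvu hwu ht.2 ht.1

end ThreeTermRelations

/-! ### Renaming of variables and permutations -/

section Transport

variable {σ τ : Type} [DecidableEq σ] [DecidableEq τ]

theorem rename_shiftVar {f : σ → τ} (hf : Function.Injective f) (i j : σ) (c : ℂ)
    (p : MvPolynomial σ ℂ) :
    rename f (shiftVar i j c p) = shiftVar (f i) (f j) c (rename f p) := by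
  have : (rename f).comp (shiftVar i j c) = (shiftVar (f i) (f j) c).comp (rename f) := by
    refine algHom_ext fun k => ?_
    by_cases h : k = i
    · subst h
      simp [shiftVar_X_self]
    · simp [shiftVar_X_of_ne h, shiftVar_X_of_ne (hf.ne h)]
  exact DFunLike.congr_fun this p

omit [DecidableEq σ] [DecidableEq τ] in
theorem rename_degreeFun {f : σ → τ} (hf : Function.Injective f) (i : σ) (g : ℕ → ℂ)
    (p : MvPolynomial σ ℂ) :
    rename f (degreeFun i g p) = degreeFun (f i) g (rename f p) := by
  induction p using MvPolynomial.induction_on' with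
  | monomial s c =>
    rw [degreeFun_monomial, map_smul, rename_monomial, degreeFun_monomial,
      Finsupp.mapDomain_apply hf]
  | add p q hp hq => simp only [map_add, hp, hq]

theorem rename_eulerFun {f : σ → τ} (hf : Function.Injective f) (i j : σ) (g : ℕ → ℂ)
    (p : MvPolynomial σ ℂ) :
    rename f (eulerFun i j g p) = eulerFun (f i) (f j) g (rename f p) := by
  simp only [eulerFun, LinearMap.comp_apply, AlgHom.toLinearMap_apply, rename_shiftVar hf,
    rename_degreeFun hf]

theorem rename_gammaRatio {f : σ → τ} (hf : Function.Injective f) (i j : σ) (a b : ℂ)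
    (p : MvPolynomial σ ℂ) :
    rename f (gammaRatio i j a b p) = gammaRatio (f i) (f j) a b (rename f p) :=
  rename_eulerFun hf i j _ p

theorem permOp_apply (i j : σ) (p : MvPolynomial σ ℂ) :
    permOp i j p = rename (Equiv.swap i j) p := rfl

theorem rename_permOp {f : σ → τ} (hf : Function.Injective f) (i j : σ) (p : MvPolynomial σ ℂ) :
    rename f (permOp i j p) = permOp (f i) (f j) (rename f p) := by
  rw [permOp_apply, permOp_apply, rename_rename, rename_rename, hf.swap_comp]

theorem permOp_mul_gammaRatio (i j k l : σ) (a b : ℂ) :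
    permOp i j * gammaRatio k l a b =
      gammaRatio (Equiv.swap i j k) (Equiv.swap i j l) a b * permOp i j :=
  LinearMap.ext fun p => rename_gammaRatio (Equiv.swap i j).injective k l a b p

theorem permOp_commute {i j k l : σ} (hik : i ≠ k) (hil : i ≠ l) (hjk : j ≠ k) (hjl : j ≠ l) :
    Commute (permOp i j) (permOp k l) := by
  refine LinearMap.ext fun p => ?_
  have h := rename_permOp (Equiv.swap i j).injective k l p
  rwa [Equiv.swap_apply_of_ne_of_ne hik.symm hjk.symm,
    Equiv.swap_apply_of_ne_of_ne hil.symm hjl.symm] at h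

theorem permOp_commute_gammaRatio {i j k l : σ} (hik : i ≠ k) (hil : i ≠ l) (hjk : j ≠ k)
    (hjl : j ≠ l) (a b : ℂ) : Commute (permOp i j) (gammaRatio k l a b) := by
  have h := permOp_mul_gammaRatio i j k l a b
  rwa [Equiv.swap_apply_of_ne_of_ne hik.symm hjk.symm,
    Equiv.swap_apply_of_ne_of_ne hil.symm hjl.symm] at h

theorem permOp_X_left_mul (i j : σ) (p : MvPolynomial σ ℂ) :
    permOp i j (X i * p) = X j * permOp i j p := by
  simp [permOp_apply]

theorem commutesWithX_permOp {i j l : σ} (hi : l ≠ i) (hj : l ≠ j) :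
    CommutesWithX (permOp i j) l := fun p => by
  simp [permOp_apply, Equiv.swap_apply_of_ne_of_ne hi hj]

end Transport

/-! ### Ordered products over the sites -/

section Lists

variable {σ κ : Type}

theorem CommutesWithX.list_prod {l : σ} (L : List (Module.End ℂ (MvPolynomial σ ℂ)))
    (h : ∀ T ∈ L, CommutesWithX T l) : CommutesWithX L.prod l := by
  induction L with
  | nil => exact CommutesWithX.one l
  | cons T L ih =>
    rw [List.prod_cons]
    exact (h T (by simp)).mul (ih fun T' hT' => h T' (by simp [hT']))

/-- `L` maps homogeneous polynomials to homogeneous polynomials of the same degree. -/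
def PreservesDegree (L : Module.End ℂ (MvPolynomial σ ℂ)) : Prop :=
  ∀ n p, p.IsHomogeneous n → (L p).IsHomogeneous n

theorem PreservesDegree.mul {L L' : Module.End ℂ (MvPolynomial σ ℂ)} (h : PreservesDegree L)
    (h' : PreservesDegree L') : PreservesDegree (L * L') := fun n p hp => h n _ (h' n p hp)

theorem PreservesDegree.list_prod (L : List (Module.End ℂ (MvPolynomial σ ℂ)))
    (h : ∀ T ∈ L, PreservesDegree T) : PreservesDegree L.prod := by
  induction L with
  | nil => exact fun n p hp => hp
  | cons T L ih =>
    rw [List.prod_cons]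
    exact (h T (by simp)).mul (ih fun T' hT' => h T' (by simp [hT']))

variable [DecidableEq σ]

theorem preservesDegree_shiftVar (i j : σ) (c : ℂ) :
    PreservesDegree (shiftVar i j c).toLinearMap := fun n p hp => by
  rw [← one_mul n]
  refine hp.aeval _ fun k => ?_
  by_cases h : k = i
  · subst h
    rw [Function.update_self]
    exact (isHomogeneous_X _ _).add ((isHomogeneous_X _ _).C_mul c)
  · rw [Function.update_of_ne h]
    exact isHomogeneous_X _ _

omit [DecidableEq σ] in
theorem preservesDegree_degreeFun (i : σ) (f : ℕ → ℂ) : PreservesDegree (degreeFun i f) :=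
  fun n p hp => by
    rw [p.as_sum, map_sum]
    refine IsHomogeneous.sum _ _ _ fun s hs => ?_
    rw [degreeFun_monomial, smul_monomial]
    refine isHomogeneous_monomial _ ?_
    have := hp (mem_support_iff.mp hs)
    rwa [Finsupp.degree_eq_weight_one]

theorem preservesDegree_gammaRatio (i j : σ) (a b : ℂ) : PreservesDegree (gammaRatio i j a b) :=
  (preservesDegree_shiftVar i j (-1)).mul
    ((preservesDegree_degreeFun i _).mul (preservesDegree_shiftVar i j 1))

theorem preservesDegree_permOp (i j : σ) : PreservesDegree (permOp i j) :=
  fun _ _ hp => hp.rename_isHomogeneous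

theorem gammaRatio_one (i j : σ) (a b : ℂ) : gammaRatio i j a b 1 = 1 := by
  have h : (1 : MvPolynomial σ ℂ) = monomial 0 1 := rfl
  simp only [gammaRatio, eulerFun, LinearMap.comp_apply, AlgHom.toLinearMap_apply, map_one]
  rw [h, degreeFun_monomial, ← h]
  simp [pochRatio]

/-- The ordered product of the operators `Γ(b_k)/Γ(a_k) · Γ(z_{kj} ∂_k + a_k)/Γ(z_{kj} ∂_k + b_k)`
over a list of sites `k`, with the next site in the list as `j`, and with `z_j = z_o` for the last
one. The site `k` has the variable `s k`. -/
noncomputable def gammaChain (s : κ → σ) (o : σ) (a b : κ → ℂ) :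
    List κ → Module.End ℂ (MvPolynomial σ ℂ)
  | [] => 1
  | k :: l => gammaRatio (s k) (l.head?.elim o s) (a k) (b k) * gammaChain s o a b l

theorem gammaChain_one (s : κ → σ) (o : σ) (a b : κ → ℂ) (l : List κ) :
    gammaChain s o a b l 1 = 1 := by
  induction l with
  | nil => rfl
  | cons k l ih => rw [gammaChain, Module.End.mul_apply, ih, gammaRatio_one]

theorem commutesWithX_gammaChain {s : κ → σ} {o : σ} (hs : ∀ k, o ≠ s k) (a b : κ → ℂ)
    (l : List κ) : CommutesWithX (gammaChain s o a b l) o := by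
  induction l with
  | nil => exact CommutesWithX.one o
  | cons k l ih => exact (commutesWithX_gammaRatio (hs k) _ _ _).mul ih

theorem contMapAt_gammaChain (s : κ → σ) (o : σ) {a : ℂ → κ → ℂ} {b : κ → ℂ} {t₀ : ℂ}
    (ha : ∀ k, ContinuousAt (fun t => a t k) t₀) (hb : ∀ k, NotGammaPole (b k)) (l : List κ) :
    ContMapAt t₀ fun t => gammaChain s o (a t) b l := by
  induction l with
  | nil => exact ContMapAt.const _ _
  | cons k l ih => exact (contMapAt_gammaRatio _ _ (ha k) continuousAt_const (hb k)).mul ih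

/-- Moving the right factors of a product to the right end. -/
theorem prod_map_mul_gammaRatio {s : κ → σ} (hs : Function.Injective s) {o : σ}
    (ho : ∀ k, o ≠ s k) (a b : κ → ℂ) {T : κ → Module.End ℂ (MvPolynomial σ ℂ)}
    (h1 : ∀ k i c d, i ≠ s k → i ≠ o →
      gammaRatio i o c d * T k = T k * gammaRatio i (s k) c d)
    (h2 : ∀ k i j c d, i ≠ s k → i ≠ o → j ≠ s k → j ≠ o → i ≠ j →
      Commute (gammaRatio i j c d) (T k)) (l : List κ) (hl : l.Nodup) :
    (l.map fun k => T k * gammaRatio (s k) o (a k) (b k)).prod =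
      (l.map T).prod * gammaChain s o a b l := by
  induction l with
  | nil => rfl
  | cons k l ih =>
    rw [List.nodup_cons] at hl
    -- Only the operator of the next site changes the reference point, from z_o to the variable of
    -- that site; afterwards neither variable is touched by the later sites.
    have key : gammaRatio (s k) o (a k) (b k) * (l.map T).prod =
        (l.map T).prod * gammaRatio (s k) (l.head?.elim o s) (a k) (b k) := by
      rcases l with _ | ⟨j, l⟩
      · simp
      · have hkj : k ≠ j := fun h => hl.1 (by simp [h])
        have hcomm : Commute (gammaRatio (s k) (s j) (a k) (b k)) (l.map T).prod := by
          refine Commute.list_prod_right _ _ fun x hx => ?_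
          obtain ⟨i, hi, rfl⟩ := List.mem_map.mp hx
          refine h2 i _ _ _ _ (hs.ne ?_) (ho k).symm (hs.ne ?_) (ho j).symm (hs.ne hkj)
          · rintro rfl
            exact hl.1 (by simp [hi])
          · rintro rfl
            exact (List.nodup_cons.mp hl.2).1 hi
        rw [List.map_cons, List.prod_cons, ← mul_assoc, h1 j _ _ _ (hs.ne hkj) (ho k).symm,
          mul_assoc, hcomm.eq, ← mul_assoc]
        rfl
    rw [List.map_cons, List.prod_cons, ih hl.2, List.map_cons, List.prod_cons, gammaChain,
      mul_assoc, ← mul_assoc (gammaRatio _ _ _ _), key]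
    simp only [mul_assoc]

/-- A product of transpositions with a common element is a cycle. -/
theorem prod_swap_range (g : ℕ → σ) (n : ℕ) (N : ℕ) (hN : n ≤ N)
    (hg : ∀ i ≤ N, ∀ j ≤ N, g i = g j → i = j) :
    ((List.range n).map fun k => Equiv.swap (g (k + 1)) (g 0)).prod (g 0) = g n ∧
    (∀ k < n, ((List.range n).map fun k => Equiv.swap (g (k + 1)) (g 0)).prod (g (k + 1)) = g k) ∧
    ∀ k ≤ N, n < k →
      ((List.range n).map fun k => Equiv.swap (g (k + 1)) (g 0)).prod (g k) = g k := by
  induction n with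
  | zero => simp
  | succ n ih =>
    obtain ⟨h0, h1, h2⟩ := ih (by omega)
    have hne : ∀ i ≤ N, ∀ j ≤ N, i ≠ j → g i ≠ g j := fun i hi j hj hij h => hij (hg i hi j hj h)
    simp only [List.range_succ, List.map_append, List.prod_append, List.map_cons, List.map_nil,
      List.prod_cons, List.prod_nil, mul_one, Equiv.Perm.mul_apply]
    refine ⟨?_, fun k hk => ?_, fun k hk hnk => ?_⟩
    · rw [Equiv.swap_apply_right]
      exact h2 _ hN (by omega)
    · rcases Nat.lt_succ_iff_lt_or_eq.mp hk with hk | rfl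
      · rw [Equiv.swap_apply_of_ne_of_ne (hne _ (by omega) _ (by omega) (by omega))
          (hne _ (by omega) _ (by omega) (by omega))]
        exact h1 k hk
      · rw [Equiv.swap_apply_left]
        exact h0
    · rw [Equiv.swap_apply_of_ne_of_ne (hne _ (by omega) _ (by omega) (by omega))
          (hne _ (by omega) _ (by omega) (by omega))]
      exact h2 k hk (by omega)

theorem list_prod_permOp (l : List κ) (s : κ → σ) (o : σ) (p : MvPolynomial σ ℂ) :
    (l.map fun k => permOp (s k) o).prod p =
      rename (l.map fun k => Equiv.swap (s k) o).prod p := by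
  induction l generalizing p with
  | nil => simp
  | cons k l ih =>
    rw [List.map_cons, List.prod_cons, Module.End.mul_apply, ih, permOp_apply, rename_rename,
      List.map_cons, List.prod_cons, Equiv.Perm.coe_mul]

end Lists

/-! ### The trace over the auxiliary space -/

section AuxiliarySpace

variable {N : ℕ}

/-- The coefficient of `z_0^m`. -/
noncomputable def auxCoeff (m : ℕ) :
    MvPolynomial (Fin (N + 1)) ℂ →ₗ[ℂ] MvPolynomial (Fin N) ℂ where
  toFun p := (finSuccEquiv ℂ N p).coeff m
  map_add' p q := by rw [map_add, Polynomial.coeff_add]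
  map_smul' c p := by rw [map_smul, Polynomial.coeff_smul, RingHom.id_apply]

theorem auxTerm_eq_auxCoeff (A : Module.End ℂ (MvPolynomial (Fin (N + 1)) ℂ)) (m : ℕ)
    (Ψ : MvPolynomial (Fin N) ℂ) :
    auxTerm A m Ψ = auxCoeff m (A (X 0 ^ m * rename Fin.succ Ψ)) := rfl

theorem coeff_auxCoeff (m : ℕ) (p : MvPolynomial (Fin (N + 1)) ℂ) (s : Fin N →₀ ℕ) :
    coeff s (auxCoeff m p) = coeff (s.cons m) p := finSuccEquiv_coeff_coeff s p m

theorem finSuccEquiv_rename_succ (q : MvPolynomial (Fin N) ℂ) :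
    finSuccEquiv ℂ N (rename Fin.succ q) = Polynomial.C q := by
  induction q using MvPolynomial.induction_on with
  | C a =>
    rw [rename_C]
    have := (finSuccEquiv ℂ N).commutes a
    simpa [algebraMap_eq, Polynomial.algebraMap_apply] using this
  | add p q hp hq => rw [map_add, map_add, hp, hq, map_add]
  | mul_X p i hp => rw [map_mul, map_mul, hp, rename_X, finSuccEquiv_X_succ, map_mul]

theorem auxCoeff_rename_mul (m : ℕ) (q : MvPolynomial (Fin N) ℂ)
    (p : MvPolynomial (Fin (N + 1)) ℂ) :
    auxCoeff m (rename Fin.succ q * p) = q * auxCoeff m p := by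
  simp only [auxCoeff, LinearMap.coe_mk, AddHom.coe_mk, map_mul, finSuccEquiv_rename_succ,
    Polynomial.coeff_C_mul]

theorem auxCoeff_X_pow_mul (m j : ℕ) (p : MvPolynomial (Fin (N + 1)) ℂ) :
    auxCoeff m (X 0 ^ j * p) = if j ≤ m then auxCoeff (m - j) p else 0 := by
  simp only [auxCoeff, LinearMap.coe_mk, AddHom.coe_mk, map_mul, map_pow, finSuccEquiv_X_zero,
    Polynomial.coeff_X_pow_mul']

theorem auxCoeff_add_X_pow_mul (m j : ℕ) (p : MvPolynomial (Fin (N + 1)) ℂ) :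
    auxCoeff (m + j) (X 0 ^ j * p) = auxCoeff m p := by
  rw [auxCoeff_X_pow_mul, if_pos (Nat.le_add_left j m), Nat.add_sub_cancel]

theorem auxCoeff_monomial (m j : ℕ) (q : MvPolynomial (Fin N) ℂ) :
    auxCoeff m (X 0 ^ j * rename Fin.succ q) = if m = j then q else 0 := by
  rw [mul_comm, auxCoeff_rename_mul, auxCoeff]
  simp only [LinearMap.coe_mk, AddHom.coe_mk, map_pow, finSuccEquiv_X_zero, Polynomial.coeff_X_pow]
  split_ifs <;> simp

theorem monomial_cons (j : ℕ) (s : Fin N →₀ ℕ) (c : ℂ) :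
    (monomial (s.cons j) c : MvPolynomial (Fin (N + 1)) ℂ) =
      X 0 ^ j * rename Fin.succ (monomial s c) := by
  ext t
  rw [← Finsupp.cons_tail t, ← coeff_auxCoeff, ← coeff_auxCoeff, auxCoeff_monomial, coeff_auxCoeff,
    coeff_monomial]
  have : s.cons j = (Finsupp.cons (t 0) t.tail : Fin (N + 1) →₀ ℕ) ↔ t 0 = j ∧ s = t.tail := by
    constructor
    · intro h
      refine ⟨?_, ?_⟩
      · rw [← Finsupp.cons_zero j s, h, Finsupp.cons_zero]
      · rw [← Finsupp.tail_cons j s, h, Finsupp.tail_cons]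
    · rintro ⟨rfl, rfl⟩
      rfl
  by_cases h1 : t 0 = j
  · rw [if_pos h1, coeff_monomial]
    exact if_congr (this.trans (and_iff_right h1)) rfl rfl
  · rw [if_neg h1, if_neg fun h => h1 (this.mp h).1, coeff_zero]

theorem aux_induction {P : MvPolynomial (Fin (N + 1)) ℂ → Prop}
    (h : ∀ j q, P (X 0 ^ j * rename Fin.succ q)) (hadd : ∀ p q, P p → P q → P (p + q))
    (p : MvPolynomial (Fin (N + 1)) ℂ) : P p := by
  induction p using MvPolynomial.induction_on' with
  | monomial s c =>
    rw [← Finsupp.cons_tail s, monomial_cons]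
    exact h _ _
  | add p q hp hq => exact hadd p q hp hq

/-- The substitution of `z_k` for the auxiliary variable `z_0`. -/
noncomputable def auxSubst (k : Fin N) : MvPolynomial (Fin (N + 1)) ℂ →ₐ[ℂ] MvPolynomial (Fin N) ℂ :=
  aeval (Fin.cons (X k) X)

theorem auxSubst_monomial (k : Fin N) (j : ℕ) (q : MvPolynomial (Fin N) ℂ) :
    auxSubst k (X 0 ^ j * rename Fin.succ q) = X k ^ j * q := by
  rw [map_mul, map_pow, auxSubst, aeval_X, Fin.cons_zero, aeval_rename]
  congr 1
  have : (Fin.cons (X k) X : Fin (N + 1) → MvPolynomial (Fin N) ℂ) ∘ Fin.succ = X := by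
    funext i
    simp
  rw [this, aeval_X_left_apply]

/-- If `A z_k = z_0 A`, then the trace of `A p` for an operator of multiplication by a polynomial
`p(z_0, z_1, …)` is obtained from the trace of `A` by the substitution `z_0 = z_k` in `p`. -/
theorem HasAuxTrace.hasSum_auxSubst {A : Module.End ℂ (MvPolynomial (Fin (N + 1)) ℂ)}
    {B : Module.End ℂ (MvPolynomial (Fin N) ℂ)} (h : HasAuxTrace A B) {k : Fin N}
    (hk : ∀ p, A (X k.succ * p) = X 0 * A p) (p : MvPolynomial (Fin (N + 1)) ℂ) (s : Fin N →₀ ℕ) :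
    HasSum (fun m : ℕ => coeff s (auxCoeff m (A (X 0 ^ m * p)))) (coeff s (B (auxSubst k p))) := by
  have hpow : ∀ j p, A (X k.succ ^ j * p) = X 0 ^ j * A p := by
    intro j
    induction j with
    | zero => simp
    | succ j ih =>
      intro p
      rw [pow_succ', mul_assoc, hk, ih, pow_succ', mul_assoc]
  induction p using aux_induction with
  | h j q =>
    -- Since A z_k^j = z_0^j A, the trace series of z_k^j q is that of z_0^j q inserted under A,
    -- shifted by j; its first j terms vanish because z_0^j divides the image.
    have e : ∀ m, auxTerm A m (X k ^ j * q) =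
        auxCoeff m (X 0 ^ j * A (X 0 ^ m * rename Fin.succ q)) := by
      intro m
      rw [auxTerm_eq_auxCoeff, map_mul (rename Fin.succ), map_pow, rename_X, mul_left_comm, hpow]
    rw [auxSubst_monomial]
    have hsum := (hasSum_nat_add_iff' j).mpr (h (X k ^ j * q) s)
    have hzero : ∑ i ∈ Finset.range j, coeff s (auxTerm A i (X k ^ j * q)) = 0 := by
      refine Finset.sum_eq_zero fun i hi => ?_
      rw [e, auxCoeff_X_pow_mul, if_neg (by simpa using hi), coeff_zero]
    rw [hzero, sub_zero] at hsum
    have e2 : (fun m : ℕ => coeff s (auxCoeff m (A (X 0 ^ m * (X 0 ^ j * rename Fin.succ q))))) =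
        fun m => coeff s (auxTerm A (m + j) (X k ^ j * q)) := by
      funext m
      rw [e, auxCoeff_add_X_pow_mul, ← mul_assoc, ← pow_add]
    rw [e2]
    exact hsum
  | hadd p q hp hq =>
    have := hp.add hq
    simpa only [mul_add, map_add, coeff_add] using this

/-- As C commutes with z_0, one has A C z_0^m Ψ = A z_0^m (C Ψ). Here C Ψ may depend on z_0, and
`HasAuxTrace.hasSum_auxSubst` puts z_0 = z_k in it. -/
theorem HasAuxTrace.mul_right {A C : Module.End ℂ (MvPolynomial (Fin (N + 1)) ℂ)}
    {B : Module.End ℂ (MvPolynomial (Fin N) ℂ)} (h : HasAuxTrace A B) {k : Fin N}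
    (hk : ∀ p, A (X k.succ * p) = X 0 * A p) (hC : CommutesWithX C 0) :
    HasAuxTrace (A * C) (B * ((auxSubst k).toLinearMap ∘ₗ C ∘ₗ (rename Fin.succ).toLinearMap)) := by
  have hpow : ∀ j p, C (X 0 ^ j * p) = X 0 ^ j * C p := fun j p =>
    map_mul_of_mem_supported (s := {0}) (fun l hl p => by
      rw [Set.mem_singleton_iff.mp hl]
      exact hC p) (pow_mem (X_mem_supported.mpr (Set.mem_singleton _)) j) p
  intro Ψ s
  have := h.hasSum_auxSubst hk (C (rename Fin.succ Ψ)) s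
  simpa only [auxTerm_eq_auxCoeff, Module.End.mul_apply, hpow, LinearMap.comp_apply,
    AlgHom.toLinearMap_apply] using this

/-- A finite sum in disguise: collecting powers of z_0 and replacing each by the same power of z_k.
It evaluates the trace of a product of permutations. -/
theorem hasSum_X_pow_mul_auxCoeff (k : Fin N) (p : MvPolynomial (Fin (N + 1)) ℂ) (s : Fin N →₀ ℕ) :
    HasSum (fun m : ℕ => coeff s (X k ^ m * auxCoeff m p)) (coeff s (auxSubst k p)) := by
  induction p using aux_induction with
  | h j q =>
    rw [auxSubst_monomial]
    have := hasSum_single (f := fun m : ℕ => coeff s (X k ^ m * auxCoeff m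
      (X 0 ^ j * rename Fin.succ q))) j fun m hm => by
        simp [auxCoeff_monomial, hm]
    simpa only [auxCoeff_monomial, if_true] using this
  | hadd p q hp hq =>
    have := hp.add hq
    simpa only [mul_add, map_add, coeff_add] using this

theorem AuxTraceExists.summable {A : Module.End ℂ (MvPolynomial (Fin (N + 1)) ℂ)}
    (h : AuxTraceExists A) (Ψ : MvPolynomial (Fin N) ℂ) (s : Fin N →₀ ℕ) :
    Summable fun m => coeff s (auxTerm A m Ψ) := (h.choose_spec Ψ s).summable

theorem AuxTraceExists.hasAuxTrace {A : Module.End ℂ (MvPolynomial (Fin (N + 1)) ℂ)}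
    (h : AuxTraceExists A) : HasAuxTrace A (auxTrace A) := by
  obtain ⟨B, hB⟩ := h
  rwa [hB.auxTrace_eq]

theorem auxTerm_add (A : Module.End ℂ (MvPolynomial (Fin (N + 1)) ℂ)) (m : ℕ)
    (p q : MvPolynomial (Fin N) ℂ) : auxTerm A m (p + q) = auxTerm A m p + auxTerm A m q := by
  simp only [auxTerm_eq_auxCoeff, map_add, mul_add]

theorem auxTerm_smul (A : Module.End ℂ (MvPolynomial (Fin (N + 1)) ℂ)) (m : ℕ)
    (c : ℂ) (p : MvPolynomial (Fin N) ℂ) : auxTerm A m (c • p) = c • auxTerm A m p := by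
  simp only [auxTerm_eq_auxCoeff, map_smul, mul_smul_comm]

/-- The factor z_0^m raises the degree by m and the extraction of its coefficient lowers it by m. -/
theorem PreservesDegree.isHomogeneous_auxTerm {A : Module.End ℂ (MvPolynomial (Fin (N + 1)) ℂ)}
    (hA : PreservesDegree A) {d : ℕ} {Ψ : MvPolynomial (Fin N) ℂ} (hΨ : Ψ.IsHomogeneous d) (m : ℕ) :
    (auxTerm A m Ψ).IsHomogeneous d := by
  have h := hA (m + d) _ ((isHomogeneous_X_pow (R := ℂ) (0 : Fin (N + 1)) m).mul
    (hΨ.rename_isHomogeneous (f := Fin.succ)))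
  exact h.finSuccEquiv_coeff_isHomogeneous m d rfl

/-- The multi-indices of a given degree. -/
noncomputable def degreeFinset (N d : ℕ) : Finset (Fin N →₀ ℕ) :=
  Finset.finsuppAntidiag Finset.univ d

theorem mem_degreeFinset {d : ℕ} {s : Fin N →₀ ℕ} : s ∈ degreeFinset N d ↔ s.degree = d := by
  rw [degreeFinset, Finset.mem_finsuppAntidiag, Finsupp.degree_eq_sum]
  simp

theorem sum_degreeFinset {d : ℕ} {p : MvPolynomial (Fin N) ℂ} (hp : p.IsHomogeneous d) :
    ∑ t ∈ degreeFinset N d, coeff t p • monomial t (1 : ℂ) = p := by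
  ext s
  simp only [coeff_sum, coeff_smul, coeff_monomial, smul_eq_mul, mul_ite, mul_one, mul_zero,
    Finset.sum_ite_eq', mem_degreeFinset]
  split_ifs with h
  · rfl
  · exact (hp.coeff_eq_zero h).symm

/-- For operators that preserve degrees, the trace exists as soon as the series for monomials
converge. -/
theorem PreservesDegree.auxTraceExists {A : Module.End ℂ (MvPolynomial (Fin (N + 1)) ℂ)}
    (hA : PreservesDegree A)
    (h : ∀ q s : Fin N →₀ ℕ, Summable fun m => coeff s (auxTerm A m (monomial q 1))) :
    AuxTraceExists A := by
  -- By homogeneity only the finitely many monomials of the degree of q occur, so the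
  -- coefficientwise sums form a polynomial.
  refine ⟨(basisMonomials (Fin N) ℂ).constr ℂ fun q => ∑ t ∈ degreeFinset N q.degree,
    (∑' m, coeff t (auxTerm A m (monomial q 1))) • monomial t (1 : ℂ), fun Ψ s => ?_⟩
  induction Ψ using MvPolynomial.induction_on' with
  | monomial q c =>
    have e : (monomial q c : MvPolynomial (Fin N) ℂ) = c • monomial q 1 := by simp [smul_monomial]
    have hb := (basisMonomials (Fin N) ℂ).constr_basis ℂ (fun q => ∑ t ∈ degreeFinset N q.degree,
      (∑' m, coeff t (auxTerm A m (monomial q 1))) • monomial t (1 : ℂ)) q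
    rw [coe_basisMonomials] at hb
    rw [e, map_smul, hb]
    simp only [auxTerm_smul, coeff_smul]
    refine HasSum.const_smul c ?_
    have : coeff s (∑ t ∈ degreeFinset N q.degree,
        (∑' m, coeff t (auxTerm A m (monomial q 1))) • monomial t (1 : ℂ)) =
        ∑' m, coeff s (auxTerm A m (monomial q 1)) := by
      simp only [coeff_sum, coeff_smul, coeff_monomial, smul_eq_mul, mul_ite, mul_one, mul_zero,
        Finset.sum_ite_eq', mem_degreeFinset]
      split_ifs with hs
      · rfl
      · symm
        rw [← tsum_zero]
        refine tsum_congr fun m => ?_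
        exact (hA.isHomogeneous_auxTerm (isHomogeneous_monomial (1 : ℂ) rfl) m).coeff_eq_zero hs
    rw [this]
    exact (h q s).hasSum
  | add p q hp hq =>
    simp only [auxTerm_add, map_add, coeff_add]
    exact hp.add hq

end AuxiliarySpace

/-! ### Matrix elements of the monodromy of Q₊ -/

section PlusChain

variable {N : ℕ}

/-- The matrix elements of `Γ(b)/Γ(a) · Γ(z_{ij} ∂_i + a)/Γ(z_{ij} ∂_i + b)`: the coefficient of
`z_i^p z_j^q` in the image of `z_i^{p + q}`. -/
noncomputable def gammaRatioCoeff (a b : ℂ) (p q : ℕ) : ℂ :=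
  negBinom a p * negBinom (b - a) q / negBinom b (p + q)

theorem gammaRatio_X_pow {σ : Type} [DecidableEq σ] {i j : σ} (hij : i ≠ j) (a : ℂ) {b : ℂ}
    (hb : NotGammaPole b) (n : ℕ) :
    gammaRatio i j a b (X i ^ n) = ∑ x ∈ Finset.HasAntidiagonal.antidiagonal n,
      gammaRatioCoeff a b x.1 x.2 • (X i ^ x.1 * X j ^ x.2) := by
  have h := congrArg (PowerSeries.coeff n) (coeffMap_gammaRatio_zero hij a hb (FreeOf.one i))
  rw [mul_one, mul_one, coeff_coeffMap, coeff_negBinomSeries, map_smul, PowerSeries.coeff_mul] at h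
  apply smul_right_injective _ (hb.negBinom_ne_zero n)
  simp only [h, Finset.smul_sum]
  refine Finset.sum_congr rfl fun x hx => ?_
  rw [Finset.HasAntidiagonal.mem_antidiagonal] at hx
  rw [coeff_negBinomSeries, coeff_negBinomSeries, smul_mul_smul_comm, smul_smul, gammaRatioCoeff,
    hx, mul_div_cancel₀ _ (hb.negBinom_ne_zero n)]

/-- The operator `P_{k0} Γ(b)/Γ(a) · Γ(z_{0k} ∂_0 + a)/Γ(z_{0k} ∂_0 + b)`. -/
noncomputable def plusSite (a b : Fin N → ℂ) (k : Fin N) :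
    Module.End ℂ (MvPolynomial (Fin (N + 1)) ℂ) :=
  permOp k.succ 0 * gammaRatio 0 k.succ (a k) (b k)

theorem plusSite_monomial {a b : Fin N → ℂ} {k : Fin N} (hb : NotGammaPole (b k)) (n : ℕ)
    (t : Fin N →₀ ℕ) :
    plusSite a b k (monomial (t.cons n) 1) = ∑ x ∈ Finset.HasAntidiagonal.antidiagonal n,
      gammaRatioCoeff (a k) (b k) x.1 x.2 •
        monomial (Finsupp.cons (x.2 + t k) (t.update k x.1)) (1 : ℂ) := by
  have hfree : (rename Fin.succ (monomial t (1 : ℂ)) : MvPolynomial (Fin (N + 1)) ℂ) ∈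
      supported ℂ ({0}ᶜ : Set (Fin (N + 1))) := by
    rw [rename_monomial, monomial_eq, C_1, one_mul, Finsupp.prod]
    refine prod_mem fun j hj => pow_mem (X_mem_supported_compl ?_) _
    rintro rfl
    rw [Finsupp.mem_support_iff] at hj
    exact hj (Finsupp.mapDomain_of_notMem_range _ _ (by simp))
  have hsplit : ∀ j : ℕ, (monomial (t.update k j) (1 : ℂ) : MvPolynomial (Fin N) ℂ) =
      X k ^ j * monomial (t.erase k) 1 := fun j => by
    rw [Finsupp.update_eq_erase_add_single, add_comm, ← one_mul (1 : ℂ), ← monomial_mul,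
      X_pow_eq_monomial, one_mul]
  have hperm : rename (Equiv.swap k.succ 0) (rename Fin.succ (monomial (t.erase k) (1 : ℂ))) =
      (rename Fin.succ (monomial (t.erase k) (1 : ℂ)) : MvPolynomial (Fin (N + 1)) ℂ) := by
    have hmap : Finsupp.mapDomain (Equiv.swap k.succ 0 ∘ Fin.succ) (t.erase k) =
        Finsupp.mapDomain Fin.succ (t.erase k) := by
      refine Finsupp.mapDomain_congr fun j hj => ?_
      have hjk : j ≠ k := by
        rintro rfl
        simp at hj
      exact Equiv.swap_apply_of_ne_of_ne (fun h => hjk (Fin.succ_injective _ h))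
        (Fin.succ_ne_zero j)
    rw [rename_rename, rename_monomial, rename_monomial, hmap]
  rw [monomial_cons, plusSite, Module.End.mul_apply, mul_comm, gammaRatio, eulerFun_mul _ _ hfree,
    ← gammaRatio, gammaRatio_X_pow (Fin.succ_ne_zero k).symm _ hb, Finset.mul_sum, map_sum]
  refine Finset.sum_congr rfl fun x _ => ?_
  have ht : t = t.update k (t k) := by simp
  rw [mul_smul_comm, map_smul, monomial_cons, hsplit]
  congr 1
  conv_lhs => rw [ht, hsplit]
  simp only [permOp_apply, map_mul, map_pow, rename_X, hperm, Equiv.swap_apply_left,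
    Equiv.swap_apply_right]
  ring

/-- The polynomials in which all monomials have degree `j` in `z_k`. -/
def fixedDegree (k : Fin N) (j : ℕ) : Submodule ℂ (MvPolynomial (Fin (N + 1)) ℂ) where
  carrier := {p | ∀ d, d k.succ ≠ j → coeff d p = 0}
  add_mem' hp hq d hd := by rw [coeff_add, hp d hd, hq d hd, add_zero]
  zero_mem' d _ := coeff_zero d
  smul_mem' c p hp d hd := by rw [coeff_smul, hp d hd, smul_zero]

theorem monomial_mem_fixedDegree (n : ℕ) {t : Fin N →₀ ℕ} {k : Fin N} {j : ℕ} (h : t k = j) :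
    monomial (t.cons n) (1 : ℂ) ∈ fixedDegree k j := fun d hd => by
  rw [coeff_monomial, if_neg]
  rintro rfl
  rw [Finsupp.cons_succ] at hd
  exact hd h

theorem sum_of_mem_fixedDegree {p : MvPolynomial (Fin (N + 1)) ℂ} :
    p = ∑ d ∈ p.support, coeff d p • monomial (Finsupp.cons (d 0) d.tail) 1 := by
  conv_lhs => rw [p.as_sum]
  refine Finset.sum_congr rfl fun d _ => ?_
  rw [Finsupp.cons_tail, smul_monomial, smul_eq_mul, mul_one]

theorem plusSite_mem_fixedDegree {a b : Fin N → ℂ} {k k' : Fin N} (hb : NotGammaPole (b k'))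
    (hk : k ≠ k') {j : ℕ} {p : MvPolynomial (Fin (N + 1)) ℂ} (hp : p ∈ fixedDegree k j) :
    plusSite a b k' p ∈ fixedDegree k j := by
  rw [sum_of_mem_fixedDegree (p := p), map_sum]
  refine sum_mem fun d hd => ?_
  rw [map_smul, plusSite_monomial hb]
  refine Submodule.smul_mem _ _ (sum_mem fun x _ => Submodule.smul_mem _ _
    (monomial_mem_fixedDegree _ ?_))
  rw [Finsupp.coe_update, Function.update_of_ne hk, Finsupp.tail_apply]
  by_contra h
  exact mem_support_iff.mp hd (hp d h)

/-- If the degree j in z_k is fixed on the input, the output monomial determines the input: the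
exponent of z_k comes from z_0, and r - j counts the powers moved from z_0 to z_k before the swap.
Hence matrix elements of a product are single products, without sums. -/
theorem coeff_plusSite {a b : Fin N → ℂ} {k : Fin N} (hb : NotGammaPole (b k)) {j : ℕ}
    {p : MvPolynomial (Fin (N + 1)) ℂ} (hp : p ∈ fixedDegree k j) {r : ℕ} (hr : j ≤ r)
    (s : Fin N →₀ ℕ) :
    coeff (s.cons r) (plusSite a b k p) = gammaRatioCoeff (a k) (b k) (s k) (r - j) *
      coeff (Finsupp.cons (r - j + s k) (s.update k j)) p := by
  set u : Fin (N + 1) →₀ ℕ := Finsupp.cons (r - j + s k) (s.update k j) with hu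
  have key : ∀ d : Fin (N + 1) →₀ ℕ, d k.succ = j → coeff (s.cons r)
      (plusSite a b k (monomial (Finsupp.cons (d 0) d.tail) 1)) =
      if d = u then gammaRatioCoeff (a k) (b k) (s k) (r - j) else 0 := by
    intro d hd
    have hdk : d.tail k = j := by rw [Finsupp.tail_apply, hd]
    rw [plusSite_monomial hb, coeff_sum]
    simp only [coeff_smul, coeff_monomial, smul_eq_mul, mul_ite, mul_one, mul_zero]
    split_ifs with h
    · rw [Finset.sum_eq_single (s k, r - j)]
      · rw [if_pos]
        rw [hdk, Nat.sub_add_cancel hr, h, hu, Finsupp.tail_cons]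
        congr 1
        ext i
        by_cases hi : i = k
        · subst hi
          simp
        · simp
      · rintro ⟨x, y⟩ hxy hne
        rw [if_neg]
        intro hcons
        have h0 : y + d.tail k = r := by
          have := DFunLike.congr_fun hcons 0
          rwa [Finsupp.cons_zero, Finsupp.cons_zero] at this
        have h1 : x = s k := by
          have := DFunLike.congr_fun hcons k.succ
          rw [Finsupp.cons_succ, Finsupp.cons_succ] at this
          simpa using this
        exact hne (Prod.ext h1 (by simp; omega))
      · intro hmem
        rw [Finset.HasAntidiagonal.mem_antidiagonal, h, hu, Finsupp.cons_zero] at hmem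
        exact absurd (add_comm _ _) hmem
    · refine Finset.sum_eq_zero ?_
      rintro ⟨x, y⟩ hxy
      rw [Finset.HasAntidiagonal.mem_antidiagonal] at hxy
      rw [if_neg]
      intro hcons
      apply h
      have h0 : y + d.tail k = r := by
        have := DFunLike.congr_fun hcons 0
        rwa [Finsupp.cons_zero, Finsupp.cons_zero] at this
      have h1 : d.tail.update k x = s := by
        have := congrArg Finsupp.tail hcons
        rwa [Finsupp.tail_cons, Finsupp.tail_cons] at this
      have hx : s k = x := by rw [← h1]; simp
      rw [hu, ← Finsupp.cons_tail d, ← h1]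
      congr 1
      · simp at hxy ⊢
        omega
      · ext i
        by_cases hi : i = k
        · subst hi
          simp [hdk]
        · simp [hi]
  conv_lhs => rw [sum_of_mem_fixedDegree (p := p), map_sum, coeff_sum]
  have hterm : ∀ d ∈ p.support, coeff (s.cons r) (plusSite a b k
      (coeff d p • monomial (Finsupp.cons (d 0) d.tail) 1)) =
      if d = u then gammaRatioCoeff (a k) (b k) (s k) (r - j) * coeff u p else 0 := by
    intro d hd
    have hdj : d k.succ = j := by
      by_contra h
      exact mem_support_iff.mp hd (hp d h)
    rw [map_smul, coeff_smul, key d hdj, smul_eq_mul]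
    split_ifs with h
    · rw [h, mul_comm]
    · rw [mul_zero]
  rw [Finset.sum_congr rfl hterm, Finset.sum_ite_eq']
  split_ifs with h
  · rfl
  · rw [notMem_support_iff.mp h, mul_zero]

theorem list_prod_plusSite_mem_fixedDegree {a b : Fin N → ℂ} (hb : ∀ k, NotGammaPole (b k))
    {k : Fin N} {l : List (Fin N)} (hk : k ∉ l) {j : ℕ} {p : MvPolynomial (Fin (N + 1)) ℂ}
    (hp : p ∈ fixedDegree k j) : (l.map (plusSite a b)).prod p ∈ fixedDegree k j := by
  induction l with
  | nil => exact hp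
  | cons i l ih =>
    rw [List.mem_cons, not_or] at hk
    rw [List.map_cons, List.prod_cons, Module.End.mul_apply]
    exact plusSite_mem_fixedDegree (hb i) hk.1 (ih hk.2)

theorem coeff_list_prod_plusSite_zero {a b : Fin N → ℂ} (hb : ∀ k, NotGammaPole (b k))
    (l : List (Fin N)) (hl : l.Nodup) (m : ℕ) :
    coeff (Finsupp.cons m 0) ((l.map (plusSite a b)).prod (monomial (Finsupp.cons m 0) 1)) =
      (l.map fun k => gammaRatioCoeff (a k) (b k) 0 m).prod := by
  induction l with
  | nil => simp
  | cons k l ih =>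
    rw [List.nodup_cons] at hl
    have h0 : (0 : Fin N →₀ ℕ).update k 0 = 0 := by
      ext i
      simp
    rw [List.map_cons, List.prod_cons, Module.End.mul_apply, coeff_plusSite (hb k)
      (list_prod_plusSite_mem_fixedDegree hb hl.1 (monomial_mem_fixedDegree m rfl)) (Nat.zero_le m),
      List.map_cons, List.prod_cons, ← ih hl.2]
    simp [h0]

-- Each site contributes one factor, by `coeff_plusSite`. The integer e records the bounded
-- difference between the current degree in z_0 and m; it varies along the chain, so the bounds g
-- are required for all shifts.
open Asymptotics Filter in
theorem coeff_list_prod_plusSite_isBigO {a b : Fin N → ℂ} (hb : ∀ k, NotGammaPole (b k))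
    {g : Fin N → ℕ → ℝ} (hg : ∀ k i (e : ℤ),
      (fun m : ℕ => gammaRatioCoeff (a k) (b k) i (m + e).toNat) =O[atTop] g k)
    (l : List (Fin N)) (hl : l.Nodup) (q s : Fin N →₀ ℕ) (e : ℤ) :
    (fun m : ℕ => coeff (s.cons (m + e).toNat)
      ((l.map (plusSite a b)).prod (monomial (q.cons m) 1))) =O[atTop]
      fun m => (l.map fun k => g k m).prod := by
  induction l generalizing s e with
  | nil =>
    refine IsBigO.of_bound 1 (Eventually.of_forall fun m => ?_)
    simp only [List.map_nil, List.prod_nil, Module.End.one_apply, coeff_monomial]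
    split_ifs <;> simp
  | cons k l ih =>
    rw [List.nodup_cons] at hl
    have h1 := (hg k (s k) (e - q k)).mul (ih hl.2 (s.update k (q k)) (e - q k + s k))
    simp only [List.map_cons, List.prod_cons]
    refine h1.congr' ?_ EventuallyEq.rfl
    -- For such m no truncation occurs in `toNat`, and the degree condition of `coeff_plusSite`
    -- holds.
    filter_upwards [eventually_ge_atTop ((q k - e).toNat)] with m hm
    have hr : q k ≤ (m + e).toNat := by omega
    have e1 : (m + (e - q k)).toNat = (m + e).toNat - q k := by omega
    have e2 : (m + (e - q k + s k)).toNat = (m + e).toNat - q k + s k := by omega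
    rw [Module.End.mul_apply, coeff_plusSite (hb k)
      (list_prod_plusSite_mem_fixedDegree hb hl.1 (monomial_mem_fixedDegree m rfl)) hr, e1, e2]

end PlusChain

/-! ### Growth of the matrix elements -/

section Asymptotics

open Asymptotics Filter

theorem isTheta_shift_rpow (e : ℤ) (x : ℝ) :
    (fun m : ℕ => (((m + e).toNat : ℕ) : ℝ) ^ x) =Θ[atTop] fun m : ℕ => (m : ℝ) ^ x := by
  have h : (fun m : ℕ => (((m + e).toNat : ℕ) : ℝ)) ~[atTop] fun m : ℕ => (m : ℝ) := by
    have h1 : (fun m : ℕ => ((m : ℝ) + (e : ℝ))) ~[atTop] fun m : ℕ => (m : ℝ) := by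
      refine IsEquivalent.add_isLittleO IsEquivalent.refl ?_
      exact isLittleO_const_left.mpr (Or.inr
        (tendsto_norm_atTop_atTop.comp tendsto_natCast_atTop_atTop))
    refine h1.congr_left ?_
    filter_upwards [eventually_ge_atTop (-e).toNat] with m hm
    have : ((m + e).toNat : ℤ) = m + e := Int.toNat_of_nonneg (by omega)
    exact_mod_cast congrArg (Int.cast : ℤ → ℝ) this.symm
  exact (h.rpow (fun m => Nat.cast_nonneg m)).isTheta

theorem tendsto_shift_atTop (e : ℤ) : Tendsto (fun m : ℕ => (m + e).toNat) atTop atTop := by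
  refine tendsto_atTop.mpr fun b => ?_
  filter_upwards [eventually_ge_atTop ((b : ℤ) - e).toNat] with m hm
  omega

/-- This ties the binomial coefficients to the Gauss product for Γ(s), whose convergence gives their
exact growth. -/
theorem negBinom_succ_mul_gammaSeq {s : ℂ} (hs : NotGammaPole s) (n : ℕ) :
    negBinom s (n + 1) * (((n + 1 : ℕ) : ℂ) * Complex.GammaSeq s n) = (n : ℂ) ^ s := by
  have hprod : ∀ n : ℕ, ∏ j ∈ Finset.range (n + 1), (s + j) =
      (ascPochhammer ℂ (n + 1)).eval s := by
    intro n
    induction n with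
    | zero => simp
    | succ n ih => rw [Finset.prod_range_succ, ih, ascPochhammer_succ_eval (n + 1)]
  have h1 := hs.ascPochhammer_ne_zero (n + 1)
  have h2 : ((n + 1 : ℕ) : ℂ) ≠ 0 := Nat.cast_ne_zero.mpr n.succ_ne_zero
  have h3 : ((n.factorial : ℕ) : ℂ) ≠ 0 := Nat.cast_ne_zero.mpr n.factorial_ne_zero
  rw [Complex.GammaSeq, hprod, negBinom, Nat.factorial_succ, Nat.cast_mul]
  field_simp

theorem negBinom_isTheta {s : ℂ} (hs : NotGammaPole s) :
    (negBinom s) =Θ[atTop] fun n : ℕ => (n : ℝ) ^ (s.re - 1) := by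
  have hG : (fun n => Complex.GammaSeq s n) =Θ[atTop] fun _ => (1 : ℝ) := by
    refine isTheta_of_div_tendsto_nhds_ne_zero (c := (Complex.Gamma s)⁻¹)
      (g := fun _ : ℕ => (1 : ℂ)) ?_ (inv_ne_zero (Complex.Gamma_ne_zero hs)) |>.trans ?_
    · simpa using (Complex.GammaSeq_tendsto_Gamma s).inv₀ (Complex.Gamma_ne_zero hs)
    · exact (isTheta_const_const one_ne_zero one_ne_zero)
  have hpow : (fun n : ℕ => (n : ℂ) ^ s) =Θ[atTop] fun n : ℕ => (n : ℝ) ^ s.re := by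
    refine IsTheta.of_norm_eventuallyEq_norm ?_
    filter_upwards [eventually_gt_atTop 0] with n hn
    rw [Complex.norm_natCast_cpow_of_pos hn, Real.norm_of_nonneg (by positivity)]
  have hn : (fun n : ℕ => ((n + 1 : ℕ) : ℂ)) =Θ[atTop] fun n : ℕ => (n : ℝ) ^ (1 : ℝ) := by
    refine IsTheta.trans ?_ (isTheta_shift_rpow 1 1)
    refine IsTheta.of_norm_eventuallyEq_norm (Eventually.of_forall fun n => ?_)
    have : ((n : ℤ) + 1).toNat = n + 1 := by omega
    simp only [this, Real.rpow_one, Complex.norm_natCast, Real.norm_natCast]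
  have hF : (fun n : ℕ => negBinom s (n + 1)) =Θ[atTop] fun n : ℕ => (n : ℝ) ^ (s.re - 1) := by
    have h := hpow.div (hn.mul hG)
    refine EventuallyEq.trans_isTheta ?_ (h.trans_eventuallyEq ?_)
    · filter_upwards [hG.eq_zero_iff] with n h0
      have h1 : Complex.GammaSeq s n ≠ 0 := fun h => one_ne_zero (h0.mp h)
      have h2 : ((n + 1 : ℕ) : ℂ) ≠ 0 := Nat.cast_ne_zero.mpr n.succ_ne_zero
      rw [← negBinom_succ_mul_gammaSeq hs, mul_div_assoc, div_self (mul_ne_zero h2 h1), mul_one]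
    · filter_upwards [eventually_gt_atTop 0] with n hn
      rw [mul_one, Real.rpow_sub (Nat.cast_pos.mpr hn)]
  have hc : ((fun n : ℕ => negBinom s (n + 1)) ∘ fun m : ℕ => ((m : ℤ) + (-1)).toNat) =Θ[atTop]
      ((fun n : ℕ => (n : ℝ) ^ (s.re - 1)) ∘ fun m : ℕ => ((m : ℤ) + (-1)).toNat) :=
    ⟨hF.1.comp_tendsto (tendsto_shift_atTop (-1)), hF.2.comp_tendsto (tendsto_shift_atTop (-1))⟩
  refine IsTheta.trans ?_ (hc.trans (isTheta_shift_rpow (-1) _))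
  refine (EventuallyEq.isTheta ?_)
  filter_upwards [eventually_gt_atTop 0] with n hn
  have : ((n : ℤ) + (-1)).toNat + 1 = n := by omega
  simp only [Function.comp, this]

theorem negBinom_eventually_eq_zero {s : ℂ} (hs : ¬ NotGammaPole s) :
    ∀ᶠ n in atTop, negBinom s n = 0 := by
  unfold NotGammaPole at hs
  push Not at hs
  obtain ⟨k, rfl⟩ := hs
  filter_upwards [eventually_gt_atTop k] with n hn
  rw [negBinom, ascPochhammer_eval_neg_coe_nat_of_lt hn, zero_div]

theorem negBinom_add_isTheta {b : ℂ} (hb : NotGammaPole b) (i : ℕ) :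
    (fun r => negBinom b (i + r)) =Θ[atTop] fun r : ℕ => (r : ℝ) ^ (b.re - 1) := by
  have h := negBinom_isTheta hb
  have hc : (negBinom b ∘ fun r : ℕ => ((r : ℤ) + i).toNat) =Θ[atTop]
      ((fun n : ℕ => (n : ℝ) ^ (b.re - 1)) ∘ fun r : ℕ => ((r : ℤ) + i).toNat) :=
    ⟨h.1.comp_tendsto (tendsto_shift_atTop i), h.2.comp_tendsto (tendsto_shift_atTop i)⟩
  refine IsTheta.trans ?_ (hc.trans (isTheta_shift_rpow i _))
  refine EventuallyEq.isTheta (Eventually.of_forall fun r => ?_)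
  have : ((r : ℤ) + i).toNat = i + r := by omega
  simp only [Function.comp, this]

theorem rpow_div_eventuallyEq (a b : ℂ) :
    (fun r : ℕ => (r : ℝ) ^ ((b - a).re - 1) / (r : ℝ) ^ (b.re - 1)) =ᶠ[atTop]
      fun r => (r : ℝ) ^ (-a.re) := by
  filter_upwards [eventually_gt_atTop 0] with r hr
  rw [← Real.rpow_sub (Nat.cast_pos.mpr hr), Complex.sub_re]
  congr 1
  ring

/-- A bound for the matrix elements of `Γ(b)/Γ(a) · Γ(z_{ij} ∂_i + a)/Γ(z_{ij} ∂_i + b)`. -/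
theorem gammaRatioCoeff_isBigO {a b : ℂ} (hb : NotGammaPole b) (hab : NotGammaPole (b - a)) (i : ℕ)
    (e : ℤ) : (fun m : ℕ => gammaRatioCoeff a b i (m + e).toNat) =O[atTop]
      fun m : ℕ => (m : ℝ) ^ (-a.re) := by
  have h := ((negBinom_isTheta hab).div (negBinom_add_isTheta hb i)).1.congr' EventuallyEq.rfl
    (rpow_div_eventuallyEq a b)
  have h2 : (fun r => gammaRatioCoeff a b i r) =O[atTop] fun r : ℕ => (r : ℝ) ^ (-a.re) := by
    simpa only [gammaRatioCoeff, mul_div_assoc] using h.const_mul_left (negBinom a i)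
  exact (h2.comp_tendsto (tendsto_shift_atTop e)).trans (isTheta_shift_rpow e _).1

/-- For i = 0 the prefactor (a)_i/i! is 1, so the bound is two-sided; for i > 0 it may vanish. This
is why divergence is tested on constants. -/
theorem gammaRatioCoeff_zero_isTheta {a b : ℂ} (hb : NotGammaPole b) (hab : NotGammaPole (b - a)) :
    (fun m : ℕ => gammaRatioCoeff a b 0 m) =Θ[atTop] fun m : ℕ => (m : ℝ) ^ (-a.re) := by
  have h := ((negBinom_isTheta hab).div (negBinom_add_isTheta hb 0)).trans_eventuallyEq
    (rpow_div_eventuallyEq a b)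
  simpa only [gammaRatioCoeff, negBinom_zero, one_mul] using h

theorem gammaRatioCoeff_eventually_eq_zero (a : ℂ) {b : ℂ} (hab : ¬ NotGammaPole (b - a)) (i : ℕ)
    (e : ℤ) : ∀ᶠ m : ℕ in atTop, gammaRatioCoeff a b i (m + e).toNat = 0 := by
  filter_upwards [(tendsto_shift_atTop e).eventually (negBinom_eventually_eq_zero hab)] with m hm
  rw [gammaRatioCoeff, hm, mul_zero, zero_div]

end Asymptotics

/-! ### Existence of the trace of the R⁺ monodromy -/

section PlusTrace

open Asymptotics Filter

variable {N : ℕ}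

theorem prod_finRange_rpow (a : Fin N → ℂ) :
    (fun m : ℕ => ((List.finRange N).map fun k => (m : ℝ) ^ (-(a k).re)).prod) =ᶠ[atTop]
      fun m : ℕ => (m : ℝ) ^ (-(∑ k, a k).re) := by
  filter_upwards [eventually_gt_atTop 0] with m hm
  rw [← Fin.prod_univ_def, ← Real.rpow_sum_of_pos (Nat.cast_pos.mpr hm), Finset.sum_neg_distrib,
    Complex.re_sum]

theorem coeff_auxTerm_plusSite_zero {a b : Fin N → ℂ} (hb : ∀ k, NotGammaPole (b k)) (m : ℕ) :
    coeff 0 (auxTerm ((List.finRange N).map (plusSite a b)).prod m 1) =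
      ((List.finRange N).map fun k => gammaRatioCoeff (a k) (b k) 0 m).prod := by
  rw [← coeff_list_prod_plusSite_zero hb _ (List.nodup_finRange N), auxTerm_eq_auxCoeff,
    coeff_auxCoeff, monomial_cons]
  rfl

/-- The trace of `∏_k P_{k0} Γ(z_{0k} ∂_0 + a_k)/Γ(z_{0k} ∂_0 + b_k)` exists as soon as this is the
case on the constants, and a condition for this. -/
theorem auxTraceExists_plusSite_tfae {a b : Fin N → ℂ} (hb : ∀ k, NotGammaPole (b k)) :
    List.TFAE [AuxTraceExists ((List.finRange N).map (plusSite a b)).prod,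
      Summable fun m => coeff 0 (auxTerm ((List.finRange N).map (plusSite a b)).prod m 1),
      (∃ k, ¬ NotGammaPole (b k - a k)) ∨ 1 < (∑ k, a k).re] := by
  tfae_have 1 → 2 := fun h => h.summable 1 0
  tfae_have 2 → 3 := by
    intro h
    -- Otherwise the terms on constants have the exact order m^{-Re ∑ a_k} with exponent at least
    -- -1, and the series diverges.
    by_contra! hc
    obtain ⟨hab, hre⟩ := hc
    simp only [coeff_auxTerm_plusSite_zero hb] at h
    have hth : (fun m : ℕ => ((List.finRange N).map fun k => gammaRatioCoeff (a k) (b k) 0 m).prod)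
        =Θ[atTop] fun m : ℕ => ((List.finRange N).map fun k => (m : ℝ) ^ (-(a k).re)).prod :=
      IsTheta.listProd fun k _ => gammaRatioCoeff_zero_isTheta (hb k) (hab k)
    rw [(hth.trans_eventuallyEq (prod_finRange_rpow a)).summable_iff_nat,
      Real.summable_nat_rpow] at h
    linarith
  tfae_have 3 → 1 := by
    intro hc
    refine PreservesDegree.auxTraceExists (PreservesDegree.list_prod _ ?_) fun q s => ?_
    · intro T hT
      obtain ⟨k, -, rfl⟩ := List.mem_map.mp hT
      exact (preservesDegree_permOp _ _).mul (preservesDegree_gammaRatio _ _ _ _)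
    · classical
      -- If b_k - a_k is a pole, the matrix elements of the site k vanish for large m, so 0 is an
      -- admissible bound and the series is finite.
      have hO := coeff_list_prod_plusSite_isBigO hb
        (g := fun k m => if NotGammaPole (b k - a k) then (m : ℝ) ^ (-(a k).re) else 0) (by
          intro k i e
          by_cases h : NotGammaPole (b k - a k)
          · simpa only [if_pos h] using gammaRatioCoeff_isBigO (hb k) h i e
          · simp only [if_neg h]
            exact (EventuallyEq.isBigO (gammaRatioCoeff_eventually_eq_zero (a k) h i e)).trans
              (isBigO_zero _ _)) (List.finRange N) (List.nodup_finRange N) q s 0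
      have hO' : (fun m => coeff s (auxTerm ((List.finRange N).map (plusSite a b)).prod m
          (monomial q 1))) =O[atTop] fun m : ℕ => ((List.finRange N).map fun k =>
            if NotGammaPole (b k - a k) then (m : ℝ) ^ (-(a k).re) else 0).prod := by
        refine hO.congr_left fun m => ?_
        rw [auxTerm_eq_auxCoeff, coeff_auxCoeff, monomial_cons, add_zero, Int.toNat_natCast]
      by_cases hp : ∃ k, ¬ NotGammaPole (b k - a k)
      · obtain ⟨k, hk⟩ := hp
        refine summable_of_isBigO_nat summable_zero (hO'.congr_right fun m => ?_)
        refine List.prod_eq_zero (List.mem_map.mpr ⟨k, List.mem_finRange k, if_neg hk⟩)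
      · have hre := hc.resolve_left hp
        push Not at hp
        simp only [hp, if_true] at hO'
        refine summable_of_isBigO_nat (Real.summable_nat_rpow.mpr ?_)
          (hO'.congr' EventuallyEq.rfl (prod_finRange_rpow a))
        linarith
  tfae_finish

end PlusTrace

/-! ### Moving R⁻ through the monodromy; the trace of the permutations -/

section Monodromy

variable {N : ℕ}

theorem monodromy_eq (T : Fin N → Module.End ℂ (MvPolynomial (Fin (N + 1)) ℂ)) :
    monodromy T = ((List.finRange N).map T).prod := by
  rw [monodromy, List.ofFn_eq_map]

/-- For the first site k: the factors to its right do not touch z_k, and its own permutation,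
applied last, turns z_k into z_0. -/
theorem monodromy_X_mul {T : Fin N → Module.End ℂ (MvPolynomial (Fin (N + 1)) ℂ)} {k : Fin N}
    (hk : (k : ℕ) = 0) (h0 : ∀ p, T k (X k.succ * p) = X 0 * T k p)
    (h : ∀ j, j ≠ k → CommutesWithX (T j) k.succ) (p : MvPolynomial (Fin (N + 1)) ℂ) :
    monodromy T (X k.succ * p) = X 0 * monodromy T p := by
  rcases N with _ | n
  · exact k.elim0
  obtain rfl : k = 0 := Fin.ext hk
  have hC : CommutesWithX (((List.finRange n).map Fin.succ).map T).prod (Fin.succ 0) := by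
    refine CommutesWithX.list_prod _ fun L hL => ?_
    obtain ⟨j, hj, rfl⟩ := List.mem_map.mp hL
    obtain ⟨i, -, rfl⟩ := List.mem_map.mp hj
    exact h _ (Fin.succ_ne_zero i)
  rw [monodromy_eq, List.finRange_succ, List.map_cons, List.prod_cons, Module.End.mul_apply, hC, h0,
    Module.End.mul_apply]

theorem plusSite_X_mul (a b : Fin N → ℂ) (k : Fin N) (p : MvPolynomial (Fin (N + 1)) ℂ) :
    plusSite a b k (X k.succ * p) = X 0 * plusSite a b k p := by
  rw [plusSite, Module.End.mul_apply,
    commutesWithX_gammaRatio (Fin.succ_ne_zero k) k.succ (a k) (b k) p, permOp_X_left_mul,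
    Module.End.mul_apply]

theorem commutesWithX_plusSite (a b : Fin N → ℂ) {j k : Fin N} (h : j ≠ k) :
    CommutesWithX (plusSite a b j) k.succ :=
  (commutesWithX_permOp ((Fin.succ_injective N).ne h.symm) (Fin.succ_ne_zero k)).mul
    (commutesWithX_gammaRatio (Fin.succ_ne_zero k) _ _ _)

/-- Moving the factors `Γ(z_{k0} ∂_k + a'_k)/Γ(z_{k0} ∂_k + b'_k)` of a monodromy to the right. -/
theorem monodromy_plusSite_mul (a b a' b' : Fin N → ℂ) :
    monodromy (fun k => plusSite a b k * gammaRatio k.succ 0 (a' k) (b' k)) =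
      monodromy (plusSite a b) * gammaChain Fin.succ 0 a' b' (List.finRange N) := by
  rw [monodromy_eq, monodromy_eq]
  refine prod_map_mul_gammaRatio (Fin.succ_injective N) (fun k => (Fin.succ_ne_zero k).symm) a' b'
    (fun k i c d hik hi0 => ?_) (fun k i j c d hik hi0 hjk hj0 hij => ?_) _ (List.nodup_finRange N)
  -- P_{k0} replaces the reference point z_0 by z_k, and the R⁺ factor, also referred to z_k,
  -- commutes with the result.
  · have h := permOp_mul_gammaRatio k.succ 0 i k.succ c d
    rw [Equiv.swap_apply_left, Equiv.swap_apply_of_ne_of_ne hik hi0] at h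
    rw [plusSite, ← mul_assoc, ← h, mul_assoc, mul_assoc, (gammaRatio_commute hik
      (Fin.succ_ne_zero k).symm hi0 hik (Fin.succ_ne_zero k).symm c d (a k) (b k)).eq]
  · exact (permOp_commute_gammaRatio hik.symm hjk.symm hi0.symm hj0.symm c d).symm.mul_right
      (gammaRatio_commute hij (Fin.succ_ne_zero k).symm hi0 hik hj0.symm c d _ _)

theorem monodromy_permOp_mul (a' b' : Fin N → ℂ) :
    monodromy (fun k => permOp k.succ 0 * gammaRatio k.succ 0 (a' k) (b' k)) =
      monodromy (fun k => permOp k.succ 0) * gammaChain Fin.succ 0 a' b' (List.finRange N) := by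
  rw [monodromy_eq, monodromy_eq]
  refine prod_map_mul_gammaRatio (Fin.succ_injective N) (fun k => (Fin.succ_ne_zero k).symm) a' b'
    (fun k i c d hik hi0 => ?_) (fun k i j c d hik hi0 hjk hj0 hij => ?_) _ (List.nodup_finRange N)
  · have h := permOp_mul_gammaRatio k.succ 0 i k.succ c d
    rwa [Equiv.swap_apply_left, Equiv.swap_apply_of_ne_of_ne hik hi0, eq_comm] at h
  · exact (permOp_commute_gammaRatio hik.symm hjk.symm hi0.symm hj0.symm c d).symm

theorem monodromy_permOp_apply (p : MvPolynomial (Fin (N + 1)) ℂ) :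
    monodromy (fun k : Fin N => permOp k.succ 0) p = rename (finRotate (N + 1)).symm p := by
  rw [monodromy_eq, list_prod_permOp]
  congr 2
  have hlist : (List.finRange N).map (fun k => Equiv.swap k.succ 0) = (List.range N).map
      fun k => Equiv.swap (Fin.ofNat (N + 1) (k + 1)) (Fin.ofNat (N + 1) 0) := by
    rw [← List.map_coe_finRange_eq_range, List.map_map]
    refine List.map_congr_left fun k _ => ?_
    congr 1
    exact Fin.ext (Nat.mod_eq_of_lt (by omega : (k : ℕ) + 1 < N + 1)).symm
  obtain ⟨h0, h1, -⟩ := prod_swap_range (Fin.ofNat (N + 1)) N N le_rfl (by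
    intro i hi j hj h
    have := congrArg Fin.val h
    simpa only [Fin.ofNat, Nat.mod_eq_of_lt (Nat.lt_succ_of_le hi),
      Nat.mod_eq_of_lt (Nat.lt_succ_of_le hj)] using this)
  rw [hlist]
  funext i
  rw [eq_comm, Equiv.symm_apply_eq]
  induction i using Fin.cases with
  | zero =>
    rw [show (0 : Fin (N + 1)) = Fin.ofNat (N + 1) 0 from rfl, h0]
    have : Fin.ofNat (N + 1) N = Fin.last N := Fin.ext (Nat.mod_eq_of_lt N.lt_succ_self)
    rw [this, finRotate_last]
    rfl
  | succ k =>
    have e1 : Fin.ofNat (N + 1) ((k : ℕ) + 1) = k.succ :=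
      Fin.ext (Nat.mod_eq_of_lt (by omega : (k : ℕ) + 1 < N + 1))
    have e2 : Fin.ofNat (N + 1) (k : ℕ) = k.castSucc :=
      Fin.ext (Nat.mod_eq_of_lt (by omega : (k : ℕ) < N + 1))
    have h := h1 k k.isLt
    rw [e1, e2] at h
    rw [h, finRotate_apply, Fin.coeSucc_eq_succ]

/-- The trace of `P_{10} ⋯ P_{N0}`. -/
theorem hasAuxTrace_permOp (hN : 0 < N) : HasAuxTrace (monodromy fun k : Fin N => permOp k.succ 0)
    (rename (finRotate N).symm).toLinearMap := by
  obtain ⟨n, rfl⟩ := Nat.exists_eq_succ_of_ne_zero hN.ne'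
  have hcast : ∀ j : Fin (n + 1), (finRotate (n + 1 + 1)).symm j.succ = j.castSucc := fun j => by
    rw [Equiv.symm_apply_eq, finRotate_apply, Fin.coeSucc_eq_succ]
  have hlast : (finRotate (n + 1 + 1)).symm 0 = (Fin.last n).succ := by
    rw [Equiv.symm_apply_eq, Fin.succ_last, finRotate_last]
  intro Ψ s
  -- The cyclic permutation sends z_0^m Ψ to z_N^m Ψ(z_0, …, z_{N-1}); summing over m the
  -- coefficients of z_0^m puts z_0 = z_N.
  have h := hasSum_X_pow_mul_auxCoeff (Fin.last n) (rename Fin.castSucc Ψ) s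
  have e1 : (fun m : ℕ => coeff s (auxTerm (monodromy fun k : Fin (n + 1) => permOp k.succ 0) m Ψ)) =
      fun m => coeff s (X (Fin.last n) ^ m * auxCoeff m (rename Fin.castSucc Ψ)) := by
    funext m
    have hc : (⇑(finRotate (n + 1 + 1)).symm ∘ Fin.succ) = Fin.castSucc := funext hcast
    rw [auxTerm_eq_auxCoeff, monodromy_permOp_apply, map_mul, map_pow, rename_X, rename_rename,
      hlast, hc, ← auxCoeff_rename_mul, map_pow, rename_X]
  have e2 : auxSubst (Fin.last n) (rename Fin.castSucc Ψ) = rename (finRotate (n + 1)).symm Ψ := by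
    rw [auxSubst, aeval_rename]
    refine DFunLike.congr_fun (algHom_ext fun i => ?_) Ψ
    rw [aeval_X, rename_X, Function.comp_apply]
    induction i using Fin.cases with
    | zero =>
      have : (finRotate (n + 1)).symm 0 = Fin.last n := by
        rw [Equiv.symm_apply_eq, finRotate_last]
      simp [this]
    | succ j =>
      have : (finRotate (n + 1)).symm j.succ = j.castSucc := by
        rw [Equiv.symm_apply_eq, finRotate_apply, Fin.coeSucc_eq_succ]
      simp [this, Fin.castSucc_succ]
  rw [e1]
  rw [e2] at h
  exact h

end Monodromy

/-! ### Factorization and existence of Q -/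

section Factorization

variable {N : ℕ} (ℓ δ : Fin N → ℂ)

/-- The factor of `Q(u₁|u)` due to the operators `R⁻`, with `z_k` substituted for the auxiliary
variable. For the first site `k` it is `P Q₋(u)`. -/
noncomputable def shiftedQminus (k : Fin N) (u : ℂ) : Module.End ℂ (MvPolynomial (Fin N) ℂ) :=
  (auxSubst k).toLinearMap ∘ₗ gammaChain Fin.succ 0 (fun k => u + δ k + ℓ k) (fun k => 2 * ℓ k)
    (List.finRange N) ∘ₗ (rename Fin.succ).toLinearMap

theorem siteRplus_eq_plusSite (u : ℂ) :
    siteRplus ℓ δ u = plusSite (fun k => 2 * ℓ k) (fun k => 1 + ℓ k - (u + δ k)) := rfl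

theorem siteR_eq_plusSite_mul (u1 u2 : ℂ) :
    siteR ℓ δ u1 u2 = fun k => plusSite (fun k => 2 * ℓ k) (fun k => 1 + ℓ k - (u1 + δ k)) k *
      gammaRatio k.succ 0 (u2 + δ k + ℓ k) (2 * ℓ k) := by
  funext k
  rw [siteR, plusSite, show ℓ k + 1 - u1 - δ k = 1 + ℓ k - (u1 + δ k) by ring,
    show ℓ k + u2 + δ k = u2 + δ k + ℓ k by ring]

variable {ℓ δ}

theorem RegularAt.notGammaPole {u : ℂ} (hu : RegularAt ℓ δ u) (k : Fin N) :
    NotGammaPole (1 + ℓ k - (u + δ k)) := by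
  have := hu k
  rwa [show 1 + ℓ k - (u + δ k) = 1 + ℓ k - δ k - u by ring]

theorem HasAuxTrace.monQ {u1 : ℂ} {B : Module.End ℂ (MvPolynomial (Fin N) ℂ)}
    (h : HasAuxTrace (monQplus ℓ δ u1) B) {k : Fin N} (hk : (k : ℕ) = 0) (u2 : ℂ) :
    HasAuxTrace (monQ ℓ δ u1 u2) (B * shiftedQminus ℓ δ k u2) := by
  rw [_root_.monQ, siteR_eq_plusSite_mul, monodromy_plusSite_mul]
  rw [monQplus, siteRplus_eq_plusSite] at h
  exact h.mul_right (monodromy_X_mul hk (plusSite_X_mul _ _ k)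
    fun j hj => commutesWithX_plusSite _ _ hj)
    (commutesWithX_gammaChain (fun k => (Fin.succ_ne_zero k).symm) _ _ _)

theorem hasAuxTrace_monQminus {k : Fin N} (hk : (k : ℕ) = 0) (u : ℂ) :
    HasAuxTrace (monQminus ℓ δ u)
      ((rename (finRotate N).symm).toLinearMap * shiftedQminus ℓ δ k u) := by
  have e : siteRminus ℓ δ u = fun k => permOp k.succ 0 *
    gammaRatio k.succ 0 (u + δ k + ℓ k) (2 * ℓ k) := rfl
  rw [monQminus, e, monodromy_permOp_mul]
  exact (hasAuxTrace_permOp k.pos).mul_right (monodromy_X_mul hk (permOp_X_left_mul _ _)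
    fun j hj => commutesWithX_permOp ((Fin.succ_injective N).ne hj.symm) (Fin.succ_ne_zero k))
    (commutesWithX_gammaChain (fun k => (Fin.succ_ne_zero k).symm) _ _ _)

theorem opQminus_eq {k : Fin N} (hk : (k : ℕ) = 0) (u : ℂ) :
    opQminus ℓ δ u = (rename (finRotate N).symm).toLinearMap * shiftedQminus ℓ δ k u :=
  (hasAuxTrace_monQminus hk u).auxTrace_eq

/-- The trace of the bare permutations in Q₋ is the inverse cyclic shift, which P cancels. -/
theorem cyclicShift_mul_opQminus {k : Fin N} (hk : (k : ℕ) = 0) (u : ℂ) :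
    cyclicShift N * opQminus ℓ δ u = shiftedQminus ℓ δ k u := by
  rw [opQminus_eq hk, ← mul_assoc]
  have : cyclicShift N * (rename (finRotate N).symm).toLinearMap = 1 := by
    refine LinearMap.ext fun p => ?_
    change rename (finRotate N) (rename (finRotate N).symm p) = p
    rw [rename_rename, Equiv.self_comp_symm, rename_id_apply]
  rw [this, one_mul]

theorem opQ_eq (hN : 0 < N) {u1 : ℂ} (h : AuxTraceExists (monQplus ℓ δ u1)) (u2 : ℂ) :
    opQ ℓ δ u1 u2 = opQplus ℓ δ u1 * cyclicShift N * opQminus ℓ δ u2 := by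
  rw [mul_assoc, cyclicShift_mul_opQminus (k := ⟨0, hN⟩) rfl]
  exact (h.hasAuxTrace.monQ rfl u2).auxTrace_eq

theorem auxTraceExists_monQplus {u1 : ℂ} (hu : RegularAt ℓ δ u1) (h : 1 < (∑ k, 2 * ℓ k).re) :
    AuxTraceExists (monQplus ℓ δ u1) := by
  rw [monQplus, siteRplus_eq_plusSite, monodromy_eq]
  exact ((auxTraceExists_plusSite_tfae hu.notGammaPole).out 0 2).mpr (Or.inr h)

/-- One direction is the factorization. Conversely, the chain of R⁻ fixes constants, so the series
of Q and Q₊ on constants coincide, and these decide the existence of Q₊. -/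
theorem auxTraceExists_monQ_iff (hN : 0 < N) {u1 : ℂ} (hu : RegularAt ℓ δ u1) (u2 : ℂ) :
    AuxTraceExists (monQ ℓ δ u1 u2) ↔ AuxTraceExists (monQplus ℓ δ u1) := by
  refine ⟨fun h => ?_, fun h => ⟨_, h.hasAuxTrace.monQ (k := ⟨0, hN⟩) rfl u2⟩⟩
  have hs := h.summable 1 0
  rw [monQplus, siteRplus_eq_plusSite, monodromy_eq]
  refine ((auxTraceExists_plusSite_tfae hu.notGammaPole).out 0 1).mpr ?_
  rw [monQ, siteR_eq_plusSite_mul, monodromy_plusSite_mul, monodromy_eq] at hs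
  refine hs.congr fun m => ?_
  have hC := commutesWithX_gammaChain (s := Fin.succ) (o := (0 : Fin (N + 1)))
    (fun k => (Fin.succ_ne_zero k).symm) (fun k => u2 + δ k + ℓ k) (fun k => 2 * ℓ k)
    (List.finRange N)
  rw [auxTerm_eq_auxCoeff, auxTerm_eq_auxCoeff, Module.End.mul_apply,
    map_mul_of_mem_supported (s := {0}) (fun l hl p => by
      rw [Set.mem_singleton_iff.mp hl]
      exact hC p) (pow_mem (X_mem_supported.mpr (Set.mem_singleton _)) m), map_one,
    gammaChain_one]

theorem contMapAt_shiftedQminus (hℓ : ∀ k, NotGammaPole (2 * ℓ k)) (k : Fin N) (u : ℂ) :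
    ContMapAt u fun t => shiftedQminus ℓ δ k t :=
  (ContMapAt.const u (auxSubst k).toLinearMap).comp
    ((contMapAt_gammaChain Fin.succ 0 (fun k => by fun_prop) hℓ _).comp
      (ContMapAt.const u (rename Fin.succ).toLinearMap))

/-- Q₋ is given by a finite chain whose denominators involve only 2ℓ_k, so no value of u is
exceptional. -/
theorem contMapAt_opQminus (hN : 0 < N) (hℓ : ∀ k, NotGammaPole (2 * ℓ k)) (u : ℂ) :
    ContMapAt u fun t => opQminus ℓ δ t := by
  simp only [opQminus_eq (k := ⟨0, hN⟩) rfl]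
  exact (ContMapAt.const u _).mul (contMapAt_shiftedQminus hℓ _ u)

end Factorization

/-! ### Local exchange relations at one site with two auxiliary variables -/

section SiteOperators

variable {σ : Type} [DecidableEq σ]

/-- The operator `P_{zx} · Γ(z_{xz} ∂_x + a)/Γ(z_{xz} ∂_x + b) · Γ(z_{zx} ∂_z + c)/Γ(z_{zx} ∂_z + d)`
(normalized to be `1` on constants). -/
noncomputable def siteOp (z x : σ) (a b c d : ℂ) : Module.End ℂ (MvPolynomial σ ℂ) :=
  permOp z x * gammaRatio x z a b * gammaRatio z x c d

theorem siteOp_commute {z x w y : σ} (hzx : z ≠ x) (hwy : w ≠ y) (hzw : z ≠ w) (hzy : z ≠ y)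
    (hxw : x ≠ w) (hxy : x ≠ y) (a b c d a' b' c' d' : ℂ) :
    Commute (siteOp z x a b c d) (siteOp w y a' b' c' d') := by
  have h1 := permOp_commute hzw hzy hxw hxy
  have h2 := fun p q => permOp_commute_gammaRatio hzw hzy hxw hxy p q
  have h3 := fun p q => permOp_commute_gammaRatio hzy hzw hxy hxw p q
  have h4 := fun p q => permOp_commute_gammaRatio hzw.symm hxw.symm hzy.symm hxy.symm p q
  have h5 := fun p q => permOp_commute_gammaRatio hxw.symm hzw.symm hxy.symm hzy.symm p q
  have g1 := fun p q r s => gammaRatio_commute hzx hwy hzw hzy hxw.symm p q r s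
  have g2 := fun p q r s => gammaRatio_commute hzx hwy.symm hzy hzw hxy.symm p q r s
  have g3 := fun p q r s => gammaRatio_commute hzx.symm hwy hxw hxy hzw.symm p q r s
  have g4 := fun p q r s => gammaRatio_commute hzx.symm hwy.symm hxy hxw hzy.symm p q r s
  have k1 : Commute (permOp z x) (siteOp w y a' b' c' d') :=
    (h1.mul_right (h3 _ _)).mul_right (h2 _ _)
  have k2 : Commute (gammaRatio x z a b) (siteOp w y a' b' c' d') :=
    ((h5 a b).symm.mul_right (g4 _ _ _ _)).mul_right (g3 _ _ _ _)
  have k3 : Commute (gammaRatio z x c d) (siteOp w y a' b' c' d') :=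
    ((h4 c d).symm.mul_right (g2 _ _ _ _)).mul_right (g1 _ _ _ _)
  exact (k1.mul_left k2).mul_left k3

theorem commutesWithX_siteOp {z x l : σ} (hz : l ≠ z) (hx : l ≠ x) (a b c d : ℂ) :
    CommutesWithX (siteOp z x a b c d) l :=
  ((commutesWithX_permOp hz hx).mul (commutesWithX_gammaRatio hx _ _ _)).mul
    (commutesWithX_gammaRatio hz _ _ _)

theorem preservesDegree_siteOp (z x : σ) (a b c d : ℂ) : PreservesDegree (siteOp z x a b c d) :=
  ((preservesDegree_permOp _ _).mul (preservesDegree_gammaRatio _ _ _ _)).mul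
    (preservesDegree_gammaRatio _ _ _ _)

theorem rename_siteOp {τ : Type} [DecidableEq τ] {f : σ → τ} (hf : Function.Injective f) (z x : σ)
    (a b c d : ℂ) (p : MvPolynomial σ ℂ) :
    rename f (siteOp z x a b c d p) = siteOp (f z) (f x) a b c d (rename f p) := by
  simp only [siteOp, Module.End.mul_apply, rename_permOp hf, rename_gammaRatio hf]

/-- Permutations in a product of two operators are moved to the left. -/
theorem siteOp_mul_siteOp {x y z : σ} (hxy : x ≠ y) (hxz : x ≠ z) (a b c d a' b' c' d' : ℂ) :
    siteOp z x a b c d * siteOp z y a' b' c' d' = permOp z x * permOp z y *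
      (gammaRatio x y a b * gammaRatio y x c d * gammaRatio y z a' b' * gammaRatio z y c' d') := by
  have h1 := permOp_mul_gammaRatio z y x y a b
  have h2 := permOp_mul_gammaRatio z y y x c d
  rw [Equiv.swap_apply_right, Equiv.swap_apply_of_ne_of_ne hxz hxy] at h1 h2
  calc _ = permOp z x * (gammaRatio x z a b * (gammaRatio z x c d * permOp z y)) *
        gammaRatio y z a' b' * gammaRatio z y c' d' := by simp only [siteOp, mul_assoc]
    _ = _ := by
      rw [← h2, ← mul_assoc (gammaRatio x z a b), ← h1]
      simp only [mul_assoc]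

theorem gammaRatio_mul_permOp_mul_permOp {x y z : σ} (hxy : x ≠ y) (hyz : y ≠ z)
    (a b : ℂ) : gammaRatio x y a b * (permOp z x * permOp z y) =
      permOp z x * permOp z y * gammaRatio y z a b := by
  have h1 := permOp_mul_gammaRatio z x z y a b
  have h2 := permOp_mul_gammaRatio z y y z a b
  rw [Equiv.swap_apply_left, Equiv.swap_apply_of_ne_of_ne hyz hxy.symm] at h1
  rw [Equiv.swap_apply_right, Equiv.swap_apply_left] at h2
  rw [← mul_assoc, ← h1, mul_assoc, ← h2, mul_assoc]

theorem gammaRatio_mul_permOp_mul_permOp' {x y z : σ} (hxy : x ≠ y) (hyz : y ≠ z)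
    (a b : ℂ) : gammaRatio y x a b * (permOp z x * permOp z y) =
      permOp z x * permOp z y * gammaRatio z y a b := by
  have h1 := permOp_mul_gammaRatio z x y z a b
  have h2 := permOp_mul_gammaRatio z y z y a b
  rw [Equiv.swap_apply_left, Equiv.swap_apply_of_ne_of_ne hyz hxy.symm] at h1
  rw [Equiv.swap_apply_right, Equiv.swap_apply_left] at h2
  rw [← mul_assoc, ← h1, mul_assoc, ← h2, mul_assoc]

/-- The exchange of the parameters of two operators `R⁺`, in the presence of an operator `R⁻`. -/
theorem siteOp_exchange_plus {x y z : σ} (hxy : x ≠ y) (hxz : x ≠ z) (hyz : y ≠ z)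
    {m a b b' c c' : ℂ} (hm : NotGammaPole m) (hb : NotGammaPole b) (hb' : NotGammaPole b')
    (hc : NotGammaPole c) (hc' : NotGammaPole c') (h : a + b = m + c) (h' : a + b' = m + c') :
    gammaRatio x y c' c * (siteOp z x m b a m * siteOp z y m b' m m) =
      siteOp z x m b' a m * siteOp z y m b m m * gammaRatio x y c' c := by
  have M := gammaRatio_exchange_same hyz hxy.symm hm hb' hc' h'
  have M' := gammaRatio_exchange_same hyz hxy.symm hm hb hc h
  have B := gammaRatio_braid hxy hxz hyz hb hb' hc hc'
    (show b + c' = b' + c by linear_combination h - h') (show b + a = m + c by rw [← h, add_comm])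
  have E := gammaRatio_exchange hxy.symm hb' hb hc (show c + b' = c' + b by
    linear_combination h' - h)
  rw [siteOp_mul_siteOp hxy hxz, siteOp_mul_siteOp hxy hxz, ← mul_assoc,
    gammaRatio_mul_permOp_mul_permOp hxy hyz, mul_assoc (permOp z x * permOp z y),
    mul_assoc (permOp z x * permOp z y),
    gammaRatio_self hyz.symm hm, mul_one, mul_one]
  refine congrArg (permOp z x * permOp z y * ·) ?_
  -- `M` creates an R⁻ in y relative to x with parameters c' and b', the braid relation moves c'
  -- past, `E` recreates the intertwiner at the right end, and `M'` restores the original form.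
  calc _ = gammaRatio y z c' c * gammaRatio x y m b *
        (gammaRatio y x a m * gammaRatio y z m b') := by simp only [mul_assoc]
    _ = gammaRatio y z c' c * gammaRatio x y m b * gammaRatio y z a c' * gammaRatio y x c' b' := by
      rw [M]; simp only [mul_assoc]
    _ = gammaRatio x y m b' * gammaRatio y z a c * (gammaRatio x y b' b * gammaRatio y x c' b') := by
      rw [← B]; simp only [mul_assoc]
    _ = gammaRatio x y m b' * (gammaRatio y z a c * gammaRatio y x c b) * gammaRatio x y c' c := by
      rw [E]; simp only [mul_assoc]
    _ = _ := by rw [← M']; simp only [mul_assoc]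

/-- The exchange of the parameters of two operators `R⁻`, in the presence of an operator `R⁺`. -/
theorem siteOp_exchange_minus {x y z : σ} (hxy : x ≠ y) (hxz : x ≠ z) (hyz : y ≠ z)
    {m a a' b c c' : ℂ} (hm : NotGammaPole m) (ha' : NotGammaPole a') (hb : NotGammaPole b)
    (hc : NotGammaPole c) (hc' : NotGammaPole c') (h : a + b = m + c) (h' : a' + b = m + c') :
    gammaRatio y x c c' * (siteOp z x m m a m * siteOp z y m b a' m) =
      siteOp z x m m a' m * siteOp z y m b a m * gammaRatio y x c c' := by
  have E := gammaRatio_exchange hyz.symm hm hb hc' (show c' + m = a' + b by rw [h', add_comm])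
  have E' := gammaRatio_exchange hyz.symm hm hb hc (show c + m = a + b by rw [h, add_comm])
  have B := gammaRatio_braid hyz.symm hxz.symm hxy.symm hb hc' hm ha'
    (show b + a' = c' + m by rw [add_comm, h', add_comm])
    (show b + a = c + m by rw [add_comm, h, add_comm])
  have M := gammaRatio_exchange_same hyz hxy.symm ha' hc' hc
    (show a + c' = a' + c by linear_combination h - h')
  rw [siteOp_mul_siteOp hxy hxz, siteOp_mul_siteOp hxy hxz, ← mul_assoc,
    gammaRatio_mul_permOp_mul_permOp' hxy hyz, mul_assoc (permOp z x * permOp z y),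
    mul_assoc (permOp z x * permOp z y),
    gammaRatio_self hxy hm, one_mul, one_mul]
  refine congrArg (permOp z x * permOp z y * ·) ?_
  -- The same scheme with the opposite operators: exchange, braid, recreation of the intertwiner by
  -- `M`, and exchange back.
  calc _ = gammaRatio z y c c' * gammaRatio y x a m *
        (gammaRatio y z m b * gammaRatio z y a' m) := by simp only [mul_assoc]
    _ = gammaRatio z y c c' * gammaRatio y x a m * gammaRatio z y c' b * gammaRatio y z a' c' := by
      rw [E]; simp only [mul_assoc]
    _ = gammaRatio y x a' m * gammaRatio z y c b * (gammaRatio y x a a' * gammaRatio y z a' c') := by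
      rw [B]; simp only [mul_assoc]
    _ = gammaRatio y x a' m * (gammaRatio z y c b * gammaRatio y z a c) * gammaRatio y x c c' := by
      rw [M]; simp only [mul_assoc]
    _ = _ := by rw [← E']; simp only [mul_assoc]

end SiteOperators

/-! ### Reordering products over distinct sites -/

section Lists

variable {M κ : Type*} [Monoid M]

theorem list_prod_map_mul {A B : κ → M} (h : ∀ i j, i ≠ j → Commute (A i) (B j)) (l : List κ)
    (hl : l.Nodup) : (l.map A).prod * (l.map B).prod = (l.map fun k => A k * B k).prod := by
  induction l with
  | nil => simp
  | cons k l ih =>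
    rw [List.nodup_cons] at hl
    have hc : Commute (l.map A).prod (B k) := by
      refine Commute.list_prod_left _ _ fun x hx => ?_
      obtain ⟨i, hi, rfl⟩ := List.mem_map.mp hx
      refine h i k ?_
      rintro rfl
      exact hl.1 hi
    simp only [List.map_cons, List.prod_cons]
    rw [← ih hl.2, mul_assoc, ← mul_assoc _ (B k), hc.eq]
    simp only [mul_assoc]

/-- The train argument: an intertwiner common to all sites passes through the whole monodromy. -/
theorem mul_list_prod_map {T T' : κ → M} {S : M} (h : ∀ k, S * T k = T' k * S) (l : List κ) :
    S * (l.map T).prod = (l.map T').prod * S := by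
  induction l with
  | nil => simp
  | cons k l ih =>
    simp only [List.map_cons, List.prod_cons]
    rw [← mul_assoc, h, mul_assoc, ih, mul_assoc]

theorem rename_list_prod {σ τ : Type} {f : σ → τ} {T : κ → Module.End ℂ (MvPolynomial σ ℂ)}
    {T' : κ → Module.End ℂ (MvPolynomial τ ℂ)} (h : ∀ k p, rename f (T k p) = T' k (rename f p))
    (l : List κ) (p : MvPolynomial σ ℂ) :
    rename f ((l.map T).prod p) = (l.map T').prod (rename f p) := by
  induction l with
  | nil => simp
  | cons k l ih =>
    simp only [List.map_cons, List.prod_cons, Module.End.mul_apply, h, ih]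

end Lists

/-! ### Products of traces as traces over two auxiliary spaces -/

section TwoAuxiliarySpaces

open Finset.HasAntidiagonal

variable {N : ℕ}

/-- Eigenvalues multiply on a common eigenbasis. With c = a this provides the inverse of the
intertwiner. -/
theorem gammaRatio_mul_gammaRatio {σ : Type} [DecidableEq σ] {i j : σ} (hij : i ≠ j) (a c : ℂ)
    {b : ℂ} (hb : NotGammaPole b) :
    gammaRatio i j a b * gammaRatio i j b c = gammaRatio i j a c := by
  refine ext_of_commutesWithX i (fun l hl => (commutesWithX_gammaRatio hl j a b).mul
    (commutesWithX_gammaRatio hl j b c)) (fun l hl => commutesWithX_gammaRatio hl j a c) fun n => ?_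
  have e : (X i ^ n : MvPolynomial σ ℂ) = ((X i - X j) + X j) ^ n := by rw [sub_add_cancel]
  rw [e, add_pow, map_sum, map_sum]
  refine Finset.sum_congr rfl fun r _ => ?_
  have hmem : (X j ^ (n - r) * (n.choose r : MvPolynomial σ ℂ)) ∈ supported ℂ ({i}ᶜ : Set σ) :=
    mul_mem (pow_mem (X_mem_supported_compl hij.symm) _) (natCast_mem _ _)
  rw [mul_assoc, Module.End.mul_apply, gammaRatio, gammaRatio, gammaRatio,
    eulerFun_pow_mul hij _ _ hmem, eulerFun_pow_mul hij _ _ hmem, map_smul,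
    eulerFun_pow_mul hij _ _ hmem, smul_smul, mul_comm (pochRatio b c r), pochRatio_mul hb]

/-- The polynomial `z_0^p z_1^q Ψ(z_2, z_3, …)`. -/
noncomputable def blockInsert (x : ℕ × ℕ) (Ψ : MvPolynomial (Fin N) ℂ) :
    MvPolynomial (Fin (N + 2)) ℂ :=
  X 0 ^ x.1 * rename Fin.succ (X 0 ^ x.2 * rename Fin.succ Ψ)

/-- The coefficient of `z_0^p z_1^q`. -/
noncomputable def blockCoeff (x : ℕ × ℕ) :
    MvPolynomial (Fin (N + 2)) ℂ →ₗ[ℂ] MvPolynomial (Fin N) ℂ :=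
  auxCoeff x.2 ∘ₗ auxCoeff x.1

theorem blockCoeff_blockInsert (x y : ℕ × ℕ) (Ψ : MvPolynomial (Fin N) ℂ) :
    blockCoeff x (blockInsert y Ψ) = if x = y then Ψ else 0 := by
  rw [blockCoeff, LinearMap.comp_apply, blockInsert, auxCoeff_monomial]
  by_cases h1 : x.1 = y.1
  · rw [if_pos h1, auxCoeff_monomial]
    exact if_congr ⟨fun h2 => Prod.ext h1 h2, fun h => congrArg Prod.snd h⟩ rfl rfl
  · rw [if_neg h1, map_zero, if_neg fun h => h1 (congrArg Prod.fst h)]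

theorem block_induction {P : MvPolynomial (Fin (N + 2)) ℂ → Prop}
    (h : ∀ x Ψ, P (blockInsert x Ψ)) (hadd : ∀ p q, P p → P q → P (p + q))
    (p : MvPolynomial (Fin (N + 2)) ℂ) : P p := by
  refine aux_induction (fun j q => ?_) hadd p
  induction q using aux_induction with
  | h i q => exact h (j, i) q
  | hadd q r hq hr =>
    rw [map_add, mul_add]
    exact hadd _ _ hq hr

/-- The operator acts only on the first two variables, and preserves the degree in them: it is given
by matrices in the bases `z_0^p z_1^q`, `p + q = n`. -/
def HasBlockMatrix (S : Module.End ℂ (MvPolynomial (Fin (N + 2)) ℂ)) : Prop :=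
  ∃ s : ℕ × ℕ → ℕ × ℕ → ℂ, ∀ x Ψ,
    S (blockInsert x Ψ) = ∑ y ∈ antidiagonal (x.1 + x.2), s y x • blockInsert y Ψ

/-- The cyclicity of the trace over the two auxiliary spaces in each degree. -/
theorem HasBlockMatrix.sum_blockCoeff_mul_comm {S : Module.End ℂ (MvPolynomial (Fin (N + 2)) ℂ)}
    (hS : HasBlockMatrix S) (L : Module.End ℂ (MvPolynomial (Fin (N + 2)) ℂ)) (n : ℕ)
    (Ψ : MvPolynomial (Fin N) ℂ) :
    ∑ x ∈ antidiagonal n, blockCoeff x ((S * L) (blockInsert x Ψ)) =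
      ∑ x ∈ antidiagonal n, blockCoeff x ((L * S) (blockInsert x Ψ)) := by
  obtain ⟨s, hs⟩ := hS
  -- In degree n, S acts on coefficients through the same finite matrix s, so the claim is the
  -- cyclicity of a finite trace.
  have key : ∀ x ∈ antidiagonal n, ∀ p : MvPolynomial (Fin (N + 2)) ℂ,
      blockCoeff x (S p) = ∑ y ∈ antidiagonal n, s x y • blockCoeff y p := by
    intro x hx p
    rw [mem_antidiagonal] at hx
    induction p using block_induction with
    | h z Φ =>
      simp only [hs, map_sum, map_smul, blockCoeff_blockInsert, smul_ite, smul_zero,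
        Finset.sum_ite_eq, Finset.sum_ite_eq', mem_antidiagonal, hx]
      exact if_congr eq_comm rfl rfl
    | hadd p q hp hq => simp only [map_add, smul_add, Finset.sum_add_distrib, hp, hq]
  have h1 : ∀ x ∈ antidiagonal n, blockCoeff x ((S * L) (blockInsert x Ψ)) =
      ∑ y ∈ antidiagonal n, s x y • blockCoeff y (L (blockInsert x Ψ)) :=
    fun x hx => key x hx _
  have h2 : ∀ y ∈ antidiagonal n, blockCoeff y ((L * S) (blockInsert y Ψ)) =
      ∑ x ∈ antidiagonal n, s x y • blockCoeff y (L (blockInsert x Ψ)) := by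
    intro y hy
    rw [mem_antidiagonal] at hy
    simp only [Module.End.mul_apply, hs, map_sum, map_smul, hy]
  rw [Finset.sum_congr rfl h1, Finset.sum_congr rfl h2, Finset.sum_comm]

theorem exists_sum_antidiagonal {q : MvPolynomial (Fin 2) ℂ} {n : ℕ} (hq : q.IsHomogeneous n) :
    q = ∑ y ∈ antidiagonal n,
      coeff (Finsupp.cons y.1 (Finsupp.cons y.2 0)) q • (X 0 ^ y.1 * X 1 ^ y.2) := by
  have hmon : ∀ y : ℕ × ℕ, (X 0 ^ y.1 * X 1 ^ y.2 : MvPolynomial (Fin 2) ℂ) =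
      monomial (Finsupp.cons y.1 (Finsupp.cons y.2 0)) 1 := by
    intro y
    rw [monomial_cons, monomial_cons]
    simp
  have h1 : ∀ y : ℕ × ℕ, (Finsupp.cons y.1 (Finsupp.cons y.2 0) : Fin 2 →₀ ℕ) 1 = y.2 := fun y =>
    (Finsupp.cons_succ 0 y.1 _).trans (Finsupp.cons_zero y.2 0)
  conv_lhs => rw [← sum_degreeFinset hq]
  symm
  refine Finset.sum_bij' (fun y _ => Finsupp.cons y.1 (Finsupp.cons y.2 0))
    (fun t _ => (t 0, t 1)) ?_ ?_ ?_ ?_ ?_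
  · intro y hy
    rw [mem_degreeFinset, Finsupp.degree_eq_sum]
    rw [mem_antidiagonal] at hy
    simpa [Fin.sum_univ_two, h1] using hy
  · intro t ht
    rw [mem_degreeFinset, Finsupp.degree_eq_sum] at ht
    rw [mem_antidiagonal]
    simpa [Fin.sum_univ_two] using ht
  · intro y _
    simp [h1]
  · intro t _
    ext i
    fin_cases i <;> simp [h1 (t 0, t 1)]
  · intro y _
    rw [hmon]

/-- The operator is linear over the remaining variables, so its matrix is that of the homogeneous
operator in two variables. -/
theorem hasBlockMatrix_gammaRatio (i j : Fin 2) (a b : ℂ) :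
    HasBlockMatrix (N := N) (gammaRatio (Fin.castLE (by omega) i) (Fin.castLE (by omega) j) a b) := by
  set f : Fin 2 → Fin (N + 2) := Fin.castLE (by omega) with hf
  have hinj : Function.Injective f := Fin.castLE_injective _
  refine ⟨fun y x => coeff (Finsupp.cons y.1 (Finsupp.cons y.2 0))
    (gammaRatio i j a b (X 0 ^ x.1 * X 1 ^ x.2)), fun x Ψ => ?_⟩
  have hins : ∀ x : ℕ × ℕ, blockInsert x Ψ =
      rename Fin.succ (rename Fin.succ Ψ) * rename f (X 0 ^ x.1 * X 1 ^ x.2) := by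
    intro x
    have h0 : f 0 = 0 := rfl
    have h1 : f 1 = Fin.succ 0 := rfl
    rw [blockInsert]
    simp only [map_mul, map_pow, rename_X, h0, h1]
    ring
  have hcomm : ∀ q p, gammaRatio (f i) (f j) a b
      (rename Fin.succ (rename Fin.succ q : MvPolynomial (Fin (N + 1)) ℂ) * p) =
      rename Fin.succ (rename Fin.succ q) * gammaRatio (f i) (f j) a b p := by
    intro q
    induction q using MvPolynomial.induction_on with
    | C c =>
      intro p
      simp only [rename_C, ← smul_eq_C_mul, map_smul]
    | add p q hp hq =>
      intro r
      simp only [map_add, add_mul, hp, hq]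
    | mul_X p k hp =>
      intro r
      have hk : k.succ.succ ≠ f i := by
        intro h
        have := congrArg Fin.val h
        simp [hf] at this
        omega
      simp only [map_mul, rename_X, mul_assoc, hp]
      rw [commutesWithX_gammaRatio hk]
  have hhom : (X 0 ^ x.1 * X 1 ^ x.2 : MvPolynomial (Fin 2) ℂ).IsHomogeneous (x.1 + x.2) :=
    (isHomogeneous_X_pow _ _).mul (isHomogeneous_X_pow _ _)
  rw [hins, hcomm, ← rename_gammaRatio hinj]
  conv_lhs => rw [exists_sum_antidiagonal (preservesDegree_gammaRatio i j a b _ _ hhom)]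
  simp only [map_sum, map_smul, Finset.mul_sum, mul_smul_comm, ← hins]

theorem hasBlockMatrix_gammaRatio_zero_one (a b : ℂ) :
    HasBlockMatrix (N := N) (gammaRatio 0 1 a b) := hasBlockMatrix_gammaRatio 0 1 a b

theorem hasBlockMatrix_gammaRatio_one_zero (a b : ℂ) :
    HasBlockMatrix (N := N) (gammaRatio 1 0 a b) := hasBlockMatrix_gammaRatio 1 0 a b

/-- The embedding of the variables that omits `z_1`. -/
def skipOne : Fin (N + 1) → Fin (N + 2) := Fin.cons 0 fun k => k.succ.succ

theorem skipOne_zero : (skipOne 0 : Fin (N + 2)) = 0 := rfl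

theorem skipOne_injective : Function.Injective (skipOne : Fin (N + 1) → Fin (N + 2)) := by
  refine Fin.cons_injective_iff.mpr ⟨?_, (Fin.succ_injective _).comp (Fin.succ_injective _)⟩
  rintro ⟨k, hk⟩
  exact Fin.succ_ne_zero _ hk

/-- The matrix elements of a product of operators in the two auxiliary spaces. -/
theorem blockCoeff_mul {A B : Module.End ℂ (MvPolynomial (Fin (N + 1)) ℂ)}
    {A' B' : Module.End ℂ (MvPolynomial (Fin (N + 2)) ℂ)}
    (hA : ∀ p, rename skipOne (A p) = A' (rename skipOne p)) (hA1 : CommutesWithX A' 1)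
    (hB : ∀ p, rename Fin.succ (B p) = B' (rename Fin.succ p)) (hB0 : CommutesWithX B' 0)
    (x : ℕ × ℕ) (Ψ : MvPolynomial (Fin N) ℂ) :
    blockCoeff x ((A' * B') (blockInsert x Ψ)) = auxTerm A x.1 (auxTerm B x.2 Ψ) := by
  have hpow : ∀ {L : Module.End ℂ (MvPolynomial (Fin (N + 2)) ℂ)} {l : Fin (N + 2)},
      CommutesWithX L l → ∀ j p, L (X l ^ j * p) = X l ^ j * L p := fun {L l} h j p =>
    map_mul_of_mem_supported (s := {l}) (fun i hi p => by
      rw [Set.mem_singleton_iff.mp hi]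
      exact h p) (pow_mem (X_mem_supported.mpr (Set.mem_singleton _)) j) p
  have hskip : ∀ (m j : ℕ) (q : MvPolynomial (Fin (N + 1)) ℂ),
      auxCoeff m (X 1 ^ j * rename skipOne q) = X 0 ^ j * rename Fin.succ (auxCoeff m q) := by
    intro m j q
    have h1 : (X 1 ^ j : MvPolynomial (Fin (N + 2)) ℂ) = rename Fin.succ (X 0 ^ j) := by
      rw [map_pow, rename_X]
      rfl
    rw [h1, auxCoeff_rename_mul]
    congr 1
    induction q using aux_induction with
    | h i r =>
      have h2 : (rename skipOne (X 0 ^ i * rename Fin.succ r) : MvPolynomial (Fin (N + 2)) ℂ) =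
          X 0 ^ i * rename Fin.succ (rename Fin.succ r) := by
        rw [map_mul, map_pow, rename_X, skipOne_zero, rename_rename, rename_rename]
        rfl
      rw [h2, auxCoeff_monomial, auxCoeff_monomial]
      split_ifs
      · rfl
      · rw [map_zero]
    | hadd p q hp hq => simp only [map_add, hp, hq]
  -- A' commutes with z_1, so the coefficient of a power of z_1 may be taken before A' acts.
  have main : ∀ p : MvPolynomial (Fin (N + 1)) ℂ, blockCoeff x (A' (X 0 ^ x.1 * rename Fin.succ p)) =
      auxTerm A x.1 (auxCoeff x.2 p) := by
    intro p
    induction p using aux_induction with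
    | h j q =>
      have h1 : (X 0 ^ x.1 * rename Fin.succ (X 0 ^ j * rename Fin.succ q) :
          MvPolynomial (Fin (N + 2)) ℂ) =
          X 1 ^ j * rename skipOne (X 0 ^ x.1 * rename Fin.succ q) := by
        have e : (skipOne ∘ Fin.succ : Fin N → Fin (N + 2)) = Fin.succ ∘ Fin.succ := rfl
        simp only [map_mul, map_pow, rename_X, rename_rename, skipOne_zero, e, Fin.succ_zero_eq_one]
        ring
      rw [h1, hpow hA1, ← hA, blockCoeff, LinearMap.comp_apply, hskip, auxCoeff_monomial,
        auxCoeff_monomial, auxTerm_eq_auxCoeff]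
      split_ifs
      · rfl
      · simp
    | hadd p q hp hq => simp only [map_add, mul_add, hp, hq, auxTerm_add]
  rw [Module.End.mul_apply, blockInsert, hpow hB0, ← hB, main, auxTerm_eq_auxCoeff B]

theorem HasAuxTrace.isHomogeneous {A : Module.End ℂ (MvPolynomial (Fin (N + 1)) ℂ)}
    {B : Module.End ℂ (MvPolynomial (Fin N) ℂ)} (h : HasAuxTrace A B) (hA : PreservesDegree A)
    {d : ℕ} {Ψ : MvPolynomial (Fin N) ℂ} (hΨ : Ψ.IsHomogeneous d) : (B Ψ).IsHomogeneous d := by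
  intro s hs
  by_contra hw
  have hd : s.degree ≠ d := by rwa [Finsupp.degree_eq_weight_one]
  have hzero : ∀ m, coeff s (auxTerm A m Ψ) = 0 :=
    fun m => (hA.isHomogeneous_auxTerm hΨ m).coeff_eq_zero hd
  have := h Ψ s
  simp only [hzero] at this
  exact hs (this.unique hasSum_zero)

theorem sum_degreeFinset_mul {d : ℕ} {p : MvPolynomial (Fin N) ℂ} (hp : p.IsHomogeneous d)
    (φ : MvPolynomial (Fin N) ℂ →ₗ[ℂ] ℂ) :
    ∑ t ∈ degreeFinset N d, φ (monomial t 1) * coeff t p = φ p := by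
  conv_rhs => rw [← sum_degreeFinset hp]
  rw [map_sum]
  refine Finset.sum_congr rfl fun t _ => ?_
  rw [map_smul, smul_eq_mul, mul_comm]

theorem hasSum_mul_prod {f g : ℕ → ℂ} {a b : ℂ} (hf : HasSum f a) (hg : HasSum g b) :
    HasSum (fun x : ℕ × ℕ => f x.1 * g x.2) (a * b) :=
  hf.mul hg (summable_mul_of_summable_norm hf.summable.norm hg.summable.norm)

/-- The product of two traces as a double series. -/
theorem HasAuxTrace.hasSum_mul {A B : Module.End ℂ (MvPolynomial (Fin (N + 1)) ℂ)}
    {QA QB : Module.End ℂ (MvPolynomial (Fin N) ℂ)} (hA : HasAuxTrace A QA) (hB : HasAuxTrace B QB)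
    (hB' : PreservesDegree B) {d : ℕ} {Ψ : MvPolynomial (Fin N) ℂ}
    (hΨ : Ψ.IsHomogeneous d) (s : Fin N →₀ ℕ) :
    HasSum (fun x : ℕ × ℕ => coeff s (auxTerm A x.1 (auxTerm B x.2 Ψ)))
      (coeff s (QA (QB Ψ))) := by
  -- The intermediate polynomials have degree d, hence finitely many coefficients; for each, a
  -- product of two absolutely convergent series is an absolutely convergent double series.
  have h1 : ∀ t ∈ degreeFinset N d, HasSum (fun x : ℕ × ℕ =>
      coeff s (auxTerm A x.1 (monomial t 1)) * coeff t (auxTerm B x.2 Ψ))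
      (coeff s (QA (monomial t 1)) * coeff t (QB Ψ)) := fun t _ =>
    hasSum_mul_prod (f := fun m => coeff s (auxTerm A m (monomial t 1)))
      (g := fun m => coeff t (auxTerm B m Ψ)) (hA (monomial t 1) s) (hB Ψ t)
  have h2 := hasSum_sum h1
  have e1 : (fun x : ℕ × ℕ => ∑ t ∈ degreeFinset N d,
      coeff s (auxTerm A x.1 (monomial t 1)) * coeff t (auxTerm B x.2 Ψ)) =
      fun x => coeff s (auxTerm A x.1 (auxTerm B x.2 Ψ)) := by
    funext x
    exact sum_degreeFinset_mul (hB'.isHomogeneous_auxTerm hΨ x.2)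
      { toFun := fun p => coeff s (auxTerm A x.1 p)
        map_add' := fun p q => by rw [auxTerm_add, coeff_add]
        map_smul' := fun c p => by rw [auxTerm_smul, coeff_smul, RingHom.id_apply] }
  have e2 : ∑ t ∈ degreeFinset N d, coeff s (QA (monomial t 1)) * coeff t (QB Ψ) =
      coeff s (QA (QB Ψ)) :=
    sum_degreeFinset_mul (hB.isHomogeneous hB' hΨ) (lcoeff ℂ s ∘ₗ QA)
  rwa [e1, e2] at h2

theorem hasSum_antidiagonal {f : ℕ × ℕ → ℂ} {a : ℂ} (h : HasSum f a) :
    HasSum (fun n => ∑ x ∈ antidiagonal n, f x) a := by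
  have h1 := (sigmaAntidiagonalEquivProd (A := ℕ)).hasSum_iff.mpr h
  refine h1.sigma fun n => ?_
  have h2 := hasSum_fintype fun c : antidiagonal n => f c
  rw [Finset.sum_coe_sort (antidiagonal n) f] at h2
  exact h2

/-- Operators whose traces are products of traces over two auxiliary spaces coincide if the
operators under the traces are conjugate by an operator in these spaces. -/
theorem HasAuxTrace.mul_eq_mul {A B C D : Module.End ℂ (MvPolynomial (Fin (N + 1)) ℂ)}
    {QA QB QC QD : Module.End ℂ (MvPolynomial (Fin N) ℂ)} (hA : HasAuxTrace A QA)
    (hB : HasAuxTrace B QB) (hC : HasAuxTrace C QC) (hD : HasAuxTrace D QD)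
    (hB' : PreservesDegree B) (hD' : PreservesDegree D)
    {L M S S' : Module.End ℂ (MvPolynomial (Fin (N + 2)) ℂ)}
    (hL : ∀ x Ψ, blockCoeff x (L (blockInsert x Ψ)) = auxTerm A x.1 (auxTerm B x.2 Ψ))
    (hM : ∀ x Ψ, blockCoeff x (M (blockInsert x Ψ)) = auxTerm C x.1 (auxTerm D x.2 Ψ))
    (hS : HasBlockMatrix S) (hSS' : S' * S = 1) (hS'S : S * S' = 1) (h : S * L = M * S) :
    QA * QB = QC * QD := by
  have htr : ∀ n Ψ, ∑ x ∈ antidiagonal n, blockCoeff x (L (blockInsert x Ψ)) =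
      ∑ x ∈ antidiagonal n, blockCoeff x (M (blockInsert x Ψ)) := by
    intro n Ψ
    -- S (L S') = M and (L S') S = L, so cyclicity identifies the two finite traces.
    have h1 := hS.sum_blockCoeff_mul_comm (L * S') n Ψ
    rwa [← mul_assoc, h, mul_assoc, hS'S, mul_one, mul_assoc L, hSS', mul_one, eq_comm] at h1
  have hhom : ∀ (d : ℕ) (Ψ : MvPolynomial (Fin N) ℂ), Ψ.IsHomogeneous d →
      QA (QB Ψ) = QC (QD Ψ) := by
    intro d Ψ hΨ
    ext s
    have h1 := hasSum_antidiagonal (hA.hasSum_mul hB hB' hΨ s)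
    have h2 := hasSum_antidiagonal (hC.hasSum_mul hD hD' hΨ s)
    -- The double series need not agree term by term, only after summation over each total degree.
    simp only [← hL, ← hM, ← coeff_sum, htr] at h1 h2
    exact h1.unique h2
  refine LinearMap.ext fun Ψ => ?_
  induction Ψ using MvPolynomial.induction_on' with
  | monomial t c => exact hhom _ _ (isHomogeneous_monomial c rfl)
  | add p q hp hq => rw [map_add, map_add, hp, hq]

end TwoAuxiliarySpaces

/-! ### Exchange relations for the transfer operators -/

section Exchange

variable {N : ℕ}

/-- Operators at different sites and in different auxiliary spaces commute, so the two monodromies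
merge into one product over the sites. -/
theorem blockCoeff_siteOp (a b c d a' b' c' d' : Fin N → ℂ) (x : ℕ × ℕ)
    (Ψ : MvPolynomial (Fin N) ℂ) :
    blockCoeff x (((List.finRange N).map fun k =>
      siteOp (k.succ.succ : Fin (N + 2)) 0 (a k) (b k) (c k) (d k) *
        siteOp k.succ.succ 1 (a' k) (b' k) (c' k) (d' k)).prod (blockInsert x Ψ)) =
      auxTerm (monodromy fun k => siteOp k.succ 0 (a k) (b k) (c k) (d k)) x.1
        (auxTerm (monodromy fun k => siteOp k.succ 0 (a' k) (b' k) (c' k) (d' k)) x.2 Ψ) := by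
  have h0 : ∀ k : Fin N, (k.succ.succ : Fin (N + 2)) ≠ 0 := fun k => Fin.succ_ne_zero _
  have h1 : ∀ k : Fin N, (k.succ.succ : Fin (N + 2)) ≠ 1 :=
    fun k h => Fin.succ_ne_zero k (Fin.succ_injective _ h)
  have h01 : (0 : Fin (N + 2)) ≠ 1 := Fin.zero_ne_one
  have hs : ∀ i j : Fin N, i ≠ j → (i.succ.succ : Fin (N + 2)) ≠ j.succ.succ :=
    fun i j hij h => hij (Fin.succ_injective _ (Fin.succ_injective _ h))
  rw [← list_prod_map_mul (fun i j hij => siteOp_commute (h0 i) (h1 j) (hs i j hij) (h1 i)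
    (h0 j).symm h01 _ _ _ _ _ _ _ _) _ (List.nodup_finRange N), monodromy_eq, monodromy_eq]
  refine blockCoeff_mul (fun p => rename_list_prod (fun k p => ?_) _ p) ?_
    (fun p => rename_list_prod (fun k p => ?_) _ p) ?_ x Ψ
  · exact rename_siteOp skipOne_injective k.succ 0 _ _ _ _ p
  · refine CommutesWithX.list_prod _ fun T hT => ?_
    obtain ⟨k, -, rfl⟩ := List.mem_map.mp hT
    exact commutesWithX_siteOp (h1 k).symm h01.symm _ _ _ _
  · exact rename_siteOp (Fin.succ_injective _) k.succ 0 _ _ _ _ p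
  · refine CommutesWithX.list_prod _ fun T hT => ?_
    obtain ⟨k, -, rfl⟩ := List.mem_map.mp hT
    exact commutesWithX_siteOp (h0 k).symm h01 _ _ _ _

theorem preservesDegree_monodromy_siteOp (a b c d : Fin N → ℂ) :
    PreservesDegree (monodromy fun k => siteOp k.succ 0 (a k) (b k) (c k) (d k)) := by
  rw [monodromy_eq]
  refine PreservesDegree.list_prod _ fun T hT => ?_
  obtain ⟨k, -, rfl⟩ := List.mem_map.mp hT
  exact preservesDegree_siteOp _ _ _ _ _ _

variable {ℓ δ : Fin N → ℂ}

theorem siteR_eq_siteOp (u1 u2 : ℂ) : siteR ℓ δ u1 u2 = fun k =>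
    siteOp k.succ 0 (2 * ℓ k) (1 + ℓ k - (u1 + δ k)) (u2 + δ k + ℓ k) (2 * ℓ k) :=
  siteR_eq_plusSite_mul ℓ δ u1 u2

theorem siteRplus_eq_siteOp (hℓ : ∀ k, NotGammaPole (2 * ℓ k)) (u : ℂ) :
    siteRplus ℓ δ u = fun k =>
      siteOp k.succ 0 (2 * ℓ k) (1 + ℓ k - (u + δ k)) (2 * ℓ k) (2 * ℓ k) := by
  funext k
  rw [siteRplus, siteOp, gammaRatio_self (Fin.succ_ne_zero k) (hℓ k), mul_one]

theorem siteRminus_eq_siteOp (hℓ : ∀ k, NotGammaPole (2 * ℓ k)) (u : ℂ) :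
    siteRminus ℓ δ u = fun k =>
      siteOp k.succ 0 (2 * ℓ k) (2 * ℓ k) (u + δ k + ℓ k) (2 * ℓ k) := by
  funext k
  rw [siteRminus, siteOp, gammaRatio_self (Fin.succ_ne_zero k).symm (hℓ k), mul_one]

/-- The exchange of `u₁` and `v₁` in `Q(u₁|u₂) Q₊(v₁)` for generic `u₂`. -/
theorem opQ_mul_opQplus (hN : 0 < N) (hℓ : ∀ k, NotGammaPole (2 * ℓ k)) {u1 u2 v1 : ℂ}
    (hu : RegularAt ℓ δ u1) (hv : RegularAt ℓ δ v1) (hQu : AuxTraceExists (monQplus ℓ δ u1))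
    (hQv : AuxTraceExists (monQplus ℓ δ v1)) (hc : NotGammaPole (1 - u1 + u2))
    (hc' : NotGammaPole (1 - v1 + u2)) :
    opQ ℓ δ u1 u2 * opQplus ℓ δ v1 = opQ ℓ δ v1 u2 * opQplus ℓ δ u1 := by
  have h1 := ((auxTraceExists_monQ_iff hN hu u2).mpr hQu).hasAuxTrace
  have h2 := hQv.hasAuxTrace
  have h3 := ((auxTraceExists_monQ_iff hN hv u2).mpr hQv).hasAuxTrace
  have h4 := hQu.hasAuxTrace
  rw [← opQ, monQ, siteR_eq_siteOp] at h1 h3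
  rw [← opQplus, monQplus, siteRplus_eq_siteOp hℓ] at h2 h4
  have h01 : (0 : Fin (N + 2)) ≠ 1 := Fin.zero_ne_one
  refine HasAuxTrace.mul_eq_mul h1 h2 h3 h4 (preservesDegree_monodromy_siteOp _ _ _ _)
    (preservesDegree_monodromy_siteOp _ _ _ _) (blockCoeff_siteOp _ _ _ _ _ _ _ _)
    (blockCoeff_siteOp _ _ _ _ _ _ _ _)
    (hasBlockMatrix_gammaRatio_zero_one (1 - v1 + u2) (1 - u1 + u2))
    ((gammaRatio_mul_gammaRatio h01 _ _ hc').trans (gammaRatio_self h01 hc))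
    ((gammaRatio_mul_gammaRatio h01 _ _ hc).trans (gammaRatio_self h01 hc'))
    (mul_list_prod_map (fun k => ?_) _)
  -- With m = 2ℓ_k, a = u₂ + δ_k + ℓ_k and b = 1 + ℓ_k - u₁ - δ_k, the constant c = a + b - m is 1 -
  -- u₁ + u₂: neither ℓ_k nor δ_k remains. Q₊ enters as Q with a trivial R⁻ factor.
  refine siteOp_exchange_plus h01 (Fin.succ_ne_zero _).symm (fun h => Fin.succ_ne_zero k
    (Fin.succ_injective _ h.symm)) (hℓ k) (hu.notGammaPole k) (hv.notGammaPole k) hc hc' ?_ ?_ <;>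
  ring

/-- The exchange of `u₂` and `v₂` in `Q₋(u₂) Q(v₁|v₂)` for generic `u₂` and `v₂`. -/
theorem opQminus_mul_opQ (hN : 0 < N) (hℓ : ∀ k, NotGammaPole (2 * ℓ k)) {u2 v1 v2 : ℂ}
    (hv : RegularAt ℓ δ v1) (hQ : AuxTraceExists (monQplus ℓ δ v1))
    (hc : NotGammaPole (1 - v1 + u2)) (hc' : NotGammaPole (1 - v1 + v2))
    (ha : ∀ k, NotGammaPole (v2 + δ k + ℓ k)) :
    opQminus ℓ δ u2 * opQ ℓ δ v1 v2 = opQminus ℓ δ v2 * opQ ℓ δ v1 u2 := by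
  have hex : ∀ u, AuxTraceExists (monQminus ℓ δ u) :=
    fun u => ⟨_, hasAuxTrace_monQminus (k := ⟨0, hN⟩) rfl u⟩
  have h1 := (hex u2).hasAuxTrace
  have h2 := ((auxTraceExists_monQ_iff hN hv v2).mpr hQ).hasAuxTrace
  have h3 := (hex v2).hasAuxTrace
  have h4 := ((auxTraceExists_monQ_iff hN hv u2).mpr hQ).hasAuxTrace
  rw [← opQ, monQ, siteR_eq_siteOp] at h2 h4
  rw [← opQminus, monQminus, siteRminus_eq_siteOp hℓ] at h1 h3
  have h01 : (1 : Fin (N + 2)) ≠ 0 := Fin.zero_ne_one.symm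
  refine HasAuxTrace.mul_eq_mul h1 h2 h3 h4 (preservesDegree_monodromy_siteOp _ _ _ _)
    (preservesDegree_monodromy_siteOp _ _ _ _) (blockCoeff_siteOp _ _ _ _ _ _ _ _)
    (blockCoeff_siteOp _ _ _ _ _ _ _ _)
    (hasBlockMatrix_gammaRatio_one_zero (1 - v1 + u2) (1 - v1 + v2))
    ((gammaRatio_mul_gammaRatio h01 _ _ hc).trans (gammaRatio_self h01 hc'))
    ((gammaRatio_mul_gammaRatio h01 _ _ hc').trans (gammaRatio_self h01 hc))
    (mul_list_prod_map (fun k => ?_) _)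
  -- Again a + b - m loses its dependence on k; Q₋ enters with a trivial R⁺ factor.
  refine siteOp_exchange_minus h01.symm (Fin.succ_ne_zero _).symm (fun h => Fin.succ_ne_zero k
    (Fin.succ_injective _ h.symm)) (hℓ k) (ha k) (hv.notGammaPole k) hc hc' ?_ ?_ <;>
  ring

/-- Only Q₋(u₂) depends on u₂, and it does so continuously; the generic case is `opQ_mul_opQplus`
with Q factorized. -/
theorem opQplus_exchange (hN : 0 < N) (hℓ : ∀ k, NotGammaPole (2 * ℓ k)) {u1 v1 : ℂ}
    (hu : RegularAt ℓ δ u1) (hv : RegularAt ℓ δ v1) (hQu : AuxTraceExists (monQplus ℓ δ u1))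
    (hQv : AuxTraceExists (monQplus ℓ δ v1)) (u2 : ℂ) :
    opQplus ℓ δ u1 * cyclicShift N * opQminus ℓ δ u2 * opQplus ℓ δ v1 =
      opQplus ℓ δ v1 * cyclicShift N * opQminus ℓ δ u2 * opQplus ℓ δ u1 := by
  have hcont : ∀ A B : Module.End ℂ (MvPolynomial (Fin N) ℂ),
      ContMapAt u2 fun t => A * opQminus ℓ δ t * B := fun A B =>
    ((ContMapAt.const u2 A).mul (contMapAt_opQminus hN hℓ u2)).mul (ContMapAt.const u2 B)
  refine (hcont (opQplus ℓ δ u1 * cyclicShift N) (opQplus ℓ δ v1)).eq_of_countable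
    (hcont (opQplus ℓ δ v1 * cyclicShift N) (opQplus ℓ δ u1))
    ((countable_setOf_pole_add (1 - u1)).union (countable_setOf_pole_add (1 - v1))) fun t ht => ?_
  simp only [Set.mem_union, Set.mem_ofPred_eq, not_or, not_not] at ht
  have h := opQ_mul_opQplus hN hℓ hu hv hQu hQv ht.1 ht.2
  rwa [opQ_eq hN hQu, opQ_eq hN hQv] at h

theorem opQminus_exchange (hN : 0 < N) (hℓ : ∀ k, NotGammaPole (2 * ℓ k)) {v1 : ℂ}
    (hv : RegularAt ℓ δ v1) (hQ : AuxTraceExists (monQplus ℓ δ v1)) (u2 v2 : ℂ) :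
    opQminus ℓ δ u2 * opQplus ℓ δ v1 * cyclicShift N * opQminus ℓ δ v2 =
      opQminus ℓ δ v2 * opQplus ℓ δ v1 * cyclicShift N * opQminus ℓ δ u2 := by
  have hgen : ∀ s, NotGammaPole (1 - v1 + s) → ∀ t, NotGammaPole (1 - v1 + t) →
      (∀ k, NotGammaPole (t + δ k + ℓ k)) →
      opQminus ℓ δ s * opQplus ℓ δ v1 * cyclicShift N * opQminus ℓ δ t =
        opQminus ℓ δ t * opQplus ℓ δ v1 * cyclicShift N * opQminus ℓ δ s := by
    intro s hs t ht ha
    have h := opQminus_mul_opQ hN hℓ hv hQ hs ht ha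
    rw [opQ_eq hN hQ, opQ_eq hN hQ] at h
    simpa only [mul_assoc] using h
  have hcont : ∀ (t₀ : ℂ) (A : Module.End ℂ (MvPolynomial (Fin N) ℂ)),
      ContMapAt t₀ fun t => A * opQplus ℓ δ v1 * cyclicShift N * opQminus ℓ δ t := fun t₀ A =>
    (ContMapAt.const t₀ _).mul (contMapAt_opQminus hN hℓ t₀)
  have hcont' : ∀ (t₀ : ℂ) (A : Module.End ℂ (MvPolynomial (Fin N) ℂ)),
      ContMapAt t₀ fun t => opQminus ℓ δ t * opQplus ℓ δ v1 * cyclicShift N * A := fun t₀ A =>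
    (((contMapAt_opQminus hN hℓ t₀).mul (ContMapAt.const t₀ _)).mul (ContMapAt.const t₀ _)).mul
      (ContMapAt.const t₀ A)
  -- The conditions are removed one variable at a time: first u₂ is made generic with v₂ fixed, then
  -- v₂.
  refine (hcont' u2 _).eq_of_countable (hcont u2 _) (countable_setOf_pole_add (1 - v1))
    fun s hs => ?_
  simp only [Set.mem_ofPred_eq, not_not] at hs
  refine (hcont v2 _).eq_of_countable (hcont' v2 _)
    ((countable_setOf_pole_add (1 - v1)).union
      (Set.countable_iUnion fun k => countable_setOf_pole_add (δ k + ℓ k))) fun t ht => ?_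
  simp only [Set.mem_union, Set.mem_iUnion, Set.mem_ofPred_eq, not_or, not_exists, not_not] at ht
  refine hgen s hs t ht.1 fun k => ?_
  rw [add_assoc, add_comm]
  exact ht.2 k

end Exchange

/-! ### Assembly of the statements -/

theorem proposition10 (N : ℕ) (hN : 0 < N) (ℓ δ : Fin N → ℂ) (hℓ : ∀ k, NotGammaPole (2 * ℓ k)) :
    -- three-term relation with one `R⁻` and two `Ř`
    (∀ up um vp vm wp wm : ℂ, NotGammaPole (up - um) → NotGammaPole (vp - um) → NotGammaPole (wp - um) →
      NotGammaPole (vp - vm) →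
      (Rminus 0 1 vp vm wm * Rcheck 1 2 up um wp wm * Rcheck 0 1 up um vp vm :
          Module.End ℂ (MvPolynomial (Fin 3) ℂ)) =
        Rcheck 1 2 up um wp vm * Rcheck 0 1 up um vp wm * Rminus 1 2 vp vm wm) ∧
    -- three-term relation with one `R⁺` and two `Ř`
    (∀ up um vp vm wp wm : ℂ, NotGammaPole (up - um) → NotGammaPole (vp - um) → NotGammaPole (wp - um) →
      NotGammaPole (wp - wm) →
      (Rplus 0 1 vp wp wm * Rcheck 1 2 up um wp wm * Rcheck 0 1 up um vp vm :
          Module.End ℂ (MvPolynomial (Fin 3) ℂ)) =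
        Rcheck 1 2 up um vp wm * Rcheck 0 1 up um wp vm * Rplus 1 2 vp wp wm) ∧
    -- existence of the traces
    (∀ u : ℂ, AuxTraceExists (monQminus ℓ δ u)) ∧
    (∀ u1 : ℂ, RegularAt ℓ δ u1 → 1 < (∑ k, 2 * ℓ k).re → AuxTraceExists (monQplus ℓ δ u1)) ∧
    (∀ u1 u2 : ℂ, RegularAt ℓ δ u1 →
      (AuxTraceExists (monQ ℓ δ u1 u2) ↔ AuxTraceExists (monQplus ℓ δ u1))) ∧
    -- exchange relations
    (∀ u1 u2 v1 v2 : ℂ, RegularAt ℓ δ u1 → RegularAt ℓ δ v1 →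
      AuxTraceExists (monQ ℓ δ u1 u2) → AuxTraceExists (monQ ℓ δ v1 v2) →
      opQ ℓ δ u1 u2 * opQ ℓ δ v1 v2 = opQ ℓ δ v1 u2 * opQ ℓ δ u1 v2 ∧
      opQ ℓ δ u1 u2 * opQ ℓ δ v1 v2 = opQ ℓ δ u1 v2 * opQ ℓ δ v1 u2) ∧
    -- factorization
    (∀ u1 u2 : ℂ, RegularAt ℓ δ u1 → AuxTraceExists (monQplus ℓ δ u1) →
      opQ ℓ δ u1 u2 = opQplus ℓ δ u1 * cyclicShift N * opQminus ℓ δ u2) ∧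
    -- commutation relations of `Q₊`, `P`, `Q₋`
    (∀ u1 u2 v1 : ℂ, RegularAt ℓ δ u1 → RegularAt ℓ δ v1 →
      AuxTraceExists (monQplus ℓ δ u1) → AuxTraceExists (monQplus ℓ δ v1) →
      opQplus ℓ δ u1 * cyclicShift N * opQminus ℓ δ u2 * opQplus ℓ δ v1 =
        opQplus ℓ δ v1 * cyclicShift N * opQminus ℓ δ u2 * opQplus ℓ δ u1) ∧
    (∀ u2 v1 v2 : ℂ, RegularAt ℓ δ v1 → AuxTraceExists (monQplus ℓ δ v1) →
      opQminus ℓ δ u2 * opQplus ℓ δ v1 * cyclicShift N * opQminus ℓ δ v2 =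
        opQminus ℓ δ v2 * opQplus ℓ δ v1 * cyclicShift N * opQminus ℓ δ u2) := by
  refine ⟨fun up um vp vm wp wm hu hvu _ hv => Rminus_Rcheck_Rcheck hu hvu hv,
    fun up um vp vm wp wm hu hvu hwu hw => Rplus_Rcheck_Rcheck hu hvu hwu hw,
    fun u => ⟨_, hasAuxTrace_monQminus (k := ⟨0, hN⟩) rfl u⟩,
    fun u1 => auxTraceExists_monQplus, fun u1 u2 hu => auxTraceExists_monQ_iff hN hu u2,
    fun u1 u2 v1 v2 hu hv hQu hQv => ?_, fun u1 u2 _ hQ => opQ_eq hN hQ u2,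
    fun u1 u2 v1 hu hv hQu hQv => opQplus_exchange hN hℓ hu hv hQu hQv u2,
    fun u2 v1 v2 hv hQ => opQminus_exchange hN hℓ hv hQ u2 v2⟩
  have hu' := (auxTraceExists_monQ_iff hN hu u2).mp hQu
  have hv' := (auxTraceExists_monQ_iff hN hv v2).mp hQv
  have e1 := opQplus_exchange hN hℓ hu hv hu' hv' u2
  have e2 := opQminus_exchange hN hℓ hv hv' u2 v2
  -- After factorization, exchanging u₁ and v₁ is the first relation of (e) multiplied on the right
  -- by P Q₋(v₂), and exchanging u₂ and v₂ is the second one multiplied on the left by Q₊(u₁) P.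
  simp only [opQ_eq hN hu', opQ_eq hN hv']
  constructor
  · simpa only [mul_assoc] using congrArg (· * (cyclicShift N * opQminus ℓ δ v2)) e1
  · simpa only [mul_assoc] using congrArg (opQplus ℓ δ u1 * cyclicShift N * ·) e2
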